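/- **Theorem.** Let $p$ be a prime, $\mathbb F$ a field of characteristic $p$, and $\mathfrak g$ an abelian restricted Lie algebra over $\mathbb F$ (of any dimension) with $p$-operator $g\mapsto g^{[p]}$. Let $U=U_{\rm res}(\mathfrak g)$ be its restricted universal enveloping algebra, i.e. the quotient of $U(\mathfrak g)$ by the two-sided ideal generated by all $g^p-g^{[p]}$, let $\epsilon:U\to\mathbb F$ be the augmentation (the algebra map vanishing on $\mathfrak g$), and regard $\mathbb F$ as a trivial $U$-module through $\epsilon$. Let $\overline{\mathfrak g}=\mathbb F\otimes_{\mathrm{Frob}}\mathfrak g$ be the Frobenius twist, with its canonical $p$-semilinear map $g\mapsto\bar g$ (if $\mathbb F$ is perfect, $\overline{\mathfrak g}$ is the additive group $\mathfrak g$ on which $\lambda\in\mathbb F$ acts as $\lambda^{1/p}$). Fix a basis $(e_i)_{i\in I}$ of $\mathfrak g$; then $(\bar e_i)_{i\in I}$ is a basis of $\overline{\mathfrak g}$. For $k\ge 0$ put $$C_{t,s}=S^t\overline{\mathfrak g}\otimes\Lambda^s\mathfrak g\otimes U,\qquad C_k=\bigoplus_{2t+s=k}C_{t,s},$$ so that $C_0=U$,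 and let $d_k:C_k\to C_{k-1}$ $(k\ge 1)$ be the $U$-linear map given on $C_{t,s}$, for $h_1,\dots,h_t$ in the basis $(e_i)$, $g_1,\dots,g_s\in\mathfrak g$ and $x\in U$, by $$\begin{aligned} d(\bar h_1\cdots \bar h_t\otimes g_1\wedge\cdots\wedge g_s\otimes x)={}&\sum_{i=1}^s(-1)^{i-1}\,\bar h_1\cdots \bar h_t\otimes g_1\wedge\cdots\widehat{g_i}\cdots\wedge g_s\otimes g_ix\\ &+\sum_{j=1}^t \bar h_1\cdots\widehat{\bar h_j}\cdots \bar h_t\otimes h_j^{[p]}\wedge g_1\wedge\cdots\wedge g_s\otimes x\\ &-\sum_{j=1}^t \bar h_1\cdots\widehat{\bar h_j}\cdots \bar h_t\otimes h_j\wedge g_1\wedge\cdots\wedge g_s\otimes h_j^{p-1}x. \end{aligned}$$ (The formula is used on monomials in the chosen basis vectors and extended linearly.) Then: 1. $\{C_k,d_k\}$ is an augmented complex of free $U$-modules: every $C_k$ is free over $U$, $d_kd_{k+1}=0$ for all $k\ge1$, and $\epsilon d_1=0$. 2. The augmented complex $C_*\to\mathbb F\to 0$ is exact in degrees $0\le k<p$: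 $\epsilon:C_0\to\mathbb F$ is surjective, $\operatorname{Ker}\epsilon=\operatorname{Im}d_1$, and $\operatorname{Ker}d_k=\operatorname{Im}d_{k+1}$ for $0<k<p$. 3. For a $U$-module $M$ (equivalently, a restricted $\mathfrak g$-module) put $$H^k(\mathfrak g;M)=\frac{\operatorname{Ker}\bigl(\operatorname{Hom}_U(C_k,M)\to\operatorname{Hom}_U(C_{k+1},M)\bigr)}{\operatorname{Im}\bigl(\operatorname{Hom}_U(C_{k-1},M)\to\operatorname{Hom}_U(C_k,M)\bigr)},\qquad C_{-1}=0.$$ For every $0\le k<p$ there is an $\mathbb F$-linear isomorphism, natural in $M$, $$H^k(\mathfrak g;M)\cong\operatorname{Ext}^k_U(\mathbb F,M).$$ -/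

import Mathlib

open scoped TensorProduct DirectSum ModuleCat
open Module

universe u

/-! ## Restricted Lie algebras -/

/-- A restricted Lie algebra of characteristic `p` over `F`: a Lie algebra with a `p`-operator
`g ↦ g^[p]`. In `pMap_add` the sequences `(g₁, …, g_p)` with `g₁ = g`, `g₂ = h` and every other
entry equal to `g` or `h` are indexed by `c : Fin (p - 2) → Bool` (`true` stands for `g`), the
number of `g`'s is `1 + #{i | c i = true}`, and the summand is the left-normed iterated bracket
`[[[g₁, g₂], g₃], …, g_p]`. -/
class RestrictedLieAlgebra (F : Type*) (p : ℕ) (L : Type*)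
    [Field F] [LieRing L] [LieAlgebra F L] where
  /-- The `p`-operator. -/
  pMap : L → L
  pMap_smul : ∀ (a : F) (g : L), pMap (a • g) = a ^ p • pMap g
  pMap_add : ∀ g h : L, pMap (g + h) = pMap g + pMap h +
    ∑ c : Fin (p - 2) → Bool,
      ((1 + (Finset.univ.filter fun i => c i = true).card : ℕ) : F)⁻¹ •
        (List.ofFn fun i => if c i = true then g else h).foldl (fun x y => ⁅x, y⁆) ⁅g, h⁆
  lie_pMap : ∀ g h : L, ⁅g, pMap h⁆ = (fun x => ⁅x, h⁆)^[p] g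

/-! ## The restricted universal enveloping algebra -/

section Enveloping

attribute [local instance] LieRing.ofAssociativeRing

variable (F : Type*) (p : ℕ) (L : Type*) [Field F] [LieRing L] [LieAlgebra F L]
  [RestrictedLieAlgebra F p L]

/-- The relations `g ^ p = g^[p]` in the universal enveloping algebra. -/
inductive RestrictedUEA.Rel :
    UniversalEnvelopingAlgebra F L → UniversalEnvelopingAlgebra F L → Prop
  | pow_eq (g : L) : RestrictedUEA.Rel (UniversalEnvelopingAlgebra.ι F g ^ p)
      (UniversalEnvelopingAlgebra.ι F (RestrictedLieAlgebra.pMap F p g))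

/-- The restricted universal enveloping algebra: the quotient of the universal enveloping algebra
by the two-sided ideal generated by all `g ^ p - g^[p]`. -/
def RestrictedUEA : Type _ := RingQuot (RestrictedUEA.Rel F p L)

namespace RestrictedUEA

noncomputable instance : Ring (RestrictedUEA F p L) :=
  inferInstanceAs (Ring (RingQuot (RestrictedUEA.Rel F p L)))

noncomputable instance : Algebra F (RestrictedUEA F p L) :=
  inferInstanceAs (Algebra F (RingQuot (RestrictedUEA.Rel F p L)))

/-- The quotient map from the universal enveloping algebra. -/
noncomputable def mk : UniversalEnvelopingAlgebra F L →ₐ[F] RestrictedUEA F p L :=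
  RingQuot.mkAlgHom F (RestrictedUEA.Rel F p L)

/-- The canonical map from the Lie algebra to its restricted universal enveloping algebra. -/
noncomputable def ι : L →ₗ[F] RestrictedUEA F p L :=
  (mk F p L).toLinearMap ∘ₗ (UniversalEnvelopingAlgebra.ι F : L →ₗ⁅F⁆ _).toLinearMap

theorem ι_pow (g : L) :
    ι F p L g ^ p = ι F p L (RestrictedLieAlgebra.pMap F p g) := by
  have h := RingQuot.mkAlgHom_rel F (RestrictedUEA.Rel.pow_eq (F := F) (p := p) g)
  rw [map_pow] at h
  exact h

theorem ι_lie (g h : L) :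
    ι F p L ⁅g, h⁆ = ι F p L g * ι F p L h - ι F p L h * ι F p L g := by
  change mk F p L (UniversalEnvelopingAlgebra.ι F ⁅g, h⁆) =
    mk F p L (UniversalEnvelopingAlgebra.ι F g) * mk F p L (UniversalEnvelopingAlgebra.ι F h) -
    mk F p L (UniversalEnvelopingAlgebra.ι F h) * mk F p L (UniversalEnvelopingAlgebra.ι F g)
  rw [LieHom.map_lie, LieRing.of_associative_ring_bracket, map_sub, map_mul, map_mul]

/-- If the Lie algebra is abelian, so is its restricted universal enveloping algebra. -/
theorem mul_comm_of_abelian [IsLieAbelian L] (x y : RestrictedUEA F p L) : x * y = y * x := by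
  have hmk : Function.Surjective
      ((mk F p L).comp (UniversalEnvelopingAlgebra.mkAlgHom F L)) :=
    (RingQuot.mkAlgHom_surjective F _).comp Quotient.mk_surjective
  have key : ∀ (g : L) (a : TensorAlgebra F L),
      Commute (ι F p L g) ((mk F p L).comp (UniversalEnvelopingAlgebra.mkAlgHom F L) a) := by
    intro g a
    induction a using TensorAlgebra.induction with
    | algebraMap r => rw [AlgHom.commutes]; exact Algebra.commute_algebraMap_right _ _
    | ι h =>
      have := ι_lie F p L g h
      rw [trivial_lie_zero, map_zero] at this
      exact (sub_eq_zero.mp this.symm)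
    | mul a b ha hb => rw [map_mul]; exact ha.mul_right hb
    | add a b ha hb => rw [map_add]; exact ha.add_right hb
  obtain ⟨b, rfl⟩ := hmk y
  obtain ⟨a, rfl⟩ := hmk x
  change Commute _ _
  induction a using TensorAlgebra.induction with
  | algebraMap r => rw [AlgHom.commutes]; exact Algebra.commute_algebraMap_left _ _
  | ι h => exact key h b
  | mul a c ha hc => rw [map_mul]; exact ha.mul_left hc
  | add a c ha hc => rw [map_add]; exact ha.add_left hc

/-- The `U_res(L)`-linear extension `x ⊗ n ↦ x • f n` of an `F`-linear map `f`. -/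
noncomputable def extend {N Q : Type*} [AddCommMonoid N] [Module F N] [AddCommMonoid Q] [Module F Q]
    [Module (RestrictedUEA F p L) Q] [IsScalarTower F (RestrictedUEA F p L) Q] (f : N →ₗ[F] Q) :
    RestrictedUEA F p L ⊗[F] N →ₗ[RestrictedUEA F p L] Q :=
  TensorProduct.AlgebraTensorModule.lift
    (LinearMap.toSpanSingleton (RestrictedUEA F p L) (N →ₗ[F] Q) f)

theorem extend_tmul {N Q : Type*} [AddCommMonoid N] [Module F N] [AddCommMonoid Q] [Module F Q]
    [Module (RestrictedUEA F p L) Q] [IsScalarTower F (RestrictedUEA F p L) Q] (f : N →ₗ[F] Q)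
    (x : RestrictedUEA F p L) (n : N) : extend F p L f (x ⊗ₜ n) = x • f n := rfl

variable [Fact p.Prime]

/-- The augmentation `ε : U_res(L) → F`, the algebra map that vanishes on `L`. -/
noncomputable def aug : RestrictedUEA F p L →ₐ[F] F :=
  RingQuot.liftAlgHom F ⟨UniversalEnvelopingAlgebra.lift F (0 : L →ₗ⁅F⁆ F), by
    rintro _ _ ⟨g⟩
    rw [map_pow, UniversalEnvelopingAlgebra.lift_ι_apply, UniversalEnvelopingAlgebra.lift_ι_apply]
    exact zero_pow (Fact.out : p.Prime).ne_zero⟩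

theorem aug_ι (g : L) : aug F p L (ι F p L g) = 0 := by
  have : aug F p L (mk F p L (UniversalEnvelopingAlgebra.ι F g)) =
      UniversalEnvelopingAlgebra.lift F (0 : L →ₗ⁅F⁆ F) (UniversalEnvelopingAlgebra.ι F g) :=
    RingQuot.liftAlgHom_mkAlgHom_apply F _ _ _
  rw [UniversalEnvelopingAlgebra.lift_ι_apply] at this
  exact this

/-- The ground field as a trivial `U_res(L)`-module. -/
@[nolint unusedArguments]
def Triv (F : Type*) (p : ℕ) (L : Type*) [Field F] [LieRing L] [LieAlgebra F L]
    [RestrictedLieAlgebra F p L] [Fact p.Prime] : Type _ := F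

noncomputable instance : AddCommGroup (Triv F p L) := inferInstanceAs (AddCommGroup F)

noncomputable instance : Module F (Triv F p L) := inferInstanceAs (Module F F)

/-- `U_res(L)` acts on the trivial module through the augmentation. -/
noncomputable instance : Module (RestrictedUEA F p L) (Triv F p L) :=
  Module.compHom F (aug F p L).toRingHom

theorem smul_triv_def (x : RestrictedUEA F p L) (a : Triv F p L) :
    x • a = ((aug F p L x * (show F from a) : F) : Triv F p L) := rfl

instance : IsScalarTower F (RestrictedUEA F p L) (Triv F p L) where
  smul_assoc a x b := by
    rw [smul_triv_def, smul_triv_def, map_smul, smul_eq_mul, mul_assoc]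
    rfl

end RestrictedUEA

end Enveloping

/-! ## The Frobenius twist -/

section Twist

variable (F : Type*) [Field F] (p : ℕ) [Fact p.Prime] [CharP F p]

/-- A copy of `F`, regarded as an `F`-algebra through the Frobenius map `a ↦ a ^ p`. -/
@[nolint unusedArguments]
def FrobField (F : Type*) (_p : ℕ) : Type _ := F

noncomputable instance : Field (FrobField F p) := inferInstanceAs (Field F)

/-- The identity map, as an isomorphism of `F` onto its copy. -/
noncomputable def FrobField.equiv : F ≃+* FrobField F p := RingEquiv.refl F

noncomputable instance : Algebra F (FrobField F p) :=
  ((FrobField.equiv F p).toRingHom.comp (frobenius F p)).toAlgebra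

theorem FrobField.algebraMap_apply (a : F) :
    algebraMap F (FrobField F p) a = FrobField.equiv F p (a ^ p) := rfl

variable (V : Type*) [AddCommGroup V] [Module F V]

/-- The Frobenius twist `V̄ = F ⊗_{Frob} V`, generated over `F` by symbols `v̄` additive in `v`
with `(a v)‾ = a ^ p v̄`; linear maps out of it are the `p`-semilinear maps out of `V`. -/
def FrobTwist : Type _ := FrobField F p ⊗[F] V

noncomputable instance : AddCommGroup (FrobTwist F p V) :=
  inferInstanceAs (AddCommGroup (FrobField F p ⊗[F] V))

noncomputable instance : Module (FrobField F p) (FrobTwist F p V) :=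
  inferInstanceAs (Module (FrobField F p) (FrobField F p ⊗[F] V))

/-- `F` acts by multiplication on the left factor (not through the Frobenius map). -/
noncomputable instance : Module F (FrobTwist F p V) :=
  Module.compHom (FrobTwist F p V) (FrobField.equiv F p).toRingHom

namespace FrobTwist

/-- The defining identification of the twist with a tensor product. -/
noncomputable def tensorEquiv : FrobField F p ⊗[F] V ≃ₗ[FrobField F p] FrobTwist F p V :=
  LinearEquiv.refl _ _

theorem smul_def (a : F) (x : FrobTwist F p V) : a • x = FrobField.equiv F p a • x := rfl

/-- The canonical `p`-semilinear map `v ↦ v̄`. -/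
noncomputable def of : V →+ FrobTwist F p V where
  toFun v := tensorEquiv F p V (1 ⊗ₜ[F] v)
  map_zero' := by rw [TensorProduct.tmul_zero, map_zero]
  map_add' v w := by rw [TensorProduct.tmul_add, map_add]

theorem of_apply (v : V) : of F p V v = tensorEquiv F p V (1 ⊗ₜ[F] v) := rfl

theorem smul_of (a : F) (v : V) :
    a • of F p V v = tensorEquiv F p V (FrobField.equiv F p a ⊗ₜ[F] v) := by
  rw [smul_def, of_apply, ← map_smul, TensorProduct.smul_tmul', smul_eq_mul, mul_one]

theorem of_smul (a : F) (v : V) : of F p V (a • v) = a ^ p • of F p V v := by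
  rw [smul_of, of_apply, ← TensorProduct.smul_tmul, Algebra.smul_def, mul_one,
    FrobField.algebraMap_apply]

/-- Over a perfect field the twist is `V` itself, with `a` acting as `a ^ (1 / p)`. -/
theorem of_bijective [PerfectRing F p] : Function.Bijective (of F p V) := by
  constructor
  · exact (tensorEquiv F p V).injective.comp
      (Module.FaithfullyFlat.tensorProduct_mk_injective (A := F) (B := FrobField F p) V)
  · intro x
    obtain ⟨y, rfl⟩ := (tensorEquiv F p V).surjective x
    induction y using TensorProduct.induction_on with
    | zero => exact ⟨0, by rw [map_zero, map_zero]⟩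
    | tmul a v =>
      obtain ⟨b, rfl⟩ := (FrobField.equiv F p).surjective a
      obtain ⟨c, rfl⟩ := (frobeniusEquiv F p).surjective b
      refine ⟨c • v, ?_⟩
      rw [of_smul, smul_of]
      rfl
    | add x y hx hy =>
      obtain ⟨a, ha⟩ := hx
      obtain ⟨b, hb⟩ := hy
      exact ⟨a + b, by rw [map_add, map_add, ha, hb]⟩

variable {V} {I : Type*}

/-- The basis `(ē i)` of the twist induced by a basis `(e i)`. -/
noncomputable def basis (e : Basis I F V) : Basis I F (FrobTwist F p V) :=
  ((Algebra.TensorProduct.basis (FrobField F p) e).map (tensorEquiv F p V)).mapCoeffs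
    (FrobField.equiv F p).symm fun c x => by rw [smul_def, RingEquiv.apply_symm_apply]

theorem basis_apply (e : Basis I F V) (i : I) : basis F p e i = of F p V (e i) := by
  rw [basis, Basis.mapCoeffs_apply, Basis.map_apply, Algebra.TensorProduct.basis_apply, of_apply]

end FrobTwist

end Twist

/-! ## Symmetric powers and their monomial bases -/

section SymmetricPowers

variable (F : Type*) [Field F] (V : Type*) [AddCommGroup V] [Module F V]

/-- The symmetric power `S^t V`, as the degree-`t` part of the symmetric algebra. -/
def symPow (t : ℕ) : Submodule F (SymmetricAlgebra F V) :=
  (LinearMap.range (SymmetricAlgebra.ι F V)) ^ t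

variable {F V} {I : Type*}

/-- The monomial `e_{i₁} ⋯ e_{i_t}` attached to an unordered `t`-tuple of indices. -/
noncomputable def symMonomial (e : Basis I F V) {t : ℕ} (m : Sym I t) : symPow F V t :=
  ⟨((m : Multiset I).map fun i => SymmetricAlgebra.ι F V (e i)).prod, by
    obtain ⟨s, rfl⟩ := m
    induction s using Multiset.induction_on with
    | empty => exact Submodule.one_le.mp le_rfl
    | cons a s ih =>
      simp only [Sym.coe_mk, Multiset.map_cons, Multiset.prod_cons, Multiset.card_cons, symPow,
        pow_succ'] at ih ⊢
      exact Submodule.mul_mem_mul (LinearMap.mem_range_self _ _) ih⟩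

theorem symMonomial_coe (e : Basis I F V) {t : ℕ} (m : Sym I t) :
    (symMonomial e m : SymmetricAlgebra F V) =
      ((m : Multiset I).map fun i => SymmetricAlgebra.ι F V (e i)).prod := rfl

theorem symMonomial_linearIndependent (e : Basis I F V) (t : ℕ) :
    LinearIndependent F (symMonomial e (t := t)) := by
  classical
  refine LinearIndependent.of_comp (symPow F V t).subtype ?_
  have h : (symPow F V t).subtype ∘ symMonomial e (t := t) =
      e.symmetricAlgebra ∘ fun m : Sym I t => Multiset.toFinsupp (m : Multiset I) := by
    funext m
    simp only [Function.comp_apply, Submodule.subtype_apply, symMonomial_coe,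
      Basis.symmetricAlgebra, Basis.map_apply, MvPolynomial.coe_basisMonomials]
    rw [AlgEquiv.toLinearEquiv_apply, AlgEquiv.eq_symm_apply, map_multiset_prod, Multiset.map_map]
    simp only [Function.comp_def, SymmetricAlgebra.equivMvPolynomial_ι_apply]
    generalize (m : Multiset I) = s
    induction s using Multiset.induction_on with
    | empty => simp
    | cons a s ih =>
      rw [Multiset.map_cons, Multiset.prod_cons, ih, ← Multiset.singleton_add, map_add,
        Multiset.toFinsupp_singleton, MvPolynomial.X, MvPolynomial.monomial_mul, one_mul]
  rw [h]
  exact e.symmetricAlgebra.linearIndependent.comp _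
    (Multiset.toFinsupp.injective.comp Sym.coe_injective)

theorem symMonomial_span (e : Basis I F V) (t : ℕ) :
    ⊤ ≤ Submodule.span F (Set.range (symMonomial e (t := t))) := by
  have key : ∀ n : ℕ, symPow F V n ≤ Submodule.span F
      (Set.range fun m : Sym I n => (symMonomial e m : SymmetricAlgebra F V)) := by
    intro n
    induction n with
    | zero =>
      change LinearMap.range (SymmetricAlgebra.ι F V) ^ 0 ≤ _
      rw [pow_zero, Submodule.one_eq_span, Submodule.span_le, Set.singleton_subset_iff]
      exact Submodule.subset_span ⟨Sym.nil, by simp [symMonomial_coe]⟩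
    | succ n ih =>
      have hr : LinearMap.range (SymmetricAlgebra.ι F V) =
          Submodule.span F (Set.range fun i => SymmetricAlgebra.ι F V (e i)) := by
        rw [LinearMap.range_eq_map, ← e.span_eq, Submodule.map_span, ← Set.range_comp]
        rfl
      change LinearMap.range (SymmetricAlgebra.ι F V) ^ (n + 1) ≤ _
      rw [pow_succ']
      change _ * symPow F V n ≤ _
      rw [hr]
      have h2 := mul_le_mul' (le_refl (Submodule.span F
        (Set.range fun i => SymmetricAlgebra.ι F V (e i)))) ih
      rw [Submodule.span_mul_span] at h2
      refine le_trans h2 (Submodule.span_mono ?_)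
      rintro _ ⟨_, ⟨i, rfl⟩, _, ⟨m, rfl⟩, rfl⟩
      exact ⟨i ::ₛ m, by simp [symMonomial_coe, Sym.coe_cons]⟩
  rw [← Submodule.map_le_map_iff_of_injective (symPow F V t).injective_subtype, Submodule.map_span,
    ← Set.range_comp, Submodule.map_top, Submodule.range_subtype]
  exact key t

/-- The monomials of degree `t` in the vectors of a basis form a basis of `S^t V`. -/
noncomputable def symBasis (e : Basis I F V) (t : ℕ) : Basis (Sym I t) F (symPow F V t) :=
  Basis.mk (symMonomial_linearIndependent e t) (symMonomial_span e t)

end SymmetricPowers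

/-! ## The complex -/

section Complex

variable (F : Type*) [Field F] (p : ℕ) [Fact p.Prime] [CharP F p]
  {L : Type*} [LieRing L] [LieAlgebra F L] [RestrictedLieAlgebra F p L]

namespace AbelianComplex

open RestrictedUEA

variable (L) in
/-- `C_{t,s} = S^t L̄ ⊗ Λ^s L ⊗ U_res(L)`, with the factor `U_res(L)` written on the left, where
Mathlib puts the `U_res(L)`-module structure. -/
abbrev Term (t s : ℕ) : Type _ :=
  RestrictedUEA F p L ⊗[F] (symPow F (FrobTwist F p L) t ⊗[F] ⋀[F]^s L)

/-- `L → (Λ^s L → U_res(L) ⊗ Λ^s L)`, `g ↦ (ω ↦ g ⊗ ω)`, as a family of alternating maps. -/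
noncomputable def koszulAux (s : ℕ) :
    L →ₗ[F] L [⋀^Fin s]→ₗ[F] (RestrictedUEA F p L ⊗[F] ⋀[F]^s L) where
  toFun g := (TensorProduct.mk F (RestrictedUEA F p L) (⋀[F]^s L)
    (RestrictedUEA.ι F p L g)).compAlternatingMap (exteriorPower.ιMulti F s)
  map_add' g h := by ext v; simp
  map_smul' a g := by ext v; simp [TensorProduct.smul_tmul']

/-- `g₁ ∧ ⋯ ∧ g_{s+1} ↦ ∑ i, (-1)^(i-1) g_i ⊗ (g₁ ∧ ⋯ ĝ_i ⋯ ∧ g_{s+1})`. -/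
noncomputable def koszul (s : ℕ) : ⋀[F]^(s + 1) L →ₗ[F] RestrictedUEA F p L ⊗[F] ⋀[F]^s L :=
  exteriorPower.alternatingMapLinearEquiv (AlternatingMap.alternatizeUncurryFin (koszulAux F p s))

variable (L) in
/-- The part `C_{t,s+1} → C_{t,s}` of the differential. -/
noncomputable def dK (t s : ℕ) : Term F p L t (s + 1) →ₗ[RestrictedUEA F p L] Term F p L t s :=
  extend F p L
    (TensorProduct.lift ((LinearMap.lTensorHom (RestrictedUEA F p L) ∘ₗ
      TensorProduct.mk F (symPow F (FrobTwist F p L) t) (⋀[F]^s L)).compl₂ (koszul F p s)))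

/-- Left exterior multiplication `ω ↦ g ∧ ω`. -/
noncomputable def wedge (s : ℕ) (g : L) : ⋀[F]^s L →ₗ[F] ⋀[F]^(s + 1) L :=
  ((LinearMap.mulLeft F (ExteriorAlgebra.ι F g)).comp (⋀[F]^s L).subtype).codRestrict _
    fun ω => by
      change _ ∈ LinearMap.range (ExteriorAlgebra.ι F) ^ (s + 1)
      rw [pow_succ']
      exact Submodule.mul_mem_mul (LinearMap.mem_range_self _ _) ω.2

theorem wedge_ιMulti (s : ℕ) (g : L) (v : Fin s → L) :
    wedge F s g (exteriorPower.ιMulti F s v) =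
      exteriorPower.ιMulti F (s + 1) (Fin.cons g v : Fin (s + 1) → L) := by
  apply Subtype.ext
  simp [wedge, ExteriorAlgebra.ιMulti_succ_apply, Matrix.vecTail, Function.comp_def]

variable {I : Type*} (e : Basis I F L)

open Classical in
/-- For the monomial `e_{j₁} ⋯ e_{j_{t+1}}`, the map sending `ω` to
`∑ i, e_{j₁} ⋯ ê_{j_i} ⋯ e_{j_{t+1}} ⊗ (e_{j_i}^[p] ∧ ω) ⊗ 1
  - ∑ i, e_{j₁} ⋯ ê_{j_i} ⋯ e_{j_{t+1}} ⊗ (e_{j_i} ∧ ω) ⊗ e_{j_i}^(p-1)`. -/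
noncomputable def monomialPart (t s : ℕ) (m : Sym I (t + 1)) :
    ⋀[F]^s L →ₗ[F] Term F p L t (s + 1) :=
  ((m : Multiset I).attach.map fun j =>
    TensorProduct.mk F _ _ 1 ∘ₗ
      TensorProduct.mk F _ _ (symMonomial (FrobTwist.basis F p e) (m.erase j.1 j.2)) ∘ₗ
        wedge F s (RestrictedLieAlgebra.pMap F p (e j.1)) -
    TensorProduct.mk F _ _ (RestrictedUEA.ι F p L (e j.1) ^ (p - 1)) ∘ₗ
      TensorProduct.mk F _ _ (symMonomial (FrobTwist.basis F p e) (m.erase j.1 j.2)) ∘ₗ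
        wedge F s (e j.1)).sum

/-- The extension of `monomialPart` to `S^{t+1} L̄`, by linearity from the basis monomials. -/
noncomputable def symPart (t s : ℕ) :
    symPow F (FrobTwist F p L) (t + 1) →ₗ[F] ⋀[F]^s L →ₗ[F] Term F p L t (s + 1) :=
  (symBasis (FrobTwist.basis F p e) (t + 1)).constr F (monomialPart F p e t s)

theorem symPart_symMonomial (t s : ℕ) (m : Sym I (t + 1)) :
    symPart F p e t s (symMonomial (FrobTwist.basis F p e) m) = monomialPart F p e t s m := by
  have h := (symBasis (FrobTwist.basis F p e) (t + 1)).constr_basis F (monomialPart F p e t s) m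
  rw [symBasis, Basis.mk_apply] at h
  exact h

variable {F} in
/-- The part `C_{t+1,s} → C_{t,s+1}` of the differential. -/
noncomputable def dP (t s : ℕ) : Term F p L (t + 1) s →ₗ[RestrictedUEA F p L] Term F p L t (s + 1) :=
  extend F p L (TensorProduct.lift (symPart F p e t s))

/-- The pairs `(t, s)` with `2t + s = k`. -/
abbrev Idx (k : ℕ) : Type := {q : ℕ × ℕ // 2 * q.1 + q.2 = k}

variable (L) in
/-- `C_k = ⨁_{2t+s=k} C_{t,s}`. -/
abbrev C (k : ℕ) : Type _ := ⨁ q : Idx k, Term F p L q.1.1 q.1.2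

variable (L) in
/-- The inclusion of `C_{t,s}` in `C_k`. -/
noncomputable def incl (k t s : ℕ) (h : 2 * t + s = k) :
    Term F p L t s →ₗ[RestrictedUEA F p L] C F p L k :=
  DirectSum.lof (RestrictedUEA F p L) (Idx k) (fun q => Term F p L q.1.1 q.1.2) ⟨(t, s), h⟩

variable (L) in
/-- The first part of the differential on `C_{t,s}`, zero for `s = 0`. -/
noncomputable def dKFrom (k : ℕ) : (t s : ℕ) → 2 * t + s = k + 1 →
    (Term F p L t s →ₗ[RestrictedUEA F p L] C F p L k)
  | _, 0, _ => 0
  | t, s + 1, h => incl F p L k t s (by omega) ∘ₗ dK F p L t s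

variable {F} in
/-- The second part of the differential on `C_{t,s}`, zero for `t = 0`. -/
noncomputable def dPFrom (k : ℕ) : (t s : ℕ) → 2 * t + s = k + 1 →
    (Term F p L t s →ₗ[RestrictedUEA F p L] C F p L k)
  | 0, _, _ => 0
  | t + 1, s, h => incl F p L k t (s + 1) (by omega) ∘ₗ dP p e t s

variable {F} in
/-- The differential `d_{k+1} : C_{k+1} → C_k`. -/
noncomputable def d (k : ℕ) : C F p L (k + 1) →ₗ[RestrictedUEA F p L] C F p L k :=
  DirectSum.toModule (RestrictedUEA F p L) (Idx (k + 1)) (C F p L k) fun q =>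
    dKFrom F p L k q.1.1 q.1.2 q.2 + dPFrom p e k q.1.1 q.1.2 q.2

variable (L) in
/-- The augmentation on `C_{0,0} = S^0 L̄ ⊗ Λ^0 L ⊗ U_res(L)`, `a ⊗ b ⊗ x ↦ a b ε(x)` for scalars
`a`, `b`. -/
noncomputable def augTerm : Term F p L 0 0 →ₗ[RestrictedUEA F p L] Triv F p L :=
  extend F p L (Q := Triv F p L)
    (TensorProduct.lift ((LinearMap.mul F F).compl₁₂
      (SymmetricAlgebra.algebraMapInv.toLinearMap ∘ₗ (symPow F (FrobTwist F p L) 0).subtype)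
      (ExteriorAlgebra.algebraMapInv.toLinearMap ∘ₗ (⋀[F]^0 L).subtype)) :
      symPow F (FrobTwist F p L) 0 ⊗[F] ⋀[F]^0 L →ₗ[F] F)

variable (L) in
/-- The augmentation `ε : C_0 → F`; the only summand of `C_0` is `C_{0,0}`. -/
noncomputable def augC : C F p L 0 →ₗ[RestrictedUEA F p L] Triv F p L :=
  DirectSum.toModule (RestrictedUEA F p L) (Idx 0) (Triv F p L) fun
    | ⟨(0, 0), _⟩ => augTerm F p L
    | ⟨(_ + 1, _), h⟩ => absurd h (by simp)
    | ⟨(0, _ + 1), h⟩ => absurd h (by simp)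

section Formulas

/-- The first part of the differential on decomposable elements. -/
theorem dK_apply [IsLieAbelian L] (t s : ℕ) (x : RestrictedUEA F p L)
    (h : symPow F (FrobTwist F p L) t) (g : Fin (s + 1) → L) :
    dK F p L t s (x ⊗ₜ (h ⊗ₜ exteriorPower.ιMulti F (s + 1) g)) =
      ∑ i : Fin (s + 1), (-1) ^ (i : ℕ) •
        ((RestrictedUEA.ι F p L (g i) * x) ⊗ₜ[F]
          (h ⊗ₜ[F] exteriorPower.ιMulti F s (i.removeNth g))) := by
  have h1 : koszul F p s (exteriorPower.ιMulti F (s + 1) g) = ∑ i : Fin (s + 1), (-1) ^ (i : ℕ) •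
      (RestrictedUEA.ι F p L (g i) ⊗ₜ[F] exteriorPower.ιMulti F s (i.removeNth g)) := by
    rw [koszul, exteriorPower.alternatingMapLinearEquiv_apply_ιMulti,
      AlternatingMap.alternatizeUncurryFin_apply]
    rfl
  rw [dK, extend_tmul, TensorProduct.lift.tmul, LinearMap.compl₂_apply, h1, map_sum,
    Finset.smul_sum]
  refine Finset.sum_congr rfl fun i _ => ?_
  rw [map_zsmul, smul_comm, ← mul_comm_of_abelian]
  rfl

open Classical in
/-- The second part of the differential on basis monomials. -/
theorem dP_apply [IsLieAbelian L] (t s : ℕ) (x : RestrictedUEA F p L) (m : Sym I (t + 1))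
    (ω : ⋀[F]^s L) :
    dP p e t s (x ⊗ₜ (symMonomial (FrobTwist.basis F p e) m ⊗ₜ ω)) =
      ((m : Multiset I).attach.map fun j =>
        (x ⊗ₜ[F] (symMonomial (FrobTwist.basis F p e) (m.erase j.1 j.2) ⊗ₜ[F]
            wedge F s (RestrictedLieAlgebra.pMap F p (e j.1)) ω) -
          (RestrictedUEA.ι F p L (e j.1) ^ (p - 1) * x) ⊗ₜ[F]
            (symMonomial (FrobTwist.basis F p e) (m.erase j.1 j.2) ⊗ₜ[F]
              wedge F s (e j.1) ω))).sum := by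
  have key : ∀ (J : Type _) (A : Multiset J) (f : J → ⋀[F]^s L →ₗ[F] Term F p L t (s + 1))
      (f' : J → Term F p L t (s + 1)), (∀ j, x • f j ω = f' j) →
      x • (A.map f).sum ω = (A.map f').sum := by
    intro J A f f' hf
    induction A using Multiset.induction_on with
    | empty => simp
    | cons j A ih =>
      rw [Multiset.map_cons, Multiset.sum_cons, Multiset.map_cons, Multiset.sum_cons,
        LinearMap.add_apply, smul_add, ih, hf]
  rw [dP, extend_tmul, TensorProduct.lift.tmul, symPart_symMonomial, monomialPart]
  refine key _ _ _ _ fun j => ?_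
  rw [LinearMap.sub_apply, smul_sub, ← mul_comm_of_abelian]
  congr 1
  change (x * 1) ⊗ₜ[F] (_ ⊗ₜ[F] wedge F s _ ω) = _
  rw [mul_one]

end Formulas

section Cohomology

open CategoryTheory

/-- The coboundary `Hom_{U_res(L)}(C_k, M) → Hom_{U_res(L)}(C_{k+1}, M)`, `φ ↦ φ ∘ d_{k+1}`. -/
noncomputable def coboundary (M : ModuleCat (RestrictedUEA F p L)) (k : ℕ) :
    (C F p L k →ₗ[RestrictedUEA F p L] M) →ₗ[F] (C F p L (k + 1) →ₗ[RestrictedUEA F p L] M) where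
  toFun φ := φ ∘ₗ d p e k
  map_add' _ _ := rfl
  map_smul' _ _ := rfl

/-- The `k`-cocycles `ker (Hom(C_k, M) → Hom(C_{k+1}, M))`. -/
noncomputable def cocycles (M : ModuleCat (RestrictedUEA F p L)) (k : ℕ) :
    Submodule F (C F p L k →ₗ[RestrictedUEA F p L] M) :=
  LinearMap.ker (coboundary F p e M k)

/-- The `k`-coboundaries `im (Hom(C_{k-1}, M) → Hom(C_k, M))`, where `C_{-1} = 0`. -/
noncomputable def coboundaries (M : ModuleCat (RestrictedUEA F p L)) :
    (k : ℕ) → Submodule F (C F p L k →ₗ[RestrictedUEA F p L] M)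
  | 0 => ⊥
  | k + 1 => LinearMap.range (coboundary F p e M k)

/-- `H^k(L; M)`, the cocycles modulo the coboundaries. -/
abbrev H (M : ModuleCat (RestrictedUEA F p L)) (k : ℕ) : Type _ :=
  cocycles F p e M k ⧸ (coboundaries F p e M k).submoduleOf (cocycles F p e M k)

variable {F} {p} {e} in
/-- The cohomology class of a cocycle. -/
noncomputable def cls {M : ModuleCat (RestrictedUEA F p L)} {k : ℕ} (φ : cocycles F p e M k) :
    H F p e M k :=
  Submodule.Quotient.mk φ

end Cohomology

end AbelianComplex

end Complex

/-!
The complex `C_*` is compared with a larger complex in which no degree is fixed. Polynomials in the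
`ē_i` are written as functions on multisets of indices, so that `⨁ C_k` becomes the space
`Multiset I →₀ U ⊗ Λ L`, on which the differential is `K + ∑_j ∂_j G_j`: here `K` is the Koszul
differential of the commuting operators `g ↦ (x ↦ g x)` on `U = U_res(L)`, `∂_j` is the derivative
in `ē_j`, and `G_j ω = e_j^[p] ∧ ω - e_j ^ (p - 1) (e_j ∧ ω)`. The square is zero because `K` has
square zero, the `G_j` anticommute, and `G_j K + K G_j = 0`, which is the relation
`e_j^[p] = e_j ^ (p - 1) e_j` of `U` (`LeadingData.totD_mul_self`).

For exactness, `U` is filtered by degree in its monomial basis (`RestrictedUEA.pbw`, whose linear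
independence is read off from leading forms in the polynomial ring), and `e_i ∈ L` gets weight `1`,
`ē_i` weight `p`. The part of the differential that preserves the weight is the differential of the
same complex with `L` replaced by the Lie algebra with zero `p`-operator, where the `e_i` no longer
interact. In the direction of a single `e_i` it is the two-periodic resolution over
`F[e_i] / (e_i ^ p)` with the divided powers in `ē_i` replaced by ordinary powers, and it is
contracted by an explicit homotopy that integrates in the variable `ē_i`
(`LeadingData.leadD_homOp_single`). The integration divides by the exponents, which is possible as
long as they are less than `p`: this is where the restriction on the degree comes from. An element
involves finitely many directions, so finitely many of these homotopies move a cycle of positive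
degree, by a boundary, into lower weight, and induction on the weight shows that it is a boundary
(`LeadingData.exists_totD_eq`). In degree zero, the kernel of the augmentation is the ideal
generated by `L`.

Finally, a partial resolution by projective modules computes `Ext` in the same range of degrees: if
`Z_k` is the `k`-th syzygy, Yoneda composition with the class in `Ext^k (F, Z_k)` of the exact
sequence `0 → Z_k → C_{k-1} → ⋯ → C_0 → F → 0` maps `Hom (Z_k, M)` onto `Ext^k (F, M)`, the kernel
being the maps that extend to `C_{k-1}` (`Ext.exists_iterated_extClass`), and `Hom (Z_k, M)` is the
space of cocycles because `C_{k+1} → C_k → Z_k → 0` is exact.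
-/

/-! ### A filtered basis of a polynomial ring -/

namespace MvPolynomial

section FilteredBasis

variable {F : Type*} [Field F] {I : Type*}

variable (F I) in
/-- The polynomials of total degree less than `m`. -/
noncomputable def degLT (m : ℕ) : Submodule F (MvPolynomial I F) :=
  Submodule.span F ((fun n => monomial n (1 : F)) '' {n : I →₀ ℕ | n.degree < m})

theorem monomial_mem_degLT {m : ℕ} {n : I →₀ ℕ} (h : n.degree < m) :
    monomial n (1 : F) ∈ degLT F I m :=
  Submodule.subset_span ⟨n, h, rfl⟩

theorem degLT_mono {m m' : ℕ} (h : m ≤ m') : degLT F I m ≤ degLT F I m' :=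
  Submodule.span_mono (Set.image_mono fun _ hn => lt_of_lt_of_le hn h)

theorem coeff_eq_zero_of_mem_degLT {m : ℕ} {f : MvPolynomial I F} (hf : f ∈ degLT F I m)
    {n : I →₀ ℕ} (hn : m ≤ n.degree) : coeff n f = 0 := by
  classical
  induction hf using Submodule.span_induction with
  | mem x hx =>
    obtain ⟨n', hn', rfl⟩ := hx
    rw [coeff_monomial, if_neg]
    rintro rfl
    exact absurd hn' (not_lt.mpr hn)
  | zero => exact coeff_zero _
  | add x y _ _ hx hy => rw [coeff_add, hx, hy, add_zero]
  | smul a x _ hx => rw [coeff_smul, hx, smul_zero]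

theorem mul_mem_degLT {m m' r : ℕ} (hr : m + m' ≤ r + 1) {f g : MvPolynomial I F}
    (hf : f ∈ degLT F I m) (hg : g ∈ degLT F I m') : f * g ∈ degLT F I r := by
  have h := Submodule.mul_mem_mul hf hg
  rw [degLT, degLT, Submodule.span_mul_span] at h
  refine Submodule.span_mono ?_ h
  rintro _ ⟨_, ⟨n, hn, rfl⟩, _, ⟨n', hn', rfl⟩, rfl⟩
  refine ⟨n + n', ?_, by simp [monomial_mul]⟩
  simp only [Set.mem_ofPred_eq, map_add] at hn hn' ⊢
  omega

/-- The leading form of a product of two polynomials whose leading forms are monomials. -/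
theorem mul_sub_monomial_mem_degLT {a b : I →₀ ℕ} {f g : MvPolynomial I F}
    (hf : f - monomial a 1 ∈ degLT F I a.degree) (hg : g - monomial b 1 ∈ degLT F I b.degree) :
    f * g - monomial (a + b) 1 ∈ degLT F I (a + b).degree := by
  have hg' : g ∈ degLT F I (b.degree + 1) := by
    rw [← sub_add_cancel g (monomial b 1)]
    exact add_mem (degLT_mono (Nat.le_succ _) hg) (monomial_mem_degLT (Nat.lt_succ_self _))
  have e : f * g - monomial (a + b) 1 =
      (f - monomial a 1) * g + monomial a 1 * (g - monomial b 1) := by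
    rw [show (monomial (a + b) (1 : F)) = monomial a 1 * monomial b 1 by
      rw [monomial_mul, one_mul]]
    ring
  rw [e]
  refine add_mem (mul_mem_degLT ?_ hf hg')
    (mul_mem_degLT ?_ (monomial_mem_degLT (Nat.lt_succ_self a.degree)) hg) <;>
  · rw [map_add]; omega

/-- Polynomials `q n` with leading forms the monomials `X ^ n` are linearly independent. -/
theorem linearIndependent_of_sub_monomial_mem_degLT {q : (I →₀ ℕ) → MvPolynomial I F}
    (hq : ∀ n, q n - monomial n 1 ∈ degLT F I n.degree) : LinearIndependent F q := by
  classical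
  rw [linearIndependent_iff]
  intro c hc
  by_contra hne
  obtain ⟨n, hn, hmax⟩ := c.support.exists_max_image (fun n => n.degree)
    (Finsupp.support_nonempty_iff.mpr hne)
  have h := congrArg (coeff n) hc
  rw [Finsupp.linearCombination_apply, Finsupp.sum, coeff_sum, coeff_zero,
    Finset.sum_eq_single_of_mem n hn] at h
  · have h2 := coeff_eq_zero_of_mem_degLT (hq n) le_rfl
    rw [coeff_sub, coeff_monomial, if_pos rfl, sub_eq_zero] at h2
    rw [coeff_smul, h2, smul_eq_mul, mul_one] at h
    exact Finsupp.mem_support_iff.mp hn h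
  · intro n' hn' hne'
    have h2 := coeff_eq_zero_of_mem_degLT (hq n') (hmax n' hn')
    rw [coeff_sub, coeff_monomial, if_neg hne', sub_zero] at h2
    rw [coeff_smul, h2, smul_zero]

theorem span_eq_top_of_sub_monomial_mem_degLT {q : (I →₀ ℕ) → MvPolynomial I F}
    (hq : ∀ n, q n - monomial n 1 ∈ degLT F I n.degree) :
    Submodule.span F (Set.range q) = ⊤ := by
  have key : ∀ m, degLT F I m ≤ Submodule.span F (Set.range q) := by
    intro m
    induction m with
    | zero => exact Submodule.span_le.mpr (by rintro _ ⟨n, hn, rfl⟩; exact absurd hn (by simp))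
    | succ m ih =>
      refine Submodule.span_le.mpr ?_
      rintro _ ⟨n, hn, rfl⟩
      have h : monomial n (1 : F) = q n - (q n - monomial n 1) := by ring
      simp only [SetLike.mem_coe]
      rw [h]
      exact sub_mem (Submodule.subset_span ⟨n, rfl⟩)
        (ih (degLT_mono (Nat.lt_succ_iff.mp hn) (hq n)))
  refine eq_top_iff.mpr fun f _ => ?_
  induction f using induction_on' with
  | monomial n a =>
    rw [← mul_one a, ← smul_eq_mul, ← smul_monomial]
    exact Submodule.smul_mem _ _ (key (n.degree + 1) (monomial_mem_degLT (Nat.lt_succ_self _)))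
  | add f g hf hg => exact add_mem (hf trivial) (hg trivial)

variable (p : ℕ) (y : I → MvPolynomial I F)

/-- The products `∏ y_i ^ ⌊n_i / p⌋ X_i ^ (n_i mod p)`. -/
noncomputable def divModProd (n : I →₀ ℕ) : MvPolynomial I F :=
  n.prod fun i k => y i ^ (k / p) * X i ^ (k % p)

variable {p} {y}

theorem divModProd_sub_monomial_mem_degLT
    (hy : ∀ i, y i - X i ^ p ∈ degLT F I p) (n : I →₀ ℕ) :
    divModProd p y n - monomial n 1 ∈ degLT F I n.degree := by
  classical
  have hpow : ∀ i k, y i ^ k - monomial (Finsupp.single i (p * k)) 1 ∈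
      degLT F I (Finsupp.single i (p * k)).degree := by
    intro i k
    induction k with
    | zero => simp
    | succ k ih =>
      rw [pow_succ, mul_add_one, Finsupp.single_add]
      refine mul_sub_monomial_mem_degLT ih ?_
      rw [Finsupp.degree_single, ← X_pow_eq_monomial]
      exact hy i
  have hsingle : ∀ i k, y i ^ (k / p) * X i ^ (k % p) - monomial (Finsupp.single i k) 1 ∈
      degLT F I (Finsupp.single i k).degree := by
    intro i k
    have h := mul_sub_monomial_mem_degLT (hpow i (k / p)) (g := X i ^ (k % p))
      (b := Finsupp.single i (k % p)) (by rw [X_pow_eq_monomial, sub_self]; exact zero_mem _)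
    rwa [← Finsupp.single_add, Nat.div_add_mod] at h
  induction n using Finsupp.induction with
  | zero => simp [divModProd]
  | single_add i k n hi hk ih =>
    rw [divModProd, Finsupp.prod_add_index_of_disjoint, Finsupp.prod_single_index]
    · exact mul_sub_monomial_mem_degLT (hsingle i k) ih
    · simp
    · rw [Finsupp.support_single _ hk]
      exact Finset.disjoint_singleton_left.mpr hi

theorem divModProd_eq_monomial {n : I →₀ ℕ} (hn : ∀ i, n i < p) :
    divModProd p y n = monomial n 1 := by
  rw [divModProd, monomial_eq, C_1, one_mul]
  refine Finsupp.prod_congr fun i _ => ?_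
  rw [Nat.div_eq_of_lt (hn i), Nat.mod_eq_of_lt (hn i), pow_zero, one_mul]

theorem mul_divModProd (hp : 0 < p) (i : I) (n : I →₀ ℕ) :
    y i * divModProd p y n = divModProd p y (n + Finsupp.single i p) := by
  classical
  have e0 : ∀ n : I →₀ ℕ, divModProd p y n =
      (y i ^ (n i / p) * X i ^ (n i % p)) * divModProd p y (n.erase i) := by
    intro n
    rw [divModProd, divModProd, ← Finsupp.mul_prod_erase' n i _ (fun j => by simp)]
  rw [e0 n, e0 (n + Finsupp.single i p)]
  have e1 : (n + Finsupp.single i p).erase i = n.erase i := by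
    ext j
    by_cases hj : j = i
    · subst hj; simp
    · simp [Finsupp.erase_ne hj]
  rw [e1, Finsupp.add_apply, Finsupp.single_eq_same, Nat.add_div_right _ hp, Nat.add_mod_right,
    pow_succ]
  ring

/-- If the leading form of each `y_i` is `X_i ^ p`, then the monomials with all exponents less than
`p` are linearly independent modulo the ideal generated by the `y_i`: together with the products of
the other `y_i ^ a X_i ^ b` they form a basis, and these products span the ideal. -/
theorem linearIndependent_monomial_mod_span_range (hp : 0 < p)
    (hy : ∀ i, y i - X i ^ p ∈ degLT F I p) {B : Type*} (v : B → I →₀ ℕ)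
    (hv : Function.Injective v) (hlt : ∀ b i, v b i < p) :
    LinearIndependent F fun b => Ideal.Quotient.mk (Ideal.span (Set.range y))
      (monomial (v b) (1 : F)) := by
  have hli := linearIndependent_of_sub_monomial_mem_degLT
    (divModProd_sub_monomial_mem_degLT hy)
  have hsp := span_eq_top_of_sub_monomial_mem_degLT (divModProd_sub_monomial_mem_degLT hy)
  set q := divModProd p y with hq
  -- The products with some factor `y_i` span the ideal, since `y_i q_n = q_{n + p}`.
  let S : Submodule F (MvPolynomial I F) := Submodule.span F (q '' {n | ∃ i, p ≤ n i})
  have hS : ∀ f ∈ Ideal.span (Set.range y), f ∈ S := by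
    intro f hf
    obtain ⟨c, rfl⟩ := Finsupp.mem_span_range_iff_exists_finsupp.mp hf
    refine sum_mem fun i _ => ?_
    have hc : c i ∈ Submodule.span F (Set.range q) := hsp ▸ Submodule.mem_top
    simp only [smul_eq_mul]
    generalize c i = g at hc
    induction hc using Submodule.span_induction with
    | mem x hx =>
      obtain ⟨n, rfl⟩ := hx
      rw [mul_comm, mul_divModProd hp]
      exact Submodule.subset_span ⟨_, ⟨i, by simp⟩, rfl⟩
    | zero => rw [zero_mul]; exact zero_mem _
    | add x z _ _ hx hz => rw [add_mul]; exact add_mem hx hz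
    | smul a x _ hx => rw [smul_mul_assoc]; exact Submodule.smul_mem _ _ hx
  have hcomp : LinearIndependent F fun b => monomial (v b) (1 : F) := by
    have := hli.comp v hv
    convert this using 2 with b
    exact (divModProd_eq_monomial (hlt b)).symm
  have key := hcomp.map (f := (Ideal.Quotient.mkₐ F (Ideal.span (Set.range y))).toLinearMap) ?_
  · exact key
  · rw [Submodule.disjoint_def]
    intro x hx hx'
    have hx1 : x ∈ S := hS x (Ideal.Quotient.eq_zero_iff_mem.mp hx')
    have hx2 : x ∈ Submodule.span F (q '' Set.range v) := by
      refine Submodule.span_mono ?_ hx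
      rintro _ ⟨b, rfl⟩
      exact ⟨v b, ⟨b, rfl⟩, divModProd_eq_monomial (hlt b)⟩
    have hd := hli.disjoint_span_image (s := {n | ∃ i, p ≤ n i}) (t := Set.range v) (by
      rw [Set.disjoint_left]
      rintro _ ⟨i, hi⟩ ⟨b, rfl⟩
      exact absurd (hlt b i) (not_lt.mpr hi))
    exact Submodule.disjoint_def.mp hd x hx1 hx2

end FilteredBasis

end MvPolynomial

/-! ### The monomial basis of the restricted enveloping algebra -/

namespace RestrictedUEA

section Basic

variable {F : Type*} {p : ℕ} {L : Type*} [Field F] [LieRing L] [LieAlgebra F L]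
  [RestrictedLieAlgebra F p L]

/-- A subspace of `U_res(L)` that contains `1` and is stable under left multiplication by `L` is
everything. -/
theorem eq_top_of_ι_mul_mem (S : Submodule F (RestrictedUEA F p L)) (h1 : 1 ∈ S)
    (hmul : ∀ (g : L), ∀ x ∈ S, ι F p L g * x ∈ S) : S = ⊤ := by
  have hmk : Function.Surjective
      ((mk F p L).comp (UniversalEnvelopingAlgebra.mkAlgHom F L)) :=
    (RingQuot.mkAlgHom_surjective F _).comp Quotient.mk_surjective
  have key : ∀ (a : TensorAlgebra F L), ∀ x ∈ S,
      ((mk F p L).comp (UniversalEnvelopingAlgebra.mkAlgHom F L) a) * x ∈ S := by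
    intro a
    induction a using TensorAlgebra.induction with
    | algebraMap r =>
      intro x hx
      rw [AlgHom.commutes, ← Algebra.smul_def]
      exact S.smul_mem r hx
    | ι h => exact hmul h
    | mul a b ha hb => intro x hx; rw [map_mul, mul_assoc]; exact ha _ (hb _ hx)
    | add a b ha hb => intro x hx; rw [map_add, add_mul]; exact add_mem (ha _ hx) (hb _ hx)
  refine eq_top_iff.mpr fun x _ => ?_
  obtain ⟨a, rfl⟩ := hmk x
  simpa using key a 1 h1

theorem pMap_add_of_abelian [IsLieAbelian L] (g h : L) :
    RestrictedLieAlgebra.pMap F p (g + h) =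
      RestrictedLieAlgebra.pMap F p g + RestrictedLieAlgebra.pMap F p h := by
  have key : ∀ l : List L, l.foldl (fun x y => ⁅x, y⁆) (0 : L) = 0 := by
    intro l
    induction l with
    | nil => rfl
    | cons a l ih => rw [List.foldl_cons, trivial_lie_zero, ih]
  rw [RestrictedLieAlgebra.pMap_add, add_eq_left]
  refine Finset.sum_eq_zero fun c _ => ?_
  rw [trivial_lie_zero, key, smul_zero]

/-- The restricted enveloping algebra of an abelian Lie algebra as a commutative ring. -/
@[reducible] noncomputable def commRing (F : Type*) (p : ℕ) (L : Type*) [Field F] [LieRing L]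
    [LieAlgebra F L] [RestrictedLieAlgebra F p L] [IsLieAbelian L] :
    CommRing (RestrictedUEA F p L) :=
  { (inferInstance : Ring (RestrictedUEA F p L)) with
    mul_comm := mul_comm_of_abelian F p L }

end Basic

section Relations

variable {F : Type*} {p : ℕ} {L : Type*} [Field F] [LieRing L] [LieAlgebra F L]
  {I : Type*} (e : Basis I F L)

/-- The linear form `L → F[X_i]`, `e_i ↦ X_i`. -/
noncomputable def linForm : L →ₗ[F] MvPolynomial I F := e.constr F MvPolynomial.X

theorem linForm_mem_degLT (g : L) : linForm e g ∈ MvPolynomial.degLT F I 2 := by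
  have : ⊤ ≤ (MvPolynomial.degLT F I 2).comap (linForm e) := by
    rw [← e.span_eq, Submodule.span_le]
    rintro _ ⟨i, rfl⟩
    simp only [SetLike.mem_coe, Submodule.mem_comap, linForm, Basis.constr_basis]
    exact MvPolynomial.monomial_mem_degLT (by simp)
  exact this trivial

variable [RestrictedLieAlgebra F p L]

variable (p) in
/-- The relation `X_i ^ p - e_i^[p]`, as a polynomial. -/
noncomputable def relPoly (i : I) : MvPolynomial I F :=
  MvPolynomial.X i ^ p - linForm e (RestrictedLieAlgebra.pMap F p (e i))

variable [Fact p.Prime]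

theorem relPoly_sub_mem_degLT (i : I) :
    relPoly p e i - MvPolynomial.X i ^ p ∈ MvPolynomial.degLT F I p := by
  rw [relPoly, sub_sub_cancel_left]
  exact neg_mem (MvPolynomial.degLT_mono (Fact.out : p.Prime).two_le (linForm_mem_degLT e _))

end Relations

section Monomials

variable {F : Type*} {p : ℕ} {L : Type*} [Field F] [LieRing L] [LieAlgebra F L]
  [RestrictedLieAlgebra F p L] [IsLieAbelian L] {I : Type*} (e : Basis I F L)

/-- The map `F[X_i] → U_res(L)`, `X_i ↦ e_i`. -/
noncomputable def ofPoly : MvPolynomial I F →ₐ[F] RestrictedUEA F p L :=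
  letI := commRing F p L
  MvPolynomial.aeval fun i => ι F p L (e i)

theorem ofPoly_X (i : I) : ofPoly (p := p) e (MvPolynomial.X i) = ι F p L (e i) :=
  letI := commRing F p L
  MvPolynomial.aeval_X _ i

theorem ι_pow_mul_ofPoly (i : I) (a : ℕ) (n : I →₀ ℕ) :
    ι F p L (e i) ^ a * ofPoly e (MvPolynomial.monomial n 1) =
      ofPoly e (MvPolynomial.monomial (Finsupp.single i a + n) 1) := by
  rw [← ofPoly_X, ← map_pow, ← map_mul, MvPolynomial.X_pow_eq_monomial,
    MvPolynomial.monomial_mul, one_mul]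

variable [Fact p.Prime]

/-- The exponents of a monomial with all exponents less than `p`. -/
noncomputable def expo (β : I →₀ Fin p) : I →₀ ℕ := β.mapRange Fin.val (Fin.val_zero p)

/-- The total degree of a monomial with all exponents less than `p`. -/
noncomputable def wt (β : I →₀ Fin p) : ℕ := (expo β).degree

/-- The monomial `∏ e_i ^ β_i` in `U_res(L)`. -/
noncomputable def mon (β : I →₀ Fin p) : RestrictedUEA F p L :=
  ofPoly e (MvPolynomial.monomial (expo β) 1)

theorem mon_zero : mon (p := p) e 0 = 1 := by
  have : expo (0 : I →₀ Fin p) = 0 := by ext; simp [expo]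
  rw [mon, this]
  exact map_one _

theorem single_add_expo_update (i : I) (β : I →₀ Fin p) (v : Fin p) :
    Finsupp.single i (β i : ℕ) + expo (β.update i v) = Finsupp.single i (v : ℕ) + expo β := by
  classical
  ext j
  by_cases h : j = i
  · subst h; simp [expo, add_comm]
  · simp [expo, h]

theorem wt_update (i : I) (β : I →₀ Fin p) (v : Fin p) :
    β i + wt (β.update i v) = v + wt β := by
  have := congrArg Finsupp.degree (single_add_expo_update i β v)
  simpa [wt] using this

/-- The span of the monomials of total degree at most `n`. -/
noncomputable def fil (n : ℕ) : Submodule F (RestrictedUEA F p L) :=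
  Submodule.span F (mon e '' {β | wt β ≤ n})

theorem mon_mem_fil {β : I →₀ Fin p} {n : ℕ} (h : wt β ≤ n) : mon e β ∈ fil (p := p) e n :=
  Submodule.subset_span ⟨β, h, rfl⟩

theorem fil_mono {m n : ℕ} (h : m ≤ n) : fil (p := p) e m ≤ fil e n :=
  Submodule.span_mono (Set.image_mono fun _ hβ => le_trans hβ h)

/-- To map `fil n` into a subspace it suffices to map monomials there. -/
theorem map_mem_of_mem_fil {Q : Type*} [AddCommMonoid Q] [Module F Q]
    (φ : RestrictedUEA F p L →ₗ[F] Q) (S : Submodule F Q) {n : ℕ}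
    (h : ∀ β, wt β ≤ n → φ (mon e β) ∈ S) {x : RestrictedUEA F p L} (hx : x ∈ fil e n) :
    φ x ∈ S := by
  have : fil e n ≤ S.comap φ := by
    refine Submodule.span_le.mpr ?_
    rintro _ ⟨β, hβ, rfl⟩
    exact h β hβ
  exact this hx

/-- Raising one exponent of a monomial. -/
theorem ι_pow_mul_mon (i : I) (β : I →₀ Fin p) (v : Fin p) (a : ℕ) (h : β i + a = v) :
    ι F p L (e i) ^ a * mon e β = mon e (β.update i v) := by
  rw [mon, ι_pow_mul_ofPoly, mon]
  congr 3
  have := single_add_expo_update i β v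
  rw [← h, Finsupp.single_add, add_assoc] at this
  exact (add_left_cancel this).symm

/-- If the exponent reaches `p`, the factor `e_i ^ p` becomes `e_i^[p]`. -/
theorem ι_pow_mul_mon_of_le (i : I) (β : I →₀ Fin p) (v : Fin p) (a : ℕ) (h : β i + a = p + v) :
    ι F p L (e i) ^ a * mon e β =
      ι F p L (RestrictedLieAlgebra.pMap F p (e i)) * mon e (β.update i v) := by
  rw [← ι_pow, mon, ι_pow_mul_ofPoly, mon, ι_pow_mul_ofPoly]
  congr 3
  have := single_add_expo_update i β v
  refine add_left_cancel (a := Finsupp.single i (β i : ℕ)) ?_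
  rw [← add_assoc, ← Finsupp.single_add, h, Finsupp.single_add, add_assoc, ← this]
  abel

/-- Multiplication by an element of `L` raises the degree by at most one. -/
theorem ι_mul_mem_fil (g : L) {n : ℕ} {x : RestrictedUEA F p L} (hx : x ∈ fil e n) :
    ι F p L g * x ∈ fil e (n + 1) := by
  induction n using Nat.strong_induction_on generalizing g x with
  | _ n ih =>
  have hp2 := (Fact.out : p.Prime).two_le
  have key : ∀ β, wt β ≤ n → LinearMap.mulRight F (mon e β) (ι F p L g) ∈ fil e (n + 1) := by
    intro β hβ
    have : ⊤ ≤ (fil e (n + 1)).comap (LinearMap.mulRight F (mon e β) ∘ₗ ι F p L) := by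
      rw [← e.span_eq, Submodule.span_le]
      rintro _ ⟨j, rfl⟩
      change ι F p L (e j) * mon e β ∈ fil e (n + 1)
      have hlt := (β j).isLt
      -- For the exponent `p - 1` the factor `e_j ^ p` turns into `e_j^[p] ∈ L`, and the degree of
      -- the remaining monomial is smaller.
      rcases eq_or_ne ((β j : ℕ) + 1) p with h | h
      · have h0 := wt_update j β 0
        rw [Fin.val_zero] at h0
        rw [← pow_one (ι F p L (e j)), ι_pow_mul_mon_of_le e j β 0 1 (by simpa using h)]
        exact fil_mono e (by omega) (ih (wt (β.update j 0)) (by omega) _ (mon_mem_fil e le_rfl))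
      · have h0 := wt_update j β ⟨β j + 1, by omega⟩
        rw [← pow_one (ι F p L (e j)), ι_pow_mul_mon e j β ⟨β j + 1, by omega⟩ 1 rfl]
        refine mon_mem_fil e ?_
        simp only at h0
        omega
    exact this trivial
  exact map_mem_of_mem_fil e (LinearMap.mulLeft F (ι F p L g)) _ key hx

/-- The monomials span. -/
theorem exists_mem_fil (x : RestrictedUEA F p L) : ∃ n, x ∈ fil e n := by
  let S : Submodule F (RestrictedUEA F p L) :=
    { carrier := {x | ∃ n, x ∈ fil e n}
      add_mem' := by
        rintro x y ⟨m, hm⟩ ⟨n, hn⟩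
        exact ⟨max m n, add_mem (fil_mono e (le_max_left _ _) hm)
          (fil_mono e (le_max_right _ _) hn)⟩
      zero_mem' := ⟨0, zero_mem _⟩
      smul_mem' := by
        rintro a x ⟨n, hn⟩
        exact ⟨n, Submodule.smul_mem _ _ hn⟩ }
  have : S = ⊤ := by
    refine eq_top_of_ι_mul_mem S ⟨0, ?_⟩ ?_
    · rw [← mon_zero e]
      exact mon_mem_fil e (by simp [wt, expo])
    · rintro g x ⟨n, hn⟩
      exact ⟨n + 1, ι_mul_mem_fil e g hn⟩
  exact (this ▸ Submodule.mem_top : x ∈ S)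

variable [CharP F p]

/-- The relations of the basis vectors imply those of all elements of `L`, because both
`g ↦ g ^ p` and `g ↦ g^[p]` are additive and `p`-semilinear. -/
theorem linForm_pow_sub_mem (g : L) :
    linForm e g ^ p - linForm e (RestrictedLieAlgebra.pMap F p g) ∈
      Ideal.span (Set.range (relPoly p e)) := by
  have hg : g ∈ Submodule.span F (Set.range e) := e.span_eq ▸ Submodule.mem_top
  induction hg using Submodule.span_induction with
  | mem x hx =>
    obtain ⟨i, rfl⟩ := hx
    refine Ideal.subset_span ⟨i, ?_⟩
    rw [relPoly]
    simp [linForm]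
  | zero =>
    have := RestrictedLieAlgebra.pMap_smul (p := p) (0 : F) (0 : L)
    rw [zero_smul, zero_pow (Fact.out : p.Prime).ne_zero, zero_smul] at this
    rw [this, map_zero, zero_pow (Fact.out : p.Prime).ne_zero, sub_zero]
    exact zero_mem _
  | add x y _ _ hx hy =>
    have : linForm e (x + y) ^ p - linForm e (RestrictedLieAlgebra.pMap F p (x + y)) =
        (linForm e x ^ p - linForm e (RestrictedLieAlgebra.pMap F p x)) +
        (linForm e y ^ p - linForm e (RestrictedLieAlgebra.pMap F p y)) := by
      rw [pMap_add_of_abelian, map_add, map_add, add_pow_char]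
      ring
    rw [this]
    exact add_mem hx hy
  | smul a x _ hx =>
    have : linForm e (a • x) ^ p - linForm e (RestrictedLieAlgebra.pMap F p (a • x)) =
        MvPolynomial.C (a ^ p) *
          (linForm e x ^ p - linForm e (RestrictedLieAlgebra.pMap F p x)) := by
      rw [RestrictedLieAlgebra.pMap_smul, map_smul, map_smul, smul_pow, mul_sub,
        MvPolynomial.smul_eq_C_mul, MvPolynomial.smul_eq_C_mul]
    rw [this]
    exact Ideal.mul_mem_left _ _ hx

section

attribute [local instance] LieRing.ofAssociativeRing

/-- The map from `U_res(L)` to the quotient of the polynomial ring by the relations. -/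
noncomputable def toQuotient :
    RestrictedUEA F p L →ₐ[F] MvPolynomial I F ⧸ Ideal.span (Set.range (relPoly p e)) :=
  RingQuot.liftAlgHom F ⟨UniversalEnvelopingAlgebra.lift F
    { (Ideal.Quotient.mkₐ F (Ideal.span (Set.range (relPoly p e)))).toLinearMap ∘ₗ linForm e with
      map_lie' := by
        intro x y
        rw [trivial_lie_zero, LieRing.of_associative_ring_bracket, mul_comm, sub_self]
        exact LinearMap.map_zero
          ((Ideal.Quotient.mkₐ F (Ideal.span (Set.range (relPoly p e)))).toLinearMap ∘ₗ
            linForm e) }, by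
    rintro _ _ ⟨g⟩
    rw [map_pow, UniversalEnvelopingAlgebra.lift_ι_apply, UniversalEnvelopingAlgebra.lift_ι_apply]
    exact Ideal.Quotient.eq.mpr (linForm_pow_sub_mem e g)⟩

theorem toQuotient_ι (g : L) :
    toQuotient (p := p) e (ι F p L g) = Ideal.Quotient.mk _ (linForm e g) := by
  have : toQuotient e (mk F p L (UniversalEnvelopingAlgebra.ι F g)) =
      UniversalEnvelopingAlgebra.lift F _ (UniversalEnvelopingAlgebra.ι F g) :=
    RingQuot.liftAlgHom_mkAlgHom_apply F _ _ _
  rw [UniversalEnvelopingAlgebra.lift_ι_apply] at this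
  exact this

end

theorem toQuotient_ofPoly (f : MvPolynomial I F) :
    toQuotient (p := p) e (ofPoly e f) = Ideal.Quotient.mk _ f := by
  have : (toQuotient (p := p) e).comp (ofPoly e) = Ideal.Quotient.mkₐ F _ := by
    refine MvPolynomial.algHom_ext fun i => ?_
    rw [AlgHom.comp_apply, ofPoly_X, toQuotient_ι]
    simp [linForm]
  exact AlgHom.congr_fun this f

/-- The monomials with exponents less than `p` are linearly independent, since their images in the
quotient of the polynomial ring are. -/
theorem linearIndependent_mon : LinearIndependent F (mon (p := p) e) := by
  refine LinearIndependent.of_comp (toQuotient (p := p) e).toLinearMap ?_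
  have h0 : (toQuotient (p := p) e).toLinearMap ∘ mon e =
      fun β => Ideal.Quotient.mk _ (MvPolynomial.monomial (expo β) 1) :=
    funext fun β => toQuotient_ofPoly e _
  rw [h0]
  exact MvPolynomial.linearIndependent_monomial_mod_span_range (F := F)
    (Fact.out : p.Prime).pos (relPoly_sub_mem_degLT (p := p) e) (expo (p := p) (I := I))
    (Finsupp.mapRange_injective _ (Fin.val_zero p) Fin.val_injective) (fun β i => by simp [expo])

/-- The Poincaré–Birkhoff–Witt basis of the restricted enveloping algebra: the monomials in the
vectors of a basis of `L` with all exponents less than `p`. -/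
noncomputable def pbw : Basis (I →₀ Fin p) F (RestrictedUEA F p L) :=
  Basis.mk (linearIndependent_mon e) fun x _ => by
    obtain ⟨n, hn⟩ := exists_mem_fil e x
    exact Submodule.span_mono (Set.image_subset_range _ _) hn

theorem pbw_apply (β : I →₀ Fin p) : pbw e β = mon (p := p) e β := Basis.mk_apply _ _ _

end Monomials

section CoordinateOperators

variable {F : Type*} {p : ℕ} {L : Type*} [Field F] [LieRing L] [LieAlgebra F L]
  [RestrictedLieAlgebra F p L] [IsLieAbelian L] [Fact p.Prime] [CharP F p]
  {I : Type*} (e : Basis I F L)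

/-- The operator on `U_res(L)` that changes the exponent of `e_i` in each monomial according to a
partial map of exponents; monomials where the partial map is undefined go to zero. -/
noncomputable def coordOp (i : I) (φ : Fin p → Option (Fin p)) :
    Module.End F (RestrictedUEA F p L) :=
  (pbw e).constr F fun β => (φ (β i)).elim 0 fun v => mon e (β.update i v)

theorem coordOp_mon (i : I) (φ : Fin p → Option (Fin p)) (β : I →₀ Fin p) :
    coordOp e i φ (mon e β) = (φ (β i)).elim 0 fun v => mon e (β.update i v) := by
  rw [← pbw_apply, coordOp, Basis.constr_basis]

theorem end_ext {Q : Type*} [AddCommMonoid Q] [Module F Q] {A B : RestrictedUEA F p L →ₗ[F] Q}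
    (h : ∀ β, A (mon e β) = B (mon e β)) : A = B :=
  (pbw e).ext fun β => by rw [pbw_apply, h]

theorem coordOp_comm {i j : I} (hij : i ≠ j) (φ ψ : Fin p → Option (Fin p)) :
    coordOp (L := L) (F := F) e i φ * coordOp e j ψ = coordOp e j ψ * coordOp e i φ := by
  classical
  refine end_ext e fun β => ?_
  rw [Module.End.mul_apply, Module.End.mul_apply, coordOp_mon, coordOp_mon]
  rcases hφ : φ (β i) with _ | v <;> rcases hψ : ψ (β j) with _ | w <;>
    simp [coordOp_mon, hφ, hψ, hij, hij.symm]
  congr 1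
  ext k
  simp only [Finsupp.coe_update]
  rw [Function.update_comm hij]

/-- The partial map `a ↦ a + 1` of exponents. -/
def raise (a : Fin p) : Option (Fin p) := if h : (a : ℕ) + 1 < p then some ⟨a + 1, h⟩ else none

/-- The partial map `a ↦ a - 1` of exponents. -/
def lower (a : Fin p) : Option (Fin p) :=
  if (a : ℕ) = 0 then none else some ⟨a - 1, lt_of_le_of_lt (Nat.sub_le _ _) a.isLt⟩

/-- The partial map of exponents defined only at `0`, where it takes the value `p - 1`. -/
def jump (a : Fin p) : Option (Fin p) :=
  if (a : ℕ) = 0 then some ⟨p - 1, Nat.sub_lt a.pos one_pos⟩ else none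

/-- The partial map of exponents defined only at `p - 1`, where it takes the value `0`. -/
def drop (a : Fin p) : Option (Fin p) :=
  if (a : ℕ) + 1 = p then some ⟨0, a.pos⟩ else none

theorem update_eq_self {i : I} {β : I →₀ Fin p} {v : Fin p} (h : v = β i) : β.update i v = β := by
  classical
  subst h
  ext k
  simp

theorem raise_lower_add_jump_drop (i : I) :
    coordOp (L := L) (F := F) e i raise * coordOp e i lower +
      coordOp e i drop * coordOp e i jump = 1 := by
  classical
  refine end_ext e fun β => ?_
  have hlt := (β i).isLt
  by_cases h : (β i : ℕ) = 0
  · have h1 : p - 1 + 1 = p := Nat.sub_add_cancel (Fact.out : p.Prime).one_le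
    simp [coordOp_mon, lower, jump, drop, h, h1]
    rw [update_eq_self (Fin.ext (by simp [h]))]
  · have h1 : (β i : ℕ) - 1 + 1 = β i := by omega
    simp [coordOp_mon, lower, jump, raise, h, h1]

theorem lower_raise_add_drop_jump (i : I) :
    coordOp (L := L) (F := F) e i lower * coordOp e i raise +
      coordOp e i jump * coordOp e i drop = 1 := by
  classical
  refine end_ext e fun β => ?_
  have hlt := (β i).isLt
  by_cases h : (β i : ℕ) + 1 = p
  · simp [coordOp_mon, raise, jump, drop, h]
    rw [update_eq_self (Fin.ext (by simp only; omega))]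
  · have h1 : (β i : ℕ) + 1 < p := by omega
    simp [coordOp_mon, lower, drop, raise, h, h1]

/-- Multiplication by `e_i` agrees with the raising operator up to terms that do not raise the
degree: if the exponent of `e_i` is `p - 1`, the factor `e_i ^ p` is replaced by an element of
`L`. -/
theorem ι_mul_sub_raise_mem (i : I) (β : I →₀ Fin p) :
    ι F p L (e i) * mon e β - coordOp e i raise (mon e β) ∈ fil e (wt β) := by
  have hlt := (β i).isLt
  have hp2 := (Fact.out : p.Prime).two_le
  rw [coordOp_mon, raise]
  split_ifs with h
  · rw [← pow_one (ι F p L (e i)), ι_pow_mul_mon e i β ⟨β i + 1, h⟩ 1 rfl, Option.elim_some,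
      sub_self]
    exact zero_mem _
  · rw [← pow_one (ι F p L (e i)), ι_pow_mul_mon_of_le e i β 0 1 (by simp; omega), Option.elim_none,
      sub_zero]
    have h0 := wt_update i β 0
    rw [Fin.val_zero] at h0
    exact fil_mono e (by omega) (ι_mul_mem_fil e _ (mon_mem_fil e le_rfl))

/-- Multiplication by `e_i ^ (p - 1)` agrees with the operator `jump` up to terms that raise the
degree by at most `p - 2`. -/
theorem ι_pow_mul_sub_jump_mem (i : I) (β : I →₀ Fin p) :
    ι F p L (e i) ^ (p - 1) * mon e β - coordOp e i jump (mon e β) ∈ fil e (wt β + p - 2) := by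
  have hlt := (β i).isLt
  have hp2 := (Fact.out : p.Prime).two_le
  rw [coordOp_mon, jump]
  split_ifs with h
  · rw [ι_pow_mul_mon e i β ⟨p - 1, by omega⟩ (p - 1) (by simp [h]), Option.elim_some, sub_self]
    exact zero_mem _
  · rw [ι_pow_mul_mon_of_le e i β ⟨β i - 1, by omega⟩ (p - 1) (by simp; omega), Option.elim_none,
      sub_zero]
    have h0 := wt_update i β ⟨β i - 1, by omega⟩
    simp only at h0
    exact fil_mono e (by omega) (ι_mul_mem_fil e _ (mon_mem_fil e le_rfl))

end CoordinateOperators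

end RestrictedUEA

/-! ### Koszul operators on an exterior algebra with coefficients -/

namespace ExteriorAlgebra

section Contraction

variable {F : Type*} [Field F] {L : Type*} [AddCommGroup L] [Module F L]

theorem ι_mul_mem_exteriorPower (g : L) {s : ℕ} {ω : ExteriorAlgebra F L} (h : ω ∈ ⋀[F]^s L) :
    ι F g * ω ∈ ⋀[F]^(s + 1) L := by
  change _ ∈ LinearMap.range (ExteriorAlgebra.ι F) ^ (s + 1)
  rw [pow_succ']
  exact Submodule.mul_mem_mul (LinearMap.mem_range_self _ _) h

/-- Induction for exterior powers by exterior multiplication with vectors. -/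
theorem exteriorPower_succ_induction {s : ℕ} {P : ExteriorAlgebra F L → Prop}
    (hmul : ∀ g, ∀ ω ∈ ⋀[F]^s L, P (ι F g * ω)) (hadd : ∀ ω η, P ω → P η → P (ω + η))
    {ω : ExteriorAlgebra F L} (h : ω ∈ ⋀[F]^(s + 1) L) : P ω := by
  change _ ∈ LinearMap.range (ExteriorAlgebra.ι F) ^ (s + 1) at h
  rw [pow_succ'] at h
  refine Submodule.mul_induction_on h ?_ hadd
  rintro _ ⟨g, rfl⟩ ω hω
  exact hmul g ω hω

theorem exists_algebraMap_of_mem_exteriorPower_zero {ω : ExteriorAlgebra F L}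
    (h : ω ∈ ⋀[F]^0 L) : ∃ r : F, algebraMap F (ExteriorAlgebra F L) r = ω := by
  change _ ∈ LinearMap.range (ExteriorAlgebra.ι F) ^ 0 at h
  rw [pow_zero] at h
  exact Submodule.mem_one.mp h

theorem contractLeft_mem_exteriorPower (f : Dual F L) {s : ℕ} {ω : ExteriorAlgebra F L}
    (h : ω ∈ ⋀[F]^(s + 1) L) :
    (CliffordAlgebra.contractLeft f ω : ExteriorAlgebra F L) ∈ ⋀[F]^s L := by
  induction s generalizing ω with
  | zero =>
    refine exteriorPower_succ_induction
      (P := fun ω => (CliffordAlgebra.contractLeft f ω : ExteriorAlgebra F L) ∈ _)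
      (fun g ω hω => ?_) (fun ω η h1 h2 => ?_) h
    · obtain ⟨r, rfl⟩ := exists_algebraMap_of_mem_exteriorPower_zero hω
      erw [CliffordAlgebra.contractLeft_ι_mul]
      rw [CliffordAlgebra.contractLeft_algebraMap, mul_zero, sub_zero]
      exact Submodule.smul_mem _ _ hω
    · rw [map_add]; exact add_mem h1 h2
  | succ s ih =>
    refine exteriorPower_succ_induction
      (P := fun ω => (CliffordAlgebra.contractLeft f ω : ExteriorAlgebra F L) ∈ _)
      (fun g ω hω => ?_) (fun ω η h1 h2 => ?_) h
    · erw [CliffordAlgebra.contractLeft_ι_mul]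
      exact sub_mem (Submodule.smul_mem _ _ hω) (ι_mul_mem_exteriorPower g (ih hω))
    · rw [map_add]; exact add_mem h1 h2

end Contraction

section Operators

variable {F : Type*} [Field F] {L : Type*} [AddCommGroup L] [Module F L]
  {V : Type*} [AddCommGroup V] [Module F V]

/-- A linear map on `V ⊗ Λ L` is determined inductively. -/
theorem tensor_hom_ext {Q : Type*} [AddCommGroup Q] [Module F Q]
    {Φ Ψ : V ⊗[F] ExteriorAlgebra F L →ₗ[F] Q} (h1 : ∀ x, Φ (x ⊗ₜ 1) = Ψ (x ⊗ₜ 1))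
    (hmul : ∀ g ω, (∀ x, Φ (x ⊗ₜ ω) = Ψ (x ⊗ₜ ω)) →
      ∀ x, Φ (x ⊗ₜ (ι F g * ω)) = Ψ (x ⊗ₜ (ι F g * ω))) : Φ = Ψ := by
  refine TensorProduct.ext' fun x ω => ?_
  induction ω using CliffordAlgebra.left_induction generalizing x with
  | algebraMap r =>
    rw [Algebra.algebraMap_eq_smul_one, TensorProduct.tmul_smul, map_smul, map_smul]
    congr 1
    exact h1 x
  | add a b ha hb => rw [TensorProduct.tmul_add, map_add, map_add, ha, hb]
  | ι_mul ω g h => exact hmul g ω h x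

/-- Operators on the coefficients. -/
noncomputable def leftOp (B : Module.End F V) : Module.End F (V ⊗[F] ExteriorAlgebra F L) :=
  LinearMap.rTensor _ B

/-- Exterior multiplication with a vector. -/
noncomputable def wedgeOp : L →ₗ[F] Module.End F (V ⊗[F] ExteriorAlgebra F L) :=
  LinearMap.lTensorHom V ∘ₗ LinearMap.mul F (ExteriorAlgebra F L) ∘ₗ ι F

/-- Contraction with a linear form. -/
noncomputable def contrOp (f : Dual F L) : Module.End F (V ⊗[F] ExteriorAlgebra F L) :=
  LinearMap.lTensor V (CliffordAlgebra.contractLeft f)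

/-- The recursion step `(g, ω, n) ↦ (x ↦ A g x ⊗ ω - g ∧ n x)` defining the Koszul operator. -/
noncomputable def koszulStep (A : L →ₗ[F] Module.End F V) :
    L →ₗ[F] ExteriorAlgebra F L × (V →ₗ[F] V ⊗[F] ExteriorAlgebra F L) →ₗ[F]
      (V →ₗ[F] V ⊗[F] ExteriorAlgebra F L) :=
  LinearMap.mk₂ F (fun g y => (TensorProduct.mk F V (ExteriorAlgebra F L)).flip y.1 ∘ₗ A g -
      wedgeOp g ∘ₗ y.2)
    (by
      intro g h y
      ext x
      simp only [map_add, LinearMap.sub_apply, LinearMap.add_apply, LinearMap.comp_apply,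
        LinearMap.flip_apply]
      abel)
    (by
      intro a g y
      ext x
      simp only [map_smul, LinearMap.sub_apply, LinearMap.smul_apply, LinearMap.comp_apply,
        LinearMap.flip_apply, smul_sub])
    (by
      intro g y z
      ext x
      simp only [map_add, LinearMap.sub_apply, LinearMap.add_apply, LinearMap.comp_apply,
        LinearMap.flip_apply, Prod.fst_add, Prod.snd_add]
      abel)
    (by
      intro a g y
      ext x
      simp only [map_smul, LinearMap.sub_apply, LinearMap.smul_apply, LinearMap.comp_apply,
        LinearMap.flip_apply, smul_sub, Prod.smul_fst, Prod.smul_snd])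

/-- The instance of `mul_neg` for operators on `V ⊗ Λ L`, stated for rewriting. -/
theorem opMul_neg (A B : Module.End F (V ⊗[F] ExteriorAlgebra F L)) : A * -B = -(A * B) :=
  mul_neg A B

/-- The instance of `neg_mul` for operators on `V ⊗ Λ L`, stated for rewriting. -/
theorem opNeg_mul (A B : Module.End F (V ⊗[F] ExteriorAlgebra F L)) : -A * B = -(A * B) :=
  neg_mul A B

theorem wedgeOp_tmul (g : L) (x : V) (ω : ExteriorAlgebra F L) :
    wedgeOp g (x ⊗ₜ[F] ω) = x ⊗ₜ (ι F g * ω) := rfl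

theorem leftOp_tmul (B : Module.End F V) (x : V) (ω : ExteriorAlgebra F L) :
    leftOp B (x ⊗ₜ[F] ω) = B x ⊗ₜ ω := rfl

theorem contrOp_tmul (f : Dual F L) (x : V) (ω : ExteriorAlgebra F L) :
    contrOp f (x ⊗ₜ[F] ω) = x ⊗ₜ (CliffordAlgebra.contractLeft f ω : ExteriorAlgebra F L) := rfl

theorem wedgeOp_mul_self (g : L) : wedgeOp g * wedgeOp g = (0 : Module.End F (V ⊗[F] _)) := by
  refine TensorProduct.ext' fun x ω => ?_
  rw [Module.End.mul_apply, wedgeOp_tmul, wedgeOp_tmul, ← mul_assoc, ι_sq_zero, zero_mul,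
    TensorProduct.tmul_zero]
  rfl

/-- The operator `x ⊗ (g₁ ∧ ⋯ ∧ g_s) ↦ ∑ (-1)^(i-1) A(g_i) x ⊗ (g₁ ∧ ⋯ ĝ_i ⋯ ∧ g_s)` attached to
a linear family `A` of operators on the coefficients. It is defined by recursion on the exterior
algebra, seen as the Clifford algebra of the zero form. -/
noncomputable def koszulOp (A : L →ₗ[F] Module.End F V) :
    Module.End F (V ⊗[F] ExteriorAlgebra F L) :=
  TensorProduct.lift (LinearMap.flip (CliffordAlgebra.foldr' 0 (koszulStep A) (by
    intro g ω n
    ext x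
    simp only [koszulStep, LinearMap.mk₂_apply, LinearMap.sub_apply, LinearMap.comp_apply,
      LinearMap.flip_apply, TensorProduct.mk_apply, map_sub, wedgeOp_tmul]
    have h := LinearMap.congr_fun (wedgeOp_mul_self (V := V) g) (n x)
    rw [Module.End.mul_apply] at h
    rw [h, show ((0 : QuadraticForm F L) g) = 0 from rfl, zero_smul]
    erw [sub_zero]
    exact sub_self _) 0))

theorem koszulOp_tmul_algebraMap (A : L →ₗ[F] Module.End F V) (x : V) (r : F) :
    koszulOp A (x ⊗ₜ[F] algebraMap F (ExteriorAlgebra F L) r) = 0 := by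
  rw [koszulOp, TensorProduct.lift.tmul, LinearMap.flip_apply]
  erw [CliffordAlgebra.foldr'_algebraMap]
  rw [smul_zero]
  rfl

theorem koszulOp_tmul_one (A : L →ₗ[F] Module.End F V) (x : V) :
    koszulOp A (x ⊗ₜ[F] (1 : ExteriorAlgebra F L)) = 0 := by
  rw [← map_one (algebraMap F (ExteriorAlgebra F L)), koszulOp_tmul_algebraMap]

theorem koszulOp_tmul_ι_mul (A : L →ₗ[F] Module.End F V) (x : V) (g : L)
    (ω : ExteriorAlgebra F L) :
    koszulOp A (x ⊗ₜ[F] (ι F g * ω)) = A g x ⊗ₜ ω - wedgeOp g (koszulOp A (x ⊗ₜ ω)) := by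
  rw [koszulOp, TensorProduct.lift.tmul, TensorProduct.lift.tmul, LinearMap.flip_apply]
  erw [CliffordAlgebra.foldr'_ι_mul]
  rfl

theorem wedgeOp_mul_comm (g h : L) :
    wedgeOp g * wedgeOp h = (-(wedgeOp h * wedgeOp g) : Module.End F (V ⊗[F] _)) := by
  have h1 := wedgeOp_mul_self (F := F) (V := V) (g + h)
  rw [map_add, mul_add, add_mul, add_mul, wedgeOp_mul_self, wedgeOp_mul_self, zero_add,
    add_zero] at h1
  rw [add_comm] at h1
  exact eq_neg_of_add_eq_zero_left h1

theorem contrOp_mul_self (f : Dual F L) :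
    contrOp f * contrOp f = (0 : Module.End F (V ⊗[F] _)) := by
  refine TensorProduct.ext' fun x ω => ?_
  rw [Module.End.mul_apply, contrOp_tmul, contrOp_tmul, CliffordAlgebra.contractLeft_contractLeft,
    TensorProduct.tmul_zero]
  rfl

theorem contrOp_mul_wedgeOp (f : Dual F L) (g : L) :
    contrOp f * wedgeOp g = (f g • 1 - wedgeOp g * contrOp f : Module.End F (V ⊗[F] _)) := by
  refine TensorProduct.ext' fun x ω => ?_
  rw [LinearMap.sub_apply, Module.End.mul_apply, Module.End.mul_apply, wedgeOp_tmul, contrOp_tmul,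
    contrOp_tmul, wedgeOp_tmul]
  erw [CliffordAlgebra.contractLeft_ι_mul]
  erw [TensorProduct.tmul_sub, TensorProduct.tmul_smul]
  rfl

theorem leftOp_mul (B C : Module.End F V) :
    leftOp (L := L) (B * C) = leftOp B * leftOp C := LinearMap.rTensor_mul _ _ _

theorem leftOp_one : leftOp (L := L) (1 : Module.End F V) = 1 := LinearMap.rTensor_id _ _

theorem leftOp_sub (B C : Module.End F V) :
    leftOp (L := L) (B - C) = leftOp B - leftOp C := LinearMap.rTensor_sub _ _

theorem wedgeOp_mul_leftOp (g : L) (B : Module.End F V) :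
    wedgeOp g * leftOp B = leftOp B * wedgeOp g :=
  TensorProduct.ext' fun _ _ => rfl

theorem contrOp_mul_leftOp (f : Dual F L) (B : Module.End F V) :
    contrOp f * leftOp B = leftOp B * contrOp f :=
  TensorProduct.ext' fun _ _ => rfl

/-- The Cartan formula. -/
theorem koszulOp_mul_wedgeOp (A : L →ₗ[F] Module.End F V) (g : L) :
    koszulOp A * wedgeOp g = leftOp (A g) - wedgeOp g * koszulOp A :=
  TensorProduct.ext' fun x ω => koszulOp_tmul_ι_mul A x g ω

/-- Any operator satisfying the recursion of the Koszul operator is equal to it. -/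
theorem eq_koszulOp {A : L →ₗ[F] Module.End F V} {Φ : Module.End F (V ⊗[F] ExteriorAlgebra F L)}
    (h1 : ∀ x, Φ (x ⊗ₜ 1) = 0) (h : ∀ g, Φ * wedgeOp g = leftOp (A g) - wedgeOp g * Φ) :
    Φ = koszulOp A := by
  refine tensor_hom_ext (fun x => by rw [h1, koszulOp_tmul_one]) fun g ω hω x => ?_
  have := LinearMap.congr_fun (h g) (x ⊗ₜ ω)
  rw [Module.End.mul_apply, wedgeOp_tmul, LinearMap.sub_apply, Module.End.mul_apply, hω] at this
  rw [this, koszulOp_tmul_ι_mul]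
  rfl

theorem koszulOp_sub (A B : L →ₗ[F] Module.End F V) :
    koszulOp (A - B) = koszulOp A - koszulOp B := by
  refine (eq_koszulOp (fun x => ?_) fun g => ?_).symm
  · rw [LinearMap.sub_apply, koszulOp_tmul_one, koszulOp_tmul_one, sub_zero]
  · rw [sub_mul, koszulOp_mul_wedgeOp, koszulOp_mul_wedgeOp, LinearMap.sub_apply, leftOp_sub,
      mul_sub]
    abel

/-- A Koszul operator that involves a single direction. -/
theorem koszulOp_smulRight (f : Dual F L) (B : Module.End F V) :
    koszulOp (f.smulRight B) = leftOp B * contrOp f := by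
  refine (eq_koszulOp (fun x => ?_) fun g => ?_).symm
  · rw [Module.End.mul_apply, contrOp_tmul]
    erw [CliffordAlgebra.contractLeft_one]
    rw [TensorProduct.tmul_zero, map_zero]
  · rw [mul_assoc, contrOp_mul_wedgeOp, mul_sub, ← mul_assoc, ← wedgeOp_mul_leftOp, mul_assoc,
      LinearMap.smulRight_apply, mul_smul_comm, mul_one]
    congr 1
    exact (LinearMap.rTensor_smul _ _ _).symm

/-- The commutator of a Koszul operator with an operator on the coefficients. -/
theorem leftOp_mul_koszulOp_sub {A A' : L →ₗ[F] Module.End F V} {B : Module.End F V}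
    (h : ∀ g, B * A g - A g * B = A' g) :
    leftOp B * koszulOp A - koszulOp A * leftOp B = koszulOp A' := by
  refine eq_koszulOp (fun x => ?_) fun g => ?_
  · rw [LinearMap.sub_apply, Module.End.mul_apply, Module.End.mul_apply, leftOp_tmul,
      koszulOp_tmul_one, koszulOp_tmul_one, map_zero, sub_zero]
  · have e1 : leftOp (A' g) = leftOp B * leftOp (A g) - leftOp (A g) * leftOp (L := L) B := by
      rw [← h, leftOp_sub, leftOp_mul, leftOp_mul]
    rw [e1, sub_mul, mul_assoc, koszulOp_mul_wedgeOp, mul_assoc, ← wedgeOp_mul_leftOp,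
      ← mul_assoc (koszulOp A), koszulOp_mul_wedgeOp, mul_sub, sub_mul, mul_sub, ← mul_assoc,
      ← wedgeOp_mul_leftOp]
    noncomm_ring

theorem koszulOp_mul_contrOp (A : L →ₗ[F] Module.End F V) (f : Dual F L) :
    koszulOp A * contrOp f = -(contrOp f * koszulOp A) := by
  rw [eq_neg_iff_add_eq_zero]
  refine tensor_hom_ext (fun x => ?_) fun g ω hω x => ?_
  · rw [LinearMap.add_apply, Module.End.mul_apply, Module.End.mul_apply, contrOp_tmul,
      koszulOp_tmul_one, map_zero]
    erw [CliffordAlgebra.contractLeft_one]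
    rw [TensorProduct.tmul_zero, map_zero, add_zero]
    rfl
  · have e1 : (koszulOp A * contrOp f + contrOp f * koszulOp A) * wedgeOp g =
        wedgeOp g * (koszulOp A * contrOp f + contrOp f * koszulOp A) := by
      rw [add_mul, mul_assoc, contrOp_mul_wedgeOp, mul_assoc, koszulOp_mul_wedgeOp, mul_sub,
        mul_sub, ← mul_assoc, koszulOp_mul_wedgeOp, ← mul_assoc (contrOp f), contrOp_mul_wedgeOp,
        contrOp_mul_leftOp, mul_smul_comm, mul_one, sub_mul, sub_mul, smul_mul_assoc, one_mul]
      noncomm_ring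
    have e2 := LinearMap.congr_fun e1 (x ⊗ₜ ω)
    rw [Module.End.mul_apply, Module.End.mul_apply, wedgeOp_tmul, hω] at e2
    rw [e2, LinearMap.zero_apply, LinearMap.zero_apply, map_zero]

theorem koszulOp_mul_self {A : L →ₗ[F] Module.End F V} (h : ∀ g g', A g * A g' = A g' * A g) :
    koszulOp A * koszulOp A = 0 := by
  have hc : ∀ g, leftOp (A g) * koszulOp A = koszulOp A * leftOp (A g) := by
    intro g
    have h0 := leftOp_mul_koszulOp_sub (A := A) (A' := 0) (B := A g) (fun g' => by
      rw [h, sub_self]; rfl)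
    have h1 := koszulOp_sub A A
    rw [sub_self, sub_self] at h1
    rw [h1] at h0
    exact sub_eq_zero.mp h0
  refine tensor_hom_ext (fun x => ?_) fun g ω hω x => ?_
  · rw [Module.End.mul_apply, koszulOp_tmul_one, map_zero]
    rfl
  · have e1 : koszulOp A * koszulOp A * wedgeOp g = wedgeOp g * (koszulOp A * koszulOp A) := by
      rw [mul_assoc, koszulOp_mul_wedgeOp, mul_sub, ← hc, ← mul_assoc, koszulOp_mul_wedgeOp,
        sub_mul, sub_sub_cancel, mul_assoc]
    have e2 := LinearMap.congr_fun e1 (x ⊗ₜ ω)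
    rw [Module.End.mul_apply, wedgeOp_tmul, Module.End.mul_apply (wedgeOp g), hω] at e2
    rw [e2, LinearMap.zero_apply, LinearMap.zero_apply, map_zero]

/-- The tensors `∑ x ⊗ ω` with all `x` in `S` and all `ω` of degree `s`. -/
noncomputable def coefDegree (S : Submodule F V) (s : ℕ) :
    Submodule F (V ⊗[F] ExteriorAlgebra F L) :=
  Submodule.map₂ (TensorProduct.mk F V (ExteriorAlgebra F L)) S (⋀[F]^s L)

theorem tmul_mem_coefDegree {S : Submodule F V} {s : ℕ} {x : V} {ω : ExteriorAlgebra F L}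
    (hx : x ∈ S) (hω : ω ∈ ⋀[F]^s L) : x ⊗ₜ ω ∈ coefDegree (L := L) S s :=
  Submodule.apply_mem_map₂ _ hx hω

theorem wedgeOp_mem_coefDegree {S : Submodule F V} {s : ℕ} (g : L)
    {w : V ⊗[F] ExteriorAlgebra F L} (hw : w ∈ coefDegree S s) :
    wedgeOp g w ∈ coefDegree (L := L) S (s + 1) := by
  have : coefDegree S s ≤ (coefDegree S (s + 1)).comap (wedgeOp (V := V) g) :=
    Submodule.map₂_le.mpr fun x hx ω hω =>
      tmul_mem_coefDegree hx (ι_mul_mem_exteriorPower g hω)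
  exact this hw

theorem koszulOp_tmul_mem {A : L →ₗ[F] Module.End F V} {S : Submodule F V} {x : V}
    (hx : ∀ g, A g x ∈ S) {s : ℕ} {ω : ExteriorAlgebra F L} (hω : ω ∈ ⋀[F]^(s + 1) L) :
    koszulOp A (x ⊗ₜ ω) ∈ coefDegree (L := L) S s := by
  induction s generalizing ω with
  | zero =>
    refine exteriorPower_succ_induction
      (P := fun ω => koszulOp A (x ⊗ₜ ω) ∈ coefDegree (L := L) S 0)
      (fun g ω hω => ?_) (fun ω η h1 h2 => ?_) hω
    · obtain ⟨r, rfl⟩ := exists_algebraMap_of_mem_exteriorPower_zero hω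
      rw [koszulOp_tmul_ι_mul, koszulOp_tmul_algebraMap, map_zero, sub_zero]
      exact tmul_mem_coefDegree (hx g) hω
    · rw [TensorProduct.tmul_add, map_add]
      exact add_mem h1 h2
  | succ s ih =>
    refine exteriorPower_succ_induction
      (P := fun ω => koszulOp A (x ⊗ₜ ω) ∈ coefDegree (L := L) S (s + 1))
      (fun g ω hω => ?_) (fun ω η h1 h2 => ?_) hω
    · rw [koszulOp_tmul_ι_mul]
      exact sub_mem (tmul_mem_coefDegree (hx g) hω) (wedgeOp_mem_coefDegree g (ih hω))
    · rw [TensorProduct.tmul_add, map_add]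
      exact add_mem h1 h2

theorem koszulOp_tmul_ιMulti (A : L →ₗ[F] Module.End F V) (x : V) (s : ℕ) (v : Fin (s + 1) → L) :
    koszulOp A (x ⊗ₜ ιMulti F (s + 1) v) =
      ∑ i : Fin (s + 1), (-1) ^ (i : ℕ) • (A (v i) x ⊗ₜ[F] ιMulti F s (i.removeNth v)) := by
  induction s with
  | zero =>
    rw [ιMulti_succ_apply, koszulOp_tmul_ι_mul, ιMulti_zero_apply, koszulOp_tmul_one, map_zero]
    simp
  | succ s ih =>
    rw [ιMulti_succ_apply, koszulOp_tmul_ι_mul, ih, Fin.sum_univ_succ (n := s + 1), map_sum,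
      sub_eq_add_neg, ← Finset.sum_neg_distrib]
    congr 1
    · simp [Fin.removeNth_zero]; rfl
    · refine Finset.sum_congr rfl fun i _ => ?_
      rw [map_zsmul, wedgeOp_tmul, Fin.val_succ, pow_succ, mul_neg_one, neg_smul, ιMulti_succ_apply]
      have h0 : i.succ.removeNth v 0 = v 0 := by simp [Fin.removeNth]
      have h1 : Matrix.vecTail (i.succ.removeNth v) = i.removeNth (Matrix.vecTail v) := by
        funext j
        simp [Matrix.vecTail, Fin.removeNth]
      rw [h0, h1]
      rfl

end Operators

end ExteriorAlgebra

/-! ### Differential operators on polynomials with coefficients in a module -/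

namespace MultisetPoly

open Finsupp

section

variable {F : Type*} [Field F] {I : Type*} {N : Type*} [AddCommGroup N] [Module F N]

/-- An operator on the coefficients, extended to polynomials. Polynomials in variables indexed by
`I`, with coefficients in `N`, are represented as functions on the multisets of indices. -/
noncomputable def coeffOp (B : Module.End F N) : Module.End F (Multiset I →₀ N) :=
  Finsupp.mapRange.linearMap B

open Classical in
/-- The operator `∑ j, ∂_j G_j`, where `∂_j` is the partial derivative and `G_j` acts on the
coefficients. -/
noncomputable def derivOp (G : I → Module.End F N) : Module.End F (Multiset I →₀ N) :=
  Finsupp.lsum F fun m => (m.map fun j => Finsupp.lsingle (m.erase j) ∘ₗ G j).sum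

/-- Multiplication by the variable of index `i`. -/
noncomputable def consOp (i : I) : Module.End F (Multiset I →₀ N) :=
  Finsupp.lmapDomain N F fun m => i ::ₘ m

open Classical in
/-- The operator that multiplies by the variable of index `i` and divides by the new exponent:
integration in this variable. -/
noncomputable def integralOp (i : I) : Module.End F (Multiset I →₀ N) :=
  Finsupp.lsum F fun m => ((m.count i + 1 : ℕ) : F)⁻¹ • Finsupp.lsingle (i ::ₘ m)

open Classical in
/-- The operator `Z` on the coefficients, followed by the evaluation of the variable of index `i`
at zero. -/
noncomputable def evalZeroOp (i : I) (Z : Module.End F N) : Module.End F (Multiset I →₀ N) :=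
  Finsupp.lsum F fun m => if i ∈ m then 0 else Finsupp.lsingle m ∘ₗ Z

theorem coeffOp_single (B : Module.End F N) (m : Multiset I) (w : N) :
    coeffOp B (single m w) = single m (B w) := by
  simp [coeffOp]

theorem consOp_single (i : I) (m : Multiset I) (w : N) :
    consOp (F := F) i (single m w) = single (i ::ₘ m) w := by
  simp [consOp]

open Classical in
theorem integralOp_single (i : I) (m : Multiset I) (w : N) :
    integralOp (F := F) i (single m w) =
      ((m.count i + 1 : ℕ) : F)⁻¹ • single (i ::ₘ m) w := by
  rw [integralOp, lsum_single, LinearMap.smul_apply, lsingle_apply]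

open Classical in
theorem evalZeroOp_single (i : I) (Z : Module.End F N) (m : Multiset I) (w : N) :
    evalZeroOp i Z (single m w) = if i ∈ m then 0 else single m (Z w) := by
  rw [evalZeroOp, lsum_single]
  split_ifs <;> simp

theorem sum_map_linearMap_apply {Q J : Type*} [AddCommGroup Q] [Module F Q] (A : Multiset J)
    (f : J → N →ₗ[F] Q) (w : N) : (A.map f).sum w = (A.map fun j => f j w).sum := by
  induction A using Multiset.induction_on with
  | empty => simp
  | cons j A ih => simp [ih]

open Classical in
theorem derivOp_single (G : I → Module.End F N) (m : Multiset I) (w : N) :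
    derivOp G (single m w) = (m.map fun j => single (m.erase j) (G j w)).sum := by
  rw [derivOp, lsum_single, sum_map_linearMap_apply]
  rfl

theorem derivOp_single_zero (G : I → Module.End F N) (w : N) :
    derivOp G (single 0 w) = 0 := by
  rw [derivOp_single, Multiset.map_zero, Multiset.sum_zero]

/-- The commutation relation of differentiation and multiplication by a variable. -/
theorem derivOp_mul_consOp (G : I → Module.End F N) (i : I) :
    derivOp G * consOp i = consOp i * derivOp G + coeffOp (G i) := by
  classical
  refine Finsupp.lhom_ext fun m w => ?_
  rw [LinearMap.add_apply, Module.End.mul_apply, Module.End.mul_apply, consOp_single,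
    derivOp_single, derivOp_single, coeffOp_single, map_multiset_sum, Multiset.map_map,
    Multiset.map_cons, Multiset.sum_cons, Multiset.erase_cons_head, add_comm]
  congr 2
  refine Multiset.map_congr rfl fun j hj => ?_
  rw [Function.comp_apply, consOp_single, Multiset.erase_cons_tail_of_mem hj]

theorem hom_ext {Q : Type*} [AddCommGroup Q] [Module F Q]
    {Φ Ψ : (Multiset I →₀ N) →ₗ[F] Q} (h0 : ∀ w, Φ (single 0 w) = Ψ (single 0 w))
    (hcons : ∀ i m, (∀ w, Φ (single m w) = Ψ (single m w)) →
      ∀ w, Φ (single (i ::ₘ m) w) = Ψ (single (i ::ₘ m) w)) : Φ = Ψ := by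
  refine Finsupp.lhom_ext fun m w => ?_
  induction m using Multiset.induction_on generalizing w with
  | empty => exact h0 w
  | cons i m ih => exact hcons i m ih w

/-- The operator `derivOp G` is characterized by its commutation relations with the variables. -/
theorem eq_derivOp {G : I → Module.End F N} {Φ : Module.End F (Multiset I →₀ N)}
    (h0 : ∀ w, Φ (single 0 w) = 0)
    (h : ∀ i, Φ * consOp i = consOp i * Φ + coeffOp (G i)) : Φ = derivOp G := by
  refine hom_ext (fun w => by rw [h0, derivOp_single_zero]) fun i m hm w => ?_
  have h1 := LinearMap.congr_fun (h i) (single m w)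
  have h2 := LinearMap.congr_fun (derivOp_mul_consOp G i) (single m w)
  rw [Module.End.mul_apply, consOp_single, LinearMap.add_apply, Module.End.mul_apply] at h1 h2
  rw [h1, h2, hm]

theorem coeffOp_mul_consOp (B : Module.End F N) (i : I) :
    coeffOp B * consOp i = consOp i * coeffOp B :=
  Finsupp.lhom_ext fun m w => by
    rw [Module.End.mul_apply, Module.End.mul_apply, consOp_single, coeffOp_single, coeffOp_single,
      consOp_single]

theorem coeffOp_mul (A B : Module.End F N) :
    coeffOp (I := I) (A * B) = coeffOp A * coeffOp B :=
  Finsupp.lhom_ext fun m w => by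
    rw [Module.End.mul_apply, coeffOp_single, coeffOp_single, coeffOp_single, Module.End.mul_apply]

theorem coeffOp_add (A B : Module.End F N) :
    coeffOp (I := I) (A + B) = coeffOp A + coeffOp B :=
  Finsupp.lhom_ext fun m w => by
    rw [LinearMap.add_apply, coeffOp_single, coeffOp_single, coeffOp_single, LinearMap.add_apply,
      single_add]

theorem coeffOp_sub (A B : Module.End F N) :
    coeffOp (I := I) (A - B) = coeffOp A - coeffOp B :=
  Finsupp.lhom_ext fun m w => by
    rw [LinearMap.sub_apply, coeffOp_single, coeffOp_single, coeffOp_single, LinearMap.sub_apply,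
      single_sub]

theorem coeffOp_zero : coeffOp (I := I) (0 : Module.End F N) = 0 :=
  Finsupp.lhom_ext fun m w => by
    rw [coeffOp_single, LinearMap.zero_apply, single_zero, LinearMap.zero_apply]

theorem derivOp_add (G H : I → Module.End F N) : derivOp (G + H) = derivOp G + derivOp H := by
  refine (eq_derivOp (fun w => ?_) fun i => ?_).symm
  · rw [LinearMap.add_apply, derivOp_single_zero, derivOp_single_zero, add_zero]
  · rw [add_mul, derivOp_mul_consOp, derivOp_mul_consOp, Pi.add_apply, coeffOp_add, mul_add]
    abel

theorem derivOp_sub (G H : I → Module.End F N) : derivOp (G - H) = derivOp G - derivOp H := by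
  refine (eq_derivOp (fun w => ?_) fun i => ?_).symm
  · rw [LinearMap.sub_apply, derivOp_single_zero, derivOp_single_zero, sub_zero]
  · rw [sub_mul, derivOp_mul_consOp, derivOp_mul_consOp, Pi.sub_apply, coeffOp_sub, mul_sub]
    abel

theorem derivOp_zero : derivOp (0 : I → Module.End F N) = 0 := by
  refine (eq_derivOp (fun w => rfl) fun i => ?_).symm
  rw [Pi.zero_apply, coeffOp_zero, zero_mul, mul_zero, add_zero]

theorem coeffOp_mul_derivOp (B : Module.End F N) (G : I → Module.End F N) :
    coeffOp B * derivOp G = derivOp fun j => B * G j := by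
  refine eq_derivOp (fun w => ?_) fun i => ?_
  · rw [Module.End.mul_apply, derivOp_single_zero, map_zero]
  · rw [mul_assoc, derivOp_mul_consOp, mul_add, ← mul_assoc, coeffOp_mul_consOp, coeffOp_mul,
      mul_assoc]

theorem derivOp_mul_coeffOp (B : Module.End F N) (G : I → Module.End F N) :
    derivOp G * coeffOp B = derivOp fun j => G j * B := by
  refine eq_derivOp (fun w => ?_) fun i => ?_
  · rw [Module.End.mul_apply, coeffOp_single, derivOp_single_zero]
  · rw [mul_assoc, coeffOp_mul_consOp, ← mul_assoc, derivOp_mul_consOp, add_mul, coeffOp_mul,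
      mul_assoc]

theorem derivOp_mul_coeffOp_add (B : Module.End F N) (G : I → Module.End F N)
    (h : ∀ j, G j * B + B * G j = 0) : derivOp G * coeffOp B + coeffOp B * derivOp G = 0 := by
  rw [derivOp_mul_coeffOp, coeffOp_mul_derivOp, ← derivOp_add, ← derivOp_zero]
  congr 1
  exact funext h

theorem derivOp_mul_self {G : I → Module.End F N} (h : ∀ i j, G i * G j + G j * G i = 0) :
    derivOp G * derivOp G = 0 := by
  rw [← derivOp_zero]
  refine eq_derivOp (fun w => ?_) fun i => ?_
  · rw [Module.End.mul_apply, derivOp_single_zero, map_zero]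
  · rw [mul_assoc, derivOp_mul_consOp, mul_add, ← mul_assoc, derivOp_mul_consOp, add_mul, add_assoc,
      add_comm (coeffOp (G i) * _), derivOp_mul_coeffOp_add _ _ fun j => h j i, Pi.zero_apply,
      coeffOp_zero, mul_assoc]

open Classical in
theorem derivOp_piSingle_single (i : I) (g : Module.End F N) (m : Multiset I) (w : N) :
    derivOp (Pi.single i g) (single m w) = (m.count i : F) • single (m.erase i) (g w) := by
  have hs : (m.map fun j => single (m.erase j) ((Pi.single i g : I → Module.End F N) j w)).sum =
      m.count i • single (m.erase i) (g w) := by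
    generalize m.erase = f
    induction m using Multiset.induction_on with
    | empty => simp
    | cons j m ih =>
      rw [Multiset.map_cons, Multiset.sum_cons, ih]
      by_cases hj : j = i
      · subst hj
        simp [add_smul, add_comm]
      · simp [hj, Multiset.count_cons_of_ne (Ne.symm hj)]
  rw [derivOp_single, hs, Nat.cast_smul_eq_nsmul]

/-- Integration in one variable commutes with the derivatives in the other variables. -/
theorem derivOp_mul_integralOp {G : I → Module.End F N} {i : I} (h : G i = 0) :
    derivOp G * integralOp i = integralOp i * derivOp G := by
  classical
  refine Finsupp.lhom_ext fun m w => ?_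
  rw [Module.End.mul_apply, Module.End.mul_apply, integralOp_single, map_smul,
    ← consOp_single (F := F), ← Module.End.mul_apply, derivOp_mul_consOp, h, coeffOp_zero,
    add_zero, Module.End.mul_apply, derivOp_single, map_multiset_sum, map_multiset_sum,
    Multiset.map_map, Multiset.map_map, Multiset.smul_sum, Multiset.map_map]
  refine congrArg _ (Multiset.map_congr rfl fun j _ => ?_)
  rw [Function.comp_apply, Function.comp_apply, Function.comp_apply, consOp_single,
    integralOp_single]
  by_cases hj : j = i
  · rw [hj, h, LinearMap.zero_apply, single_zero, smul_zero, smul_zero]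
  · rw [Multiset.count_erase_of_ne (Ne.symm hj)]

theorem coeffOp_mul_integralOp (B : Module.End F N) (i : I) :
    coeffOp B * integralOp i = integralOp i * coeffOp B := by
  classical
  exact Finsupp.lhom_ext fun m w => by
    rw [Module.End.mul_apply, Module.End.mul_apply, integralOp_single, map_smul, coeffOp_single,
      coeffOp_single, integralOp_single]

open Classical in
/-- The homotopy formula in one variable: for a differential `K + ∑ j, ∂_j G_j` and a homotopy
`A - ∫_i B` that satisfy the given relations on the coefficients, the anticommutator is the identity
minus the operator `Z` on the terms without this variable. The hypotheses `h0` and `h1` say that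
the exponents by which the integration divides are invertible in `F`. -/
theorem homotopy_single {K A B Y Z : Module.End F N} {G : I → Module.End F N} {i : I}
    (hA : K * A + A * K = 1 - Z - Y) (hB : K * B + B * K = 0) (hGA : ∀ j, G j * A + A * G j = 0)
    (hGB : ∀ j, j ≠ i → G j * B + B * G j = 0) (hY : G i * B = -Y) (hZ : B * G i = -Z)
    (m : Multiset I) (w : N) (h0 : ((m.count i : ℕ) : F) = 0 → i ∉ m)
    (h1 : ((m.count i + 1 : ℕ) : F) ≠ 0) :
    (coeffOp K + derivOp G : Module.End F (Multiset I →₀ N))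
        ((coeffOp A - integralOp i * coeffOp B : Module.End F (Multiset I →₀ N)) (single m w)) +
      (coeffOp A - integralOp i * coeffOp B : Module.End F (Multiset I →₀ N))
        ((coeffOp K + derivOp G : Module.End F (Multiset I →₀ N)) (single m w)) =
    single m w - evalZeroOp i Z (single m w) := by
  -- `G'` collects the derivatives in the other variables, which commute with the integration.
  set G' : I → Module.End F N := Function.update G i 0 with hG'
  have hsplit : derivOp G = derivOp G' + derivOp (Pi.single i (G i)) := by
    rw [← derivOp_add]
    congr 1
    funext j
    by_cases hj : j = i
    · subst hj; simp [hG']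
    · simp [hG', hj]
  have e1 : coeffOp (I := I) K * coeffOp A + coeffOp A * coeffOp K =
      1 - coeffOp Z - coeffOp Y := by
    rw [← coeffOp_mul, ← coeffOp_mul, ← coeffOp_add, hA, coeffOp_sub, coeffOp_sub]
    congr 2
    exact Finsupp.lhom_ext fun m w => by rw [coeffOp_single]; rfl
  have e2 : coeffOp K * (integralOp i * coeffOp B) + integralOp i * coeffOp B * coeffOp K = 0 := by
    rw [← mul_assoc, coeffOp_mul_integralOp, mul_assoc, mul_assoc, ← mul_add, ← coeffOp_mul,
      ← coeffOp_mul, ← coeffOp_add, hB, coeffOp_zero, mul_zero]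
  have e3 := derivOp_mul_coeffOp_add A G hGA
  have e4 :
      derivOp G' * (integralOp i * coeffOp B) + integralOp i * coeffOp B * derivOp G' = 0 := by
    rw [← mul_assoc, derivOp_mul_integralOp (by simp [hG']), mul_assoc, mul_assoc, ← mul_add,
      derivOp_mul_coeffOp_add, mul_zero]
    intro j
    by_cases hj : j = i
    · subst hj; simp [hG']
    · simp [hG', hj, hGB j hj]
  -- Differentiation after integration is the identity.
  have e5 : derivOp (Pi.single i (G i)) (integralOp (F := F) i (coeffOp B (single m w))) =
      -single m (Y w) := by
    rw [coeffOp_single, integralOp_single, map_smul, derivOp_piSingle_single,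
      Multiset.count_cons_self, Multiset.erase_cons_head, smul_smul, inv_mul_cancel₀ h1, one_smul,
      ← Module.End.mul_apply, hY, LinearMap.neg_apply, single_neg]
  -- Integration after differentiation removes the terms without the variable.
  have e6 : integralOp (F := F) i (coeffOp B (derivOp (Pi.single i (G i)) (single m w))) =
      -single m (Z w) + evalZeroOp i Z (single m w) := by
    rw [derivOp_piSingle_single, map_smul, map_smul, coeffOp_single, ← Module.End.mul_apply B, hZ,
      evalZeroOp_single]
    by_cases hm : i ∈ m
    · rw [if_pos hm, add_zero, integralOp_single, Multiset.count_erase_self, Multiset.cons_erase hm,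
        Nat.sub_add_cancel (Multiset.one_le_count_iff_mem.mpr hm), smul_smul, mul_inv_cancel₀,
        one_smul, LinearMap.neg_apply, single_neg]
      exact fun h => h0 h hm
    · rw [if_neg hm, Multiset.count_eq_zero_of_notMem hm, Nat.cast_zero, zero_smul, neg_add_cancel]
  have f1 := LinearMap.congr_fun e1 (single m w)
  have f2 := LinearMap.congr_fun e2 (single m w)
  have f3 := LinearMap.congr_fun e3 (single m w)
  have f4 := LinearMap.congr_fun e4 (single m w)
  simp only [LinearMap.add_apply, LinearMap.sub_apply, Module.End.mul_apply, Module.End.one_apply,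
    LinearMap.zero_apply] at f1 f2 f3 f4
  rw [coeffOp_single Z, coeffOp_single Y] at f1
  simp only [LinearMap.add_apply, LinearMap.sub_apply, Module.End.mul_apply, map_add, map_sub]
  have f5 := LinearMap.congr_fun hsplit (integralOp (F := F) i (coeffOp B (single m w)))
  have f6 := congrArg (fun x : Multiset I →₀ N => integralOp (F := F) i (coeffOp B x))
    (LinearMap.congr_fun hsplit (single m w))
  simp only [LinearMap.add_apply, map_add] at f5 f6
  rw [f5, f6, e5, e6]
  linear_combination (norm := abel) f1 - f2 + f3 - f4

theorem evalZeroOp_comm {i j : I} {Y Z : Module.End F N} (h : Y * Z = Z * Y) :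
    evalZeroOp i Y * evalZeroOp j Z = evalZeroOp j Z * evalZeroOp i Y := by
  classical
  refine Finsupp.lhom_ext fun m w => ?_
  have := LinearMap.congr_fun h w
  simp only [Module.End.mul_apply] at this
  rw [Module.End.mul_apply, Module.End.mul_apply, evalZeroOp_single, evalZeroOp_single]
  by_cases hi : i ∈ m <;> by_cases hj : j ∈ m <;> simp [hi, hj, evalZeroOp_single, this]

end

end MultisetPoly

/-! ### The total complex of a module with commuting operators -/

namespace TotalComplex

open ExteriorAlgebra MultisetPoly

section Square

variable {F : Type*} [Field F] {L : Type*} [AddCommGroup L] [Module F L]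
  {V : Type*} [AddCommGroup V] [Module F V]

theorem koszulOp_mul_comm {X : L →ₗ[F] Module.End F V} {T : Module.End F V}
    (hT : ∀ g, T * X g = X g * T) : koszulOp X * leftOp T = leftOp T * koszulOp X := by
  have h0 := leftOp_mul_koszulOp_sub (A := X) (A' := X - X) (B := T) (fun g => by
    rw [hT, LinearMap.sub_apply, sub_self, sub_self])
  rw [koszulOp_sub, sub_self] at h0
  exact (sub_eq_zero.mp h0).symm

theorem koszulOp_mul_add_eq_zero {X : L →ₗ[F] Module.End F V} {T : Module.End F V} {v g : L}
    (hT : ∀ g, T * X g = X g * T) (hv : X v = T * X g) :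
    (wedgeOp v - leftOp T * wedgeOp g) * koszulOp X +
      koszulOp X * (wedgeOp v - leftOp T * wedgeOp g) = 0 := by
  rw [mul_sub, sub_mul, koszulOp_mul_wedgeOp, ← mul_assoc, koszulOp_mul_comm hT, mul_assoc,
    mul_assoc, koszulOp_mul_wedgeOp, mul_sub, hv, leftOp_mul]
  abel

theorem leftOp_mul_wedgeOp_mul (B C : Module.End F V) (g h : L) :
    leftOp B * wedgeOp g * (leftOp C * wedgeOp h) = leftOp (B * C) * (wedgeOp g * wedgeOp h) := by
  rw [mul_assoc, ← mul_assoc (wedgeOp g), wedgeOp_mul_leftOp, leftOp_mul]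
  simp only [mul_assoc]

theorem leftOp_mul_wedgeOp_mul_add (B C : Module.End F V) (g h : L) (hBC : B * C = C * B ∨ g = h) :
    leftOp B * wedgeOp g * (leftOp C * wedgeOp h) +
      leftOp C * wedgeOp h * (leftOp B * wedgeOp g) = 0 := by
  rw [leftOp_mul_wedgeOp_mul, leftOp_mul_wedgeOp_mul]
  rcases hBC with hBC | rfl
  · rw [hBC, wedgeOp_mul_comm g h, opMul_neg, neg_add_cancel]
  · rw [wedgeOp_mul_self, mul_zero, mul_zero, add_zero]

theorem wedgeOp_sub_mul_add {B C : Module.End F V} (v w g h : L) (hBC : B * C = C * B) :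
    (wedgeOp v - leftOp B * wedgeOp g) * (wedgeOp w - leftOp C * wedgeOp h) +
      (wedgeOp w - leftOp C * wedgeOp h) * (wedgeOp v - leftOp B * wedgeOp g) = 0 := by
  have h1 := leftOp_mul_wedgeOp_mul_add B C g h (Or.inl hBC)
  have h2 : ∀ (v h : L) (C : Module.End F V), wedgeOp v * (leftOp C * wedgeOp h) =
      -(leftOp C * wedgeOp h * wedgeOp v) := by
    intro v h C
    rw [← mul_assoc, wedgeOp_mul_leftOp, mul_assoc, wedgeOp_mul_comm, opMul_neg, mul_assoc]
  rw [mul_sub, mul_sub, sub_mul, sub_mul, sub_mul, sub_mul, h2, h2, eq_neg_of_add_eq_zero_left h1,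
    wedgeOp_mul_comm v w]
  abel

end Square

/-- A module `V` over the commutative algebra generated by a vector space `L` with basis `e`,
together with the data that control the leading part of its total complex: a weighted basis `b` of
`V` and, for each `i`, operators that describe the action of `e_i` and of `e_i ^ (p - 1)` up to
terms of lower weight, and partial inverses of these operators. For `V = U_res(L)` with its monomial
basis, `raise i`, `lower i`, `jump i` and `drop i` change the exponent of `e_i` by `a ↦ a + 1`,
`a ↦ a - 1`, `0 ↦ p - 1` and `p - 1 ↦ 0`. -/
structure LeadingData (p : ℕ) {F : Type*} [Field F] {L : Type*} [AddCommGroup L] [Module F L]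
    {I : Type*} (e : Basis I F L) (V : Type*) [AddCommGroup V] [Module F V] (B : Type*) where
  /-- The action of `L`. -/
  mul : L →ₗ[F] Module.End F V
  /-- The action of `e_i ^ (p - 1)`. -/
  top : I → Module.End F V
  /-- The vectors `e_i^[p]`. -/
  pth : I → L
  mul_comm : ∀ g h, mul g * mul h = mul h * mul g
  top_mul_comm : ∀ i g, top i * mul g = mul g * top i
  top_comm : ∀ i j, top i * top j = top j * top i
  mul_pth : ∀ i, mul (pth i) = top i * mul (e i)
  /-- The weighted basis. -/
  b : Basis B F V
  /-- The weights. -/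
  wt : B → ℕ
  /-- The leading part of the action of `e_i`. -/
  raise : I → Module.End F V
  /-- The partial inverse of `raise i`. -/
  lower : I → Module.End F V
  /-- The leading part of `top i`. -/
  jump : I → Module.End F V
  /-- The partial inverse of `jump i`. -/
  drop : I → Module.End F V
  raise_lower : ∀ i, raise i * lower i + drop i * jump i = 1
  lower_raise : ∀ i, lower i * raise i + jump i * drop i = 1
  lower_comm_raise : ∀ i j, i ≠ j → lower i * raise j = raise j * lower i
  drop_comm_raise : ∀ i j, i ≠ j → drop i * raise j = raise j * drop i
  jump_comm_lower : ∀ i j, i ≠ j → jump i * lower j = lower j * jump i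
  jump_comm_drop : ∀ i j, i ≠ j → jump i * drop j = drop j * jump i
  drop_jump_comm : ∀ i j, i ≠ j → drop i * jump i * (drop j * jump j) =
    drop j * jump j * (drop i * jump i)
  lower_b : ∀ i β, lower i (b β) = 0 ∨ ∃ β', lower i (b β) = b β' ∧ wt β' + 1 = wt β
  drop_b : ∀ i β, drop i (b β) = 0 ∨ ∃ β', drop i (b β) = b β' ∧ wt β' + (p - 1) = wt β
  drop_jump_b : ∀ i β, drop i (jump i (b β)) = 0 ∨ drop i (jump i (b β)) = b β
  mul_sub_raise : ∀ i β, mul (e i) (b β) - raise i (b β) ∈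
    Submodule.span F (b '' {β' | wt β' ≤ wt β})
  top_sub_jump : ∀ i β, top i (b β) - jump i (b β) ∈
    Submodule.span F (b '' {β' | wt β' ≤ wt β + p - 2})

namespace LeadingData

section

variable {p : ℕ} {F : Type*} [Field F] {L : Type*} [AddCommGroup L] [Module F L]
  {I : Type*} {e : Basis I F L} {V : Type*} [AddCommGroup V] [Module F V] {B : Type*}
  (𝒟 : LeadingData p e V B)

/-- The operator `ω ↦ e_j^[p] ∧ ω - e_j ^ (p - 1) (e_j ∧ ω)` that goes with the derivative in the
variable `ē_j`. -/
noncomputable def divOp (j : I) : Module.End F (V ⊗[F] ExteriorAlgebra F L) :=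
  wedgeOp (𝒟.pth j) - leftOp (𝒟.top j) * wedgeOp (e j)

/-- The differential on `S L̄ ⊗ Λ L ⊗ V`, with polynomials in the `ē_j` written as functions on
multisets of indices. -/
noncomputable def totD : Module.End F (Multiset I →₀ V ⊗[F] ExteriorAlgebra F L) :=
  coeffOp (koszulOp 𝒟.mul) + derivOp 𝒟.divOp

theorem totD_mul_self : 𝒟.totD * 𝒟.totD = 0 := by
  have hK : koszulOp 𝒟.mul * koszulOp 𝒟.mul = 0 := koszulOp_mul_self 𝒟.mul_comm
  have h1 : derivOp 𝒟.divOp * derivOp 𝒟.divOp = 0 :=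
    derivOp_mul_self fun i j => wedgeOp_sub_mul_add _ _ _ _ (𝒟.top_comm i j)
  have h2 := derivOp_mul_coeffOp_add (koszulOp 𝒟.mul) 𝒟.divOp fun j =>
    koszulOp_mul_add_eq_zero (𝒟.top_mul_comm j) (𝒟.mul_pth j)
  rw [totD, add_mul, mul_add, mul_add, ← coeffOp_mul, hK, coeffOp_zero, zero_add, h1, add_zero,
    add_comm, h2]

/-- The leading part of the action of `L`. -/
noncomputable def leadMul : L →ₗ[F] Module.End F V := e.constr F 𝒟.raise

theorem leadMul_basis (j : I) : 𝒟.leadMul (e j) = 𝒟.raise j := by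
  rw [leadMul, Basis.constr_basis]

/-- The leading part of `divOp`. -/
noncomputable def leadDivOp (j : I) : Module.End F (V ⊗[F] ExteriorAlgebra F L) :=
  -(leftOp (𝒟.jump j) * wedgeOp (e j))

/-- The part of the differential that preserves the weight, for which `ē_j` has weight `p` and
`e_j ∈ L` has weight one. -/
noncomputable def leadD : Module.End F (Multiset I →₀ V ⊗[F] ExteriorAlgebra F L) :=
  coeffOp (koszulOp 𝒟.leadMul) + derivOp 𝒟.leadDivOp

/-- The part of the homotopy in the direction of `e_i` that inverts multiplication by `e_i`. -/
noncomputable def lowerOp (i : I) : Module.End F (V ⊗[F] ExteriorAlgebra F L) :=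
  leftOp (𝒟.lower i) * wedgeOp (e i)

/-- The part of the homotopy in the direction of `e_i` that inverts `ē_i ↦ e_i ^ (p - 1) e_i`, on
the coefficients. -/
noncomputable def dropOp (i : I) : Module.End F (V ⊗[F] ExteriorAlgebra F L) :=
  leftOp (𝒟.drop i) * contrOp (e.coord i)

/-- The homotopy in the direction of `e_i`. -/
noncomputable def homOp (i : I) : Module.End F (Multiset I →₀ V ⊗[F] ExteriorAlgebra F L) :=
  coeffOp (𝒟.lowerOp i) - integralOp i * coeffOp (𝒟.dropOp i)

/-- The projection onto the coefficients that do not involve `e_i`. -/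
noncomputable def constOp (i : I) : Module.End F (V ⊗[F] ExteriorAlgebra F L) :=
  leftOp (𝒟.drop i * 𝒟.jump i) * (contrOp (e.coord i) * wedgeOp (e i))

/-- The projection onto the part that does not involve `e_i` or `ē_i`. -/
noncomputable def projOp (i : I) : Module.End F (Multiset I →₀ V ⊗[F] ExteriorAlgebra F L) :=
  evalZeroOp i (𝒟.constOp i)

variable (V e) in
theorem contrOp_mul_wedgeOp_self (i : I) :
    contrOp (e.coord i) * wedgeOp (e i) =
      (1 - wedgeOp (e i) * contrOp (e.coord i) : Module.End F (V ⊗[F] ExteriorAlgebra F L)) := by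
  rw [contrOp_mul_wedgeOp, Basis.coord_apply, Basis.repr_self, Finsupp.single_eq_same, one_smul]

variable (V e) in
theorem contrOp_mul_wedgeOp_of_ne {i j : I} (h : j ≠ i) :
    contrOp (e.coord i) * wedgeOp (e j) =
      (-(wedgeOp (e j) * contrOp (e.coord i)) : Module.End F (V ⊗[F] ExteriorAlgebra F L)) := by
  rw [contrOp_mul_wedgeOp, Basis.coord_apply, Basis.repr_self, Finsupp.single_eq_of_ne h.symm,
    zero_smul, zero_sub]

/-- The commutator of the leading Koszul operator with an operator in the direction of `e_i`. -/
theorem koszulOp_leadMul_mul_leftOp (i : I) (φ : Module.End F V)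
    (h : ∀ j, i ≠ j → φ * 𝒟.raise j = 𝒟.raise j * φ) :
    koszulOp 𝒟.leadMul * leftOp φ =
      leftOp φ * koszulOp 𝒟.leadMul -
        leftOp (φ * 𝒟.raise i - 𝒟.raise i * φ) * contrOp (e.coord i) := by
  rw [← koszulOp_smulRight, eq_sub_iff_add_eq, ← eq_sub_iff_add_eq']
  refine (leftOp_mul_koszulOp_sub fun g => ?_).symm
  have : LinearMap.mulLeft F φ ∘ₗ 𝒟.leadMul - LinearMap.mulRight F φ ∘ₗ 𝒟.leadMul =
      (e.coord i).smulRight (φ * 𝒟.raise i - 𝒟.raise i * φ) := by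
    refine e.ext fun j => ?_
    simp only [LinearMap.sub_apply, LinearMap.comp_apply, leadMul_basis,
      LinearMap.mulLeft_apply, LinearMap.mulRight_apply, LinearMap.smulRight_apply,
      Basis.coord_apply, Basis.repr_self]
    by_cases hj : j = i
    · subst hj
      rw [Finsupp.single_eq_same, one_smul]
    · rw [Finsupp.single_eq_of_ne (Ne.symm hj), zero_smul, h j (Ne.symm hj), sub_self]
  exact LinearMap.congr_fun this g

/-- The contraction formula: along `e_i`, the leading part of the complex is contracted onto the
part that does not involve `e_i`. The bound on the degree of the monomial keeps the exponents that
the integration divides by less than `p`. -/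
theorem leadD_homOp_single [CharP F p] (i : I) (m : Multiset I)
    (w : V ⊗[F] ExteriorAlgebra F L) (hm : m.card + 1 < p) :
    𝒟.leadD (𝒟.homOp i (Finsupp.single m w)) + 𝒟.homOp i (𝒟.leadD (Finsupp.single m w)) =
      Finsupp.single m w - 𝒟.projOp i (Finsupp.single m w) := by
  classical
  have hcount := Multiset.count_le_card i m
  have hne : ∀ n, 0 < n → n < p → (n : F) ≠ 0 := fun n h0 h1 h =>
    absurd (Nat.le_of_dvd h0 ((CharP.cast_eq_zero_iff F p n).mp h)) (not_le.mpr h1)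
  have r1 := 𝒟.raise_lower i
  have r2 := 𝒟.lower_raise i
  refine homotopy_single
    (Y := leftOp (𝒟.jump i * 𝒟.drop i) * (wedgeOp (e i) * contrOp (e.coord i)))
    ?_ ?_ ?_ ?_ ?_ ?_ m w ?_ ?_
  · have hE := koszulOp_mul_wedgeOp 𝒟.leadMul (e i)
    rw [leadMul_basis] at hE
    rw [lowerOp, constOp, ← mul_assoc,
      koszulOp_leadMul_mul_leftOp 𝒟 i _ (𝒟.lower_comm_raise i), sub_mul, mul_assoc (leftOp _), hE,
      mul_sub, mul_assoc (leftOp _) (wedgeOp _), mul_assoc (leftOp _) (contrOp _),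
      contrOp_mul_wedgeOp_self, ← leftOp_mul,
      eq_sub_of_add_eq r1, eq_sub_of_add_eq r2]
    simp only [leftOp_sub, leftOp_one, sub_mul, mul_sub, one_mul, mul_one]
    abel
  · rw [dropOp, ← mul_assoc, koszulOp_leadMul_mul_leftOp 𝒟 i _ (𝒟.drop_comm_raise i), sub_mul,
      mul_assoc (leftOp _) (contrOp _) (contrOp _), contrOp_mul_self, mul_zero, sub_zero, mul_assoc,
      koszulOp_mul_contrOp, opMul_neg, mul_assoc, neg_add_cancel]
  · intro j
    have h := leftOp_mul_wedgeOp_mul_add (𝒟.jump j) (𝒟.lower i) (e j) (e i) (by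
      by_cases hj : j = i
      · exact Or.inr (by rw [hj])
      · exact Or.inl (𝒟.jump_comm_lower j i hj))
    rw [leadDivOp, lowerOp, opNeg_mul, opMul_neg, ← neg_add, h, neg_zero]
  · intro j hj
    rw [leadDivOp, dropOp, opNeg_mul, opMul_neg, ← neg_add, neg_eq_zero, mul_assoc,
      ← mul_assoc (wedgeOp _), wedgeOp_mul_leftOp, mul_assoc (leftOp _) (contrOp _),
      ← mul_assoc (contrOp _), contrOp_mul_leftOp, mul_assoc (leftOp _) (contrOp _),
      contrOp_mul_wedgeOp_of_ne e V hj, mul_assoc (leftOp _) (wedgeOp _), ← mul_assoc,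
      ← mul_assoc (leftOp _) (leftOp _), ← leftOp_mul, ← leftOp_mul, 𝒟.jump_comm_drop j i hj,
      opMul_neg, add_neg_cancel]
  · rw [leadDivOp, dropOp, opNeg_mul, mul_assoc, ← mul_assoc (wedgeOp _), wedgeOp_mul_leftOp,
      mul_assoc (leftOp _) (wedgeOp _), ← mul_assoc, ← leftOp_mul]
  · rw [leadDivOp, dropOp, constOp, opMul_neg, mul_assoc, ← mul_assoc (contrOp _),
      contrOp_mul_leftOp, mul_assoc (leftOp _) (contrOp _), ← mul_assoc, ← leftOp_mul]
  · intro h hi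
    exact hne _ (Multiset.count_pos.mpr hi) (by omega) h
  · exact hne _ (Nat.succ_pos _) (by omega)

theorem projOp_comm (i j : I) : 𝒟.projOp i * 𝒟.projOp j = 𝒟.projOp j * 𝒟.projOp i := by
  rcases eq_or_ne i j with rfl | hij
  · rfl
  refine evalZeroOp_comm ?_
  have h1 : (contrOp (e.coord i) * contrOp (e.coord j) :
      Module.End F (V ⊗[F] ExteriorAlgebra F L)) =
        -(contrOp (e.coord j) * contrOp (e.coord i)) := by
    refine TensorProduct.ext' fun x ω => ?_
    rw [LinearMap.neg_apply, Module.End.mul_apply, Module.End.mul_apply, contrOp_tmul, contrOp_tmul,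
      contrOp_tmul, contrOp_tmul, CliffordAlgebra.contractLeft_comm, TensorProduct.tmul_neg]
  have h2 : (contrOp (e.coord i) * wedgeOp (e i) * (contrOp (e.coord j) * wedgeOp (e j)) :
      Module.End F (V ⊗[F] ExteriorAlgebra F L)) =
      contrOp (e.coord j) * wedgeOp (e j) * (contrOp (e.coord i) * wedgeOp (e i)) := by
    rw [mul_assoc, ← mul_assoc (wedgeOp (e i)), ← neg_neg (wedgeOp (e i) * contrOp (e.coord j)),
      ← contrOp_mul_wedgeOp_of_ne e V hij, opNeg_mul, opMul_neg, mul_assoc, wedgeOp_mul_comm,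
      ← mul_assoc, h1, opNeg_mul, neg_neg, opMul_neg, mul_assoc, ← mul_assoc (contrOp (e.coord i)),
      contrOp_mul_wedgeOp_of_ne e V hij.symm, opNeg_mul, opMul_neg, neg_neg, mul_assoc, mul_assoc]
  have h3 : ∀ (A C : Module.End F V) (P Q : Module.End F (V ⊗[F] ExteriorAlgebra F L)),
      P * leftOp C = leftOp C * P → leftOp A * P * (leftOp C * Q) = leftOp (A * C) * (P * Q) := by
    intro A C P Q h
    rw [mul_assoc, ← mul_assoc P, h, leftOp_mul]
    simp only [mul_assoc]
  have h4 : ∀ (C : Module.End F V) (i : I), contrOp (e.coord i) * wedgeOp (e i) * leftOp C =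
      leftOp C * (contrOp (e.coord i) * wedgeOp (e i)) := by
    intro C i
    rw [mul_assoc, wedgeOp_mul_leftOp, ← mul_assoc, contrOp_mul_leftOp, mul_assoc]
  rw [constOp, constOp, h3 _ _ _ _ (h4 _ _), h3 _ _ _ _ (h4 _ _), h2, 𝒟.drop_jump_comm i j hij]

end

end LeadingData

end TotalComplex

/-! ### Acyclicity of the total complex -/

namespace TotalComplex

open ExteriorAlgebra MultisetPoly

/-- The correction of a cycle `y` by a homotopy `h` for an approximation `D₀` of a differential `D`,
where `P` is the projection onto which `h` contracts. -/
theorem sub_sub_eq_of_homotopy {F M : Type*} [Field F] [AddCommGroup M] [Module F M]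
    (D D₀ h P : Module.End F M) {c a q : M} (hD : D (c - D a) = 0)
    (hh : D₀ (h (c - D a)) + h (D₀ (c - D a)) = c - D a - P (c - D a)) :
    c - D (a + h (c - D a)) - P q =
      P (c - D a - q) - h (D (c - D a) - D₀ (c - D a)) -
        (D (h (c - D a)) - D₀ (h (c - D a))) := by
  rw [hD, zero_sub, map_neg, eq_sub_of_add_eq' hh, map_sub P, map_add]
  abel

namespace LeadingData

section Filtration

variable {p : ℕ} {F : Type*} [Field F] {L : Type*} [AddCommGroup L] [Module F L]
  {I : Type*} {e : Basis I F L} {V : Type*} [AddCommGroup V] [Module F V] {B : Type*}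
  (𝒟 : LeadingData p e V B)

/-- The span of the basis vectors of weight at most `n`. -/
noncomputable def fil (n : ℕ) : Submodule F V := Submodule.span F (𝒟.b '' {β | 𝒟.wt β ≤ n})

/-- The part of the total complex of degree `k` and weight at most `n`. -/
noncomputable def gr (k n : ℕ) : Submodule F (Multiset I →₀ V ⊗[F] ExteriorAlgebra F L) :=
  Submodule.span F {x | ∃ m β s, ∃ ω ∈ ⋀[F]^s L, 2 * m.card + s = k ∧
    p * m.card + s + 𝒟.wt β ≤ n ∧ x = Finsupp.single m (𝒟.b β ⊗ₜ ω)}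

theorem single_mem_gr {k n s : ℕ} {m : Multiset I} {β : B} {ω : ExteriorAlgebra F L}
    (hω : ω ∈ ⋀[F]^s L) (hk : 2 * m.card + s = k) (hn : p * m.card + s + 𝒟.wt β ≤ n) :
    Finsupp.single m (𝒟.b β ⊗ₜ ω) ∈ 𝒟.gr k n :=
  Submodule.subset_span ⟨m, β, s, ω, hω, hk, hn, rfl⟩

theorem gr_mono (k : ℕ) {n n' : ℕ} (h : n ≤ n') : 𝒟.gr k n ≤ 𝒟.gr k n' :=
  Submodule.span_mono fun _ ⟨m, β, s, ω, hω, hk, hn, hx⟩ => ⟨m, β, s, ω, hω, hk, hn.trans h, hx⟩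

theorem single_mem_gr_of_mem {k n s r : ℕ} {m : Multiset I} {w : V ⊗[F] ExteriorAlgebra F L}
    (hw : w ∈ coefDegree (𝒟.fil r) s) (hk : 2 * m.card + s = k) (hn : p * m.card + s + r ≤ n) :
    Finsupp.single m w ∈ 𝒟.gr k n := by
  have : coefDegree (𝒟.fil r) s ≤ (𝒟.gr k n).comap (Finsupp.lsingle m) := by
    refine Submodule.map₂_le.mpr fun x hx ω hω => ?_
    have h2 : 𝒟.fil r ≤ ((𝒟.gr k n).comap (Finsupp.lsingle m)).comap
        ((TensorProduct.mk F V (ExteriorAlgebra F L)).flip ω) := by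
      refine Submodule.span_le.mpr ?_
      rintro _ ⟨β, hβ, rfl⟩
      exact 𝒟.single_mem_gr hω hk (le_trans (Nat.add_le_add_left hβ _) hn)
    exact h2 hx
  exact this hw

theorem map_mem_of_mem_gr {Q : Type*} [AddCommMonoid Q] [Module F Q]
    (Φ : (Multiset I →₀ V ⊗[F] ExteriorAlgebra F L) →ₗ[F] Q) (S : Submodule F Q) {k n : ℕ}
    (h : ∀ m β s, ∀ ω ∈ ⋀[F]^s L, 2 * m.card + s = k → p * m.card + s + 𝒟.wt β ≤ n →
      Φ (Finsupp.single m (𝒟.b β ⊗ₜ ω)) ∈ S)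
    {c : Multiset I →₀ V ⊗[F] ExteriorAlgebra F L} (hc : c ∈ 𝒟.gr k n) : Φ c ∈ S := by
  have : 𝒟.gr k n ≤ S.comap Φ := by
    refine Submodule.span_le.mpr ?_
    rintro _ ⟨m, β, s, ω, hω, hk, hn, rfl⟩
    exact h m β s ω hω hk hn
  exact this hc

/-- The homotopies preserve the weight. -/
theorem homOp_mem_gr (hp : 0 < p) (i : I) {k n : ℕ}
    {c : Multiset I →₀ V ⊗[F] ExteriorAlgebra F L} (hc : c ∈ 𝒟.gr k n) :
    𝒟.homOp i c ∈ 𝒟.gr (k + 1) n := by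
  refine 𝒟.map_mem_of_mem_gr _ _ (fun m β s ω hω hk hn => ?_) hc
  rw [homOp, LinearMap.sub_apply, Module.End.mul_apply, coeffOp_single, coeffOp_single, lowerOp,
    dropOp, Module.End.mul_apply, Module.End.mul_apply, wedgeOp_tmul, contrOp_tmul, leftOp_tmul,
    leftOp_tmul]
  refine sub_mem ?_ ?_
  · rcases 𝒟.lower_b i β with h | ⟨β', h, h'⟩
    · rw [h, TensorProduct.zero_tmul, Finsupp.single_zero]
      exact zero_mem _
    · rw [h]
      exact 𝒟.single_mem_gr (ι_mul_mem_exteriorPower _ hω) (by omega) (by omega)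
  · rcases s with _ | s
    · obtain ⟨r, rfl⟩ := exists_algebraMap_of_mem_exteriorPower_zero hω
      rw [CliffordAlgebra.contractLeft_algebraMap, TensorProduct.tmul_zero, Finsupp.single_zero,
        map_zero]
      exact zero_mem _
    · rcases 𝒟.drop_b i β with h | ⟨β', h, h'⟩
      · rw [h, TensorProduct.zero_tmul, Finsupp.single_zero, map_zero]
        exact zero_mem _
      · rw [h, integralOp_single]
        refine Submodule.smul_mem _ _
          (𝒟.single_mem_gr (contractLeft_mem_exteriorPower _ hω) ?_ ?_)
        · rw [Multiset.card_cons]; omega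
        · rw [Multiset.card_cons, mul_add_one]; omega

/-- The differential agrees with its leading part up to terms of lower weight. -/
theorem totD_sub_leadD_mem_gr (hp : 2 ≤ p) {k n : ℕ}
    {c : Multiset I →₀ V ⊗[F] ExteriorAlgebra F L} (hc : c ∈ 𝒟.gr (k + 1) (n + 1)) :
    𝒟.totD c - 𝒟.leadD c ∈ 𝒟.gr k n := by
  classical
  refine 𝒟.map_mem_of_mem_gr (𝒟.totD - 𝒟.leadD) _ (fun m β s ω hω hk hn => ?_) hc
  have e1 : 𝒟.totD - 𝒟.leadD =
      coeffOp (koszulOp (𝒟.mul - 𝒟.leadMul)) + derivOp (𝒟.divOp - 𝒟.leadDivOp) := by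
    rw [koszulOp_sub, coeffOp_sub, derivOp_sub, totD, leadD]
    abel
  rw [e1, LinearMap.add_apply, coeffOp_single, derivOp_single]
  refine add_mem ?_ (multiset_sum_mem _ ?_)
  · rcases s with _ | s
    · obtain ⟨r, rfl⟩ := exists_algebraMap_of_mem_exteriorPower_zero hω
      rw [koszulOp_tmul_algebraMap, Finsupp.single_zero]
      exact zero_mem _
    · refine 𝒟.single_mem_gr_of_mem (r := 𝒟.wt β) (koszulOp_tmul_mem (fun g => ?_) hω) (by omega)
        (by omega)
      have : ⊤ ≤ (𝒟.fil (𝒟.wt β)).comap ((𝒟.mul - 𝒟.leadMul).flip (𝒟.b β)) := by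
        rw [← e.span_eq, Submodule.span_le]
        rintro _ ⟨i, rfl⟩
        simp only [SetLike.mem_coe, Submodule.mem_comap, LinearMap.flip_apply, LinearMap.sub_apply,
          leadMul_basis]
        exact 𝒟.mul_sub_raise i β
      exact this trivial
  · intro x hx
    obtain ⟨j, hj, rfl⟩ := Multiset.mem_map.mp hx
    have hcard : (m.erase j).card + 1 = m.card := Multiset.card_erase_add_one hj
    have hmul : p * m.card = p * (m.erase j).card + p := by rw [← hcard, mul_add_one]
    have e2 : (𝒟.divOp - 𝒟.leadDivOp) j (𝒟.b β ⊗ₜ ω) =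
        𝒟.b β ⊗ₜ (ι F (𝒟.pth j) * ω) -
          (𝒟.top j (𝒟.b β) - 𝒟.jump j (𝒟.b β)) ⊗ₜ (ι F (e j) * ω) := by
      rw [Pi.sub_apply, LinearMap.sub_apply, divOp, leadDivOp, LinearMap.neg_apply,
        LinearMap.sub_apply, Module.End.mul_apply, Module.End.mul_apply, wedgeOp_tmul, wedgeOp_tmul,
        leftOp_tmul, leftOp_tmul, TensorProduct.sub_tmul]
      abel
    rw [e2, Finsupp.single_sub]
    refine sub_mem (𝒟.single_mem_gr (ι_mul_mem_exteriorPower _ hω) (by omega) (by omega))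
      (𝒟.single_mem_gr_of_mem
        (tmul_mem_coefDegree (𝒟.top_sub_jump j β) (ι_mul_mem_exteriorPower _ hω))
        (by omega) (by omega))

theorem projOp_single (i : I) (m : Multiset I) (β : B) (ω : ExteriorAlgebra F L) :
    𝒟.projOp i (Finsupp.single m (𝒟.b β ⊗ₜ ω)) = 0 ∨
    𝒟.projOp i (Finsupp.single m (𝒟.b β ⊗ₜ ω)) = Finsupp.single m (𝒟.b β ⊗ₜ
      (CliffordAlgebra.contractLeft (e.coord i) (ι F (e i) * ω) : ExteriorAlgebra F L)) := by
  classical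
  rw [projOp, evalZeroOp_single]
  split_ifs with h
  · exact Or.inl rfl
  · rw [constOp, Module.End.mul_apply, Module.End.mul_apply, wedgeOp_tmul, contrOp_tmul,
      leftOp_tmul, Module.End.mul_apply]
    rcases 𝒟.drop_jump_b i β with h | h
    · rw [h, TensorProduct.zero_tmul, Finsupp.single_zero]
      exact Or.inl rfl
    · rw [h]
      exact Or.inr rfl

theorem projOp_mem_gr (i : I) {k n : ℕ}
    {c : Multiset I →₀ V ⊗[F] ExteriorAlgebra F L} (hc : c ∈ 𝒟.gr k n) :
    𝒟.projOp i c ∈ 𝒟.gr k n := by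
  refine 𝒟.map_mem_of_mem_gr _ _ (fun m β s ω hω hk hn => ?_) hc
  rcases 𝒟.projOp_single i m β ω with h | h
  · rw [h]
    exact zero_mem _
  · rw [h]
    exact 𝒟.single_mem_gr
      (contractLeft_mem_exteriorPower _ (ι_mul_mem_exteriorPower _ hω)) hk hn

/-- Successive projections along the directions in a list. -/
noncomputable def projList (l : List I) :
    Module.End F (Multiset I →₀ V ⊗[F] ExteriorAlgebra F L) := (l.map 𝒟.projOp).prod

theorem projList_cons (i : I) (l : List I) :
    𝒟.projList (i :: l) = 𝒟.projOp i * 𝒟.projList l := by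
  rw [projList, List.map_cons, List.prod_cons, projList]

theorem projList_eq_zero_of_mem {i : I} {l : List I} (hi : i ∈ l)
    {c : Multiset I →₀ V ⊗[F] ExteriorAlgebra F L} (hc : 𝒟.projOp i c = 0) :
    𝒟.projList l c = 0 := by
  induction l with
  | nil => exact absurd hi List.not_mem_nil
  | cons j l ih =>
    rw [projList_cons, Module.End.mul_apply]
    rcases List.mem_cons.mp hi with rfl | h
    · have hcomm : 𝒟.projOp i * 𝒟.projList l = 𝒟.projList l * 𝒟.projOp i := by
        refine (Commute.list_prod_right _ _ fun x hx => ?_)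
        obtain ⟨j, _, rfl⟩ := List.mem_map.mp hx
        exact 𝒟.projOp_comm i j
      rw [← Module.End.mul_apply, hcomm, Module.End.mul_apply, hc, map_zero]
    · rw [ih h, map_zero]

/-- In positive degree, each element is killed by the projections along finitely many directions:
every monomial involves some `ē_i` or some exterior factor `e_i`. -/
theorem exists_projList_eq_zero {k n : ℕ}
    {c : Multiset I →₀ V ⊗[F] ExteriorAlgebra F L} (hc : c ∈ 𝒟.gr (k + 1) n) :
    ∃ l, 𝒟.projList l c = 0 := by
  classical
  let S : Submodule F (Multiset I →₀ V ⊗[F] ExteriorAlgebra F L) :=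
    { carrier := {c | ∃ l, ∀ l', l ⊆ l' → 𝒟.projList l' c = 0}
      add_mem' := by
        rintro x y ⟨l, hl⟩ ⟨l', hl'⟩
        refine ⟨l ++ l', fun l'' h => ?_⟩
        rw [map_add, hl _ (List.append_subset.mp h).1, hl' _ (List.append_subset.mp h).2, add_zero]
      zero_mem' := ⟨[], fun _ _ => map_zero _⟩
      smul_mem' := by
        rintro a x ⟨l, hl⟩
        exact ⟨l, fun l' h => by rw [map_smul, hl l' h, smul_zero]⟩ }
  have hS : ∀ c i, 𝒟.projOp i c = 0 → c ∈ S := fun c i h =>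
    ⟨[i], fun l' hl => 𝒟.projList_eq_zero_of_mem (hl (List.mem_singleton_self i)) h⟩
  have hcS : c ∈ S := by
    refine 𝒟.map_mem_of_mem_gr LinearMap.id S (fun m β s ω hω hk _ => ?_) hc
    rw [LinearMap.id_apply]
    rcases Multiset.empty_or_exists_mem m with rfl | ⟨i, hi⟩
    · rw [Multiset.card_zero] at hk
      obtain rfl : s = k + 1 := by omega
      refine exteriorPower_succ_induction
        (P := fun ω => (Finsupp.single 0 (𝒟.b β ⊗ₜ ω) : Multiset I →₀ _) ∈ S)
        (fun g ω _ => ?_) (fun ω η h1 h2 => ?_) hω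
      · have : ⊤ ≤ S.comap (Finsupp.lsingle 0 ∘ₗ TensorProduct.mk F V _ (𝒟.b β) ∘ₗ
            LinearMap.mulRight F ω ∘ₗ ι F) := by
          rw [← e.span_eq, Submodule.span_le]
          rintro _ ⟨i, rfl⟩
          refine hS _ i ?_
          simp only [LinearMap.comp_apply, LinearMap.mulRight_apply, TensorProduct.mk_apply,
            Finsupp.lsingle_apply]
          rcases 𝒟.projOp_single i 0 β (ι F (e i) * ω) with h | h
          · exact h
          · rw [h, ← mul_assoc, ι_sq_zero, zero_mul, map_zero, TensorProduct.tmul_zero,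
              Finsupp.single_zero]
        exact this (Submodule.mem_top (x := g))
      · rw [TensorProduct.tmul_add, Finsupp.single_add]
        exact add_mem h1 h2
    · refine hS _ i ?_
      rw [projOp, evalZeroOp_single, if_pos hi]
  obtain ⟨l, hl⟩ := hcS
  exact ⟨l, hl l (List.Subset.refl l)⟩

/-- In positive degree there is nothing of weight zero. -/
theorem gr_succ_zero (hp : 2 ≤ p) (k : ℕ) : 𝒟.gr (k + 1) 0 = ⊥ := by
  refine (Submodule.eq_bot_iff _).mpr fun c hc => ?_
  refine 𝒟.map_mem_of_mem_gr LinearMap.id ⊥ (fun m β s ω hω hk hn => ?_) hc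
  have h : m.card ≤ p * m.card := Nat.le_mul_of_pos_left _ (by omega)
  omega

theorem leadD_homOp [CharP F p] (i : I) {k n : ℕ} (hk : k < p)
    {c : Multiset I →₀ V ⊗[F] ExteriorAlgebra F L} (hc : c ∈ 𝒟.gr k n) (hp : 2 ≤ p) :
    𝒟.leadD (𝒟.homOp i c) + 𝒟.homOp i (𝒟.leadD c) = c - 𝒟.projOp i c := by
  have h := 𝒟.map_mem_of_mem_gr
    (𝒟.leadD * 𝒟.homOp i + 𝒟.homOp i * 𝒟.leadD - (1 - 𝒟.projOp i)) ⊥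
    (fun m β s ω _ hk' _ => by
      rw [Submodule.mem_bot, LinearMap.sub_apply, LinearMap.add_apply, Module.End.mul_apply,
        Module.End.mul_apply, 𝒟.leadD_homOp_single i m _ (by omega), LinearMap.sub_apply,
        Module.End.one_apply, sub_self]) hc
  exact sub_eq_zero.mp h

/-- A cycle is, up to boundaries and terms of lower weight, equal to its projection along any
finite set of directions. -/
theorem exists_sub_totD_sub_projList_mem [CharP F p] (hp : 2 ≤ p) {k n : ℕ} (hk : k + 1 < p)
    {c : Multiset I →₀ V ⊗[F] ExteriorAlgebra F L} (hc : c ∈ 𝒟.gr (k + 1) (n + 1))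
    (hD : 𝒟.totD c = 0) (l : List I) :
    ∃ a ∈ 𝒟.gr (k + 2) (n + 1), c - 𝒟.totD a - 𝒟.projList l c ∈ 𝒟.gr (k + 1) n := by
  induction l with
  | nil =>
    refine ⟨0, zero_mem _, ?_⟩
    rw [map_zero, sub_zero, projList, List.map_nil, List.prod_nil, Module.End.one_apply, sub_self]
    exact zero_mem _
  | cons i l ih =>
    obtain ⟨a, ha, hsub⟩ := ih
    set y := c - 𝒟.totD a with hy
    have hlist : ∀ l : List I, 𝒟.projList l c ∈ 𝒟.gr (k + 1) (n + 1) := by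
      intro l
      induction l with
      | nil => exact hc
      | cons j l ih =>
        rw [projList_cons, Module.End.mul_apply]
        exact 𝒟.projOp_mem_gr j ih
    have hymem : y ∈ 𝒟.gr (k + 1) (n + 1) := by
      rw [← sub_add_cancel y (𝒟.projList l c)]
      exact add_mem (𝒟.gr_mono _ (Nat.le_succ n) hsub) (hlist l)
    have hyD : 𝒟.totD y = 0 := by
      rw [hy, map_sub, hD, ← Module.End.mul_apply, totD_mul_self, LinearMap.zero_apply, sub_zero]
    have hhom := 𝒟.leadD_homOp i (by omega) hymem hp
    have hb := 𝒟.homOp_mem_gr (by omega) i hymem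
    have h1 := 𝒟.totD_sub_leadD_mem_gr hp hb
    have h2 := 𝒟.homOp_mem_gr (by omega) i (𝒟.totD_sub_leadD_mem_gr hp hymem)
    have h3 := 𝒟.projOp_mem_gr i hsub
    refine ⟨a + 𝒟.homOp i y, add_mem ha hb, ?_⟩
    rw [projList_cons, Module.End.mul_apply,
      sub_sub_eq_of_homotopy 𝒟.totD 𝒟.leadD (𝒟.homOp i) (𝒟.projOp i) hyD hhom]
    exact sub_mem (sub_mem h3 h2) h1

/-- The total complex of a module with leading data is acyclic in the degrees `0 < k < p`, by
induction on the weight of a cycle. -/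
theorem exists_totD_eq [CharP F p] (hp : 2 ≤ p) {k n : ℕ} (hk : k + 1 < p)
    {c : Multiset I →₀ V ⊗[F] ExteriorAlgebra F L} (hc : c ∈ 𝒟.gr (k + 1) n)
    (hD : 𝒟.totD c = 0) : ∃ a ∈ 𝒟.gr (k + 2) n, 𝒟.totD a = c := by
  induction n generalizing c with
  | zero =>
    rw [gr_succ_zero _ hp, Submodule.mem_bot] at hc
    exact ⟨0, zero_mem _, by rw [hc, map_zero]⟩
  | succ n ih =>
    obtain ⟨l, hl⟩ := 𝒟.exists_projList_eq_zero hc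
    obtain ⟨a, ha, hsub⟩ := 𝒟.exists_sub_totD_sub_projList_mem hp hk hc hD l
    rw [hl, sub_zero] at hsub
    obtain ⟨a', ha', h'⟩ := ih hsub (by
      rw [map_sub, hD, ← Module.End.mul_apply, totD_mul_self, LinearMap.zero_apply, sub_zero])
    exact ⟨a + a', add_mem ha (𝒟.gr_mono _ (Nat.le_succ n) ha'), by
      rw [map_add, h', add_sub_cancel]⟩

end Filtration

end LeadingData

end TotalComplex

/-! ### Comparison with the total complex -/

namespace RestrictedUEA

open TotalComplex

theorem mulLeft_mul_comm {F : Type*} {p : ℕ} {L : Type*} [Field F] [LieRing L] [LieAlgebra F L]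
    [RestrictedLieAlgebra F p L] [IsLieAbelian L] (x y : RestrictedUEA F p L) :
    LinearMap.mulLeft F x * LinearMap.mulLeft F y =
      LinearMap.mulLeft F y * LinearMap.mulLeft F x := by
  ext z
  simp only [Module.End.mul_apply, LinearMap.mulLeft_apply]
  rw [← mul_assoc, ← mul_assoc, mul_comm_of_abelian F p L x]

section

variable {F : Type*} {p : ℕ} {L : Type*} [Field F] [LieRing L] [LieAlgebra F L]
  [RestrictedLieAlgebra F p L] [IsLieAbelian L] [Fact p.Prime] [CharP F p]
  {I : Type*} (e : Basis I F L)

/-- The operator `drop ∘ jump` projects onto the monomials that do not involve `e_i`. -/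
theorem coordOp_drop_jump (i : I) (β : I →₀ Fin p) :
    coordOp e i drop (coordOp e i jump (mon e β)) = 0 ∨
      coordOp e i drop (coordOp e i jump (mon e β)) = mon e β := by
  classical
  have h1 : p - 1 + 1 = p := Nat.sub_add_cancel (Fact.out : p.Prime).one_le
  rw [coordOp_mon e i jump, jump]
  split_ifs with h
  · right
    rw [Option.elim_some, coordOp_mon, drop, if_pos (by simpa using h1), Option.elim_some]
    congr 1
    ext k
    by_cases hk : k = i
    · subst hk; simp [h]
    · simp [hk]
  · left
    rw [Option.elim_none, map_zero]

variable (p) in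
/-- The leading data of the restricted enveloping algebra, read off from its monomial basis. -/
noncomputable def leadingData : LeadingData p e (RestrictedUEA F p L) (I →₀ Fin p) where
  mul := LinearMap.mul F (RestrictedUEA F p L) ∘ₗ ι F p L
  top i := LinearMap.mulLeft F (ι F p L (e i) ^ (p - 1))
  pth i := RestrictedLieAlgebra.pMap F p (e i)
  mul_comm g h := mulLeft_mul_comm _ _
  top_mul_comm i g := mulLeft_mul_comm _ _
  top_comm i j := mulLeft_mul_comm _ _
  mul_pth i := by
    ext x
    change ι F p L (RestrictedLieAlgebra.pMap F p (e i)) * x =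
      ι F p L (e i) ^ (p - 1) * (ι F p L (e i) * x)
    rw [← mul_assoc, ← pow_succ, Nat.sub_add_cancel (Fact.out : p.Prime).one_le, ι_pow]
  b := pbw e
  wt := wt
  raise i := coordOp e i raise
  lower i := coordOp e i lower
  jump i := coordOp e i jump
  drop i := coordOp e i drop
  raise_lower := raise_lower_add_jump_drop e
  lower_raise := lower_raise_add_drop_jump e
  lower_comm_raise i j h := coordOp_comm e h _ _
  drop_comm_raise i j h := coordOp_comm e h _ _
  jump_comm_lower i j h := coordOp_comm e h _ _
  jump_comm_drop i j h := coordOp_comm e h _ _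
  drop_jump_comm i j h := by
    have h1 : ∀ φ ψ : Fin p → Option (Fin p), Commute (coordOp (L := L) (F := F) e i φ)
      (coordOp e j ψ) := fun φ ψ => coordOp_comm e h φ ψ
    exact ((h1 _ _).mul_left (h1 _ _)).mul_right ((h1 _ _).mul_left (h1 _ _))
  lower_b i β := by
    rw [pbw_apply, coordOp_mon, lower]
    split_ifs with h
    · exact Or.inl rfl
    · refine Or.inr ⟨_, (pbw_apply e _).symm, ?_⟩
      have := wt_update i β ⟨β i - 1, lt_of_le_of_lt (Nat.sub_le _ _) (β i).isLt⟩
      simp only at this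
      omega
  drop_b i β := by
    rw [pbw_apply, coordOp_mon, drop]
    split_ifs with h
    · refine Or.inr ⟨_, (pbw_apply e _).symm, ?_⟩
      have := wt_update i β ⟨0, (β i).pos⟩
      simp only at this
      omega
    · exact Or.inl rfl
  drop_jump_b i β := by
    rw [pbw_apply]
    exact coordOp_drop_jump e i β
  mul_sub_raise i β := by
    rw [funext (pbw_apply e)]
    exact ι_mul_sub_raise_mem e i β
  top_sub_jump i β := by
    rw [funext (pbw_apply e)]
    exact ι_pow_mul_sub_jump_mem e i β

end

end RestrictedUEA

namespace AbelianComplex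

open RestrictedUEA TotalComplex MultisetPoly

section Comparison

variable {F : Type*} [Field F] {p : ℕ} [Fact p.Prime] [CharP F p]
  {L : Type*} [LieRing L] [LieAlgebra F L] [RestrictedLieAlgebra F p L]
  {I : Type*} (e : Basis I F L)

/-- Induction on `C_{t,s}` by the generators `x ⊗ e_{j₁} ⋯ e_{j_t} ⊗ g₁ ∧ ⋯ ∧ g_s`. -/
theorem term_induction {t s : ℕ} {P : Term F p L t s → Prop} (h0 : P 0)
    (hadd : ∀ x y, P x → P y → P (x + y))
    (hgen : ∀ x (m : Sym I t) (g : Fin s → L),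
      P (x ⊗ₜ (symMonomial (FrobTwist.basis F p e) m ⊗ₜ exteriorPower.ιMulti F s g)))
    (y : Term F p L t s) : P y := by
  induction y using TensorProduct.induction_on with
  | zero => exact h0
  | add x y hx hy => exact hadd x y hx hy
  | tmul x z =>
    induction z using TensorProduct.induction_on with
    | zero => rw [TensorProduct.tmul_zero]; exact h0
    | add a b ha hb => rw [TensorProduct.tmul_add]; exact hadd _ _ ha hb
    | tmul a ω =>
      have ha : a ∈ Submodule.span F (Set.range (symMonomial (FrobTwist.basis F p e) (t := t))) :=
        symMonomial_span _ t Submodule.mem_top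
      have hω : ω ∈ Submodule.span F (Set.range (exteriorPower.ιMulti F s (M := L))) := by
        rw [exteriorPower.ιMulti_span]
        exact Submodule.mem_top
      induction ha using Submodule.span_induction generalizing x with
      | zero => rw [TensorProduct.zero_tmul, TensorProduct.tmul_zero]; exact h0
      | add a b _ _ ha hb =>
        rw [TensorProduct.add_tmul, TensorProduct.tmul_add]
        exact hadd _ _ (ha x) (hb x)
      | smul r a _ ha =>
        rw [← TensorProduct.smul_tmul', TensorProduct.tmul_smul, TensorProduct.smul_tmul']
        exact ha (r • x)
      | mem a ha =>
        obtain ⟨m, rfl⟩ := ha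
        induction hω using Submodule.span_induction generalizing x with
        | zero => rw [TensorProduct.tmul_zero, TensorProduct.tmul_zero]; exact h0
        | add a b _ _ ha hb =>
          rw [TensorProduct.tmul_add, TensorProduct.tmul_add]
          exact hadd _ _ (ha x) (hb x)
        | smul r a _ ha =>
          rw [TensorProduct.tmul_smul, TensorProduct.tmul_smul, TensorProduct.smul_tmul']
          exact ha (r • x)
        | mem a ha =>
          obtain ⟨g, rfl⟩ := ha
          exact hgen x m g

/-- Induction on `C_k` by generators. -/
theorem complex_induction {k : ℕ} {P : C F p L k → Prop} (h0 : P 0)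
    (hadd : ∀ x y, P x → P y → P (x + y))
    (hgen : ∀ t s (h : 2 * t + s = k) x (m : Sym I t) (g : Fin s → L),
      P (incl F p L k t s h
        (x ⊗ₜ (symMonomial (FrobTwist.basis F p e) m ⊗ₜ exteriorPower.ιMulti F s g))))
    (y : C F p L k) : P y := by
  induction y using DirectSum.induction_on with
  | zero => exact h0
  | add x y hx hy => exact hadd x y hx hy
  | of q y =>
    obtain ⟨⟨t, s⟩, h⟩ := q
    change P (incl F p L k t s h y)
    refine term_induction e (P := fun y => P (incl F p L k t s h y)) ?_ (fun x y hx hy => ?_)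
      (hgen t s h) y
    · rw [map_zero]; exact h0
    · rw [map_add]; exact hadd _ _ hx hy

/-- The embedding of `C_{t,s}` in the total complex. -/
noncomputable def termToTot (t s : ℕ) :
    Term F p L t s →ₗ[F] (Multiset I →₀ RestrictedUEA F p L ⊗[F] ExteriorAlgebra F L) :=
  TensorProduct.lift ((symBasis (FrobTwist.basis F p e) t).constr F fun m =>
      Finsupp.lsingle (m : Multiset I)) ∘ₗ
    LinearMap.lTensor _ (LinearMap.lTensor _ (⋀[F]^s L).subtype) ∘ₗ
      (TensorProduct.leftComm F _ _ _).toLinearMap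

theorem termToTot_tmul {t s : ℕ} (x : RestrictedUEA F p L) (m : Sym I t) (ω : ⋀[F]^s L) :
    termToTot e t s (x ⊗ₜ (symMonomial (FrobTwist.basis F p e) m ⊗ₜ ω)) =
      Finsupp.single (m : Multiset I) (x ⊗ₜ (ω : ExteriorAlgebra F L)) := by
  have h := (symBasis (FrobTwist.basis F p e) t).constr_basis F (fun m : Sym I t =>
    (Finsupp.lsingle (m : Multiset I) : RestrictedUEA F p L ⊗[F] ExteriorAlgebra F L →ₗ[F] _)) m
  rw [symBasis, Basis.mk_apply] at h
  change (symBasis (FrobTwist.basis F p e) t).constr F (fun m : Sym I t =>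
    (Finsupp.lsingle (m : Multiset I) : RestrictedUEA F p L ⊗[F] ExteriorAlgebra F L →ₗ[F] _))
      (symMonomial (FrobTwist.basis F p e) m) (x ⊗ₜ (ω : ExteriorAlgebra F L)) = _
  rw [symBasis, h]
  rfl

/-- The embedding of `C_k` in the total complex. -/
noncomputable def toTot (k : ℕ) :
    C F p L k →ₗ[F] (Multiset I →₀ RestrictedUEA F p L ⊗[F] ExteriorAlgebra F L) :=
  DirectSum.toModule F (Idx k) _ fun q => termToTot e q.1.1 q.1.2

theorem toTot_incl {k t s : ℕ} (h : 2 * t + s = k) (y : Term F p L t s) :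
    toTot e k (incl F p L k t s h y) = termToTot e t s y :=
  DirectSum.toModule_lof F (M := fun q : Idx k => Term F p L q.1.1 q.1.2) ⟨(t, s), h⟩ y

variable (L) in
/-- The component of `C_k` in `C_{t,s}`, read off from the total complex. -/
noncomputable def totToTerm (t s : ℕ) :
    (Multiset I →₀ RestrictedUEA F p L ⊗[F] ExteriorAlgebra F L) →ₗ[F] Term F p L t s :=
  Finsupp.lsum F fun m => if h : m.card = t then
    LinearMap.lTensor _ (
      TensorProduct.mk F _ _ (symMonomial (FrobTwist.basis F p e) (Sym.mk m h)) ∘ₗ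
      DirectSum.component F ℕ (fun i => ⋀[F]^i L) s ∘ₗ
        (DirectSum.decomposeLinearEquiv fun i => ⋀[F]^i L).toLinearMap) else 0

theorem totToTerm_same {t s : ℕ} (x : RestrictedUEA F p L) (m : Sym I t) (ω : ⋀[F]^s L) :
    totToTerm L e t s (Finsupp.single (m : Multiset I) (x ⊗ₜ (ω : ExteriorAlgebra F L))) =
      x ⊗ₜ (symMonomial (FrobTwist.basis F p e) m ⊗ₜ ω) := by
  obtain ⟨m, rfl⟩ := m
  change totToTerm L e _ s (Finsupp.single m (x ⊗ₜ (ω : ExteriorAlgebra F L))) = _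
  have h0 : DirectSum.component F ℕ (fun i => ⋀[F]^i L) s
      ((DirectSum.decomposeLinearEquiv fun i => ⋀[F]^i L) (ω : ExteriorAlgebra F L)) = ω := by
    rw [DirectSum.decomposeLinearEquiv_apply, DirectSum.decompose_coe]
    exact DirectSum.of_eq_same _ _
  rw [totToTerm, Finsupp.lsum_single, dif_pos rfl, LinearMap.lTensor_tmul, LinearMap.comp_apply,
    LinearMap.comp_apply, LinearEquiv.coe_coe, h0]
  rfl

theorem totToTerm_of_ne {t s t' s' : ℕ} (h : (t', s') ≠ (t, s)) (x : RestrictedUEA F p L)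
    (m : Sym I t') (ω : ⋀[F]^s' L) :
    totToTerm L e t s (Finsupp.single (m : Multiset I) (x ⊗ₜ (ω : ExteriorAlgebra F L))) = 0 := by
  rw [totToTerm, Finsupp.lsum_single]
  split_ifs with ht
  · have ht' : t' = t := m.2.symm.trans ht
    have hs : s' ≠ s := fun hs => h (by rw [ht', hs])
    rw [LinearMap.lTensor_tmul]
    have h0 : DirectSum.component F ℕ (fun i => ⋀[F]^i L) s
        ((DirectSum.decomposeLinearEquiv fun i => ⋀[F]^i L) (ω : ExteriorAlgebra F L)) = 0 := by
      rw [DirectSum.decomposeLinearEquiv_apply, DirectSum.decompose_coe]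
      exact DirectSum.of_eq_of_ne _ _ _ hs.symm
    rw [LinearMap.comp_apply, LinearMap.comp_apply, LinearEquiv.coe_coe, h0, map_zero,
      TensorProduct.tmul_zero]
  · rfl

theorem totToTerm_toTot {k t s : ℕ} (h : 2 * t + s = k) (c : C F p L k) :
    totToTerm L e t s (toTot e k c) = c ⟨(t, s), h⟩ := by
  refine complex_induction e (P := fun c => totToTerm L e t s (toTot e k c) = c ⟨(t, s), h⟩) ?_
    (fun x y hx hy => ?_) (fun t' s' h' x m g => ?_) c
  · rw [map_zero, map_zero]; rfl
  · rw [map_add, map_add, hx, hy]; rfl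
  · rw [toTot_incl, termToTot_tmul]
    by_cases hq : (t', s') = (t, s)
    · obtain ⟨rfl, rfl⟩ := Prod.mk.inj hq
      rw [totToTerm_same, incl, DirectSum.lof_apply]
    · rw [totToTerm_of_ne e hq]
      rw [incl, DirectSum.lof_eq_of, DirectSum.of_eq_of_ne]
      exact fun hq' => hq (congrArg Subtype.val hq').symm

/-- The components of an element of `C_k` can be recovered from the total complex. -/
theorem toTot_injective (k : ℕ) : Function.Injective (toTot (p := p) e k) := by
  intro c c' h
  refine DFinsupp.ext fun q => ?_
  obtain ⟨⟨t, s⟩, hq⟩ := q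
  have := congrArg (totToTerm L e t s) h
  rwa [totToTerm_toTot e hq, totToTerm_toTot e hq] at this

section Differential

variable [IsLieAbelian L]

theorem toTot_dKFrom {k t s : ℕ} (h : 2 * t + s = k + 1) (x : RestrictedUEA F p L) (m : Sym I t)
    (g : Fin s → L) :
    toTot e k (dKFrom F p L k t s h
      (x ⊗ₜ (symMonomial (FrobTwist.basis F p e) m ⊗ₜ exteriorPower.ιMulti F s g))) =
      Finsupp.single (m : Multiset I) (ExteriorAlgebra.koszulOp (leadingData p e).mul
        (x ⊗ₜ ExteriorAlgebra.ιMulti F s g)) := by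
  cases s with
  | zero =>
    rw [dKFrom, LinearMap.zero_apply, map_zero, ExteriorAlgebra.ιMulti_zero_apply,
      ← map_one (algebraMap F (ExteriorAlgebra F L)), ExteriorAlgebra.koszulOp_tmul_algebraMap,
      Finsupp.single_zero]
  | succ s =>
    rw [dKFrom, LinearMap.comp_apply, dK_apply, map_sum, map_sum,
      ExteriorAlgebra.koszulOp_tmul_ιMulti, ← Finsupp.lsingle_apply (R := F), map_sum]
    refine Finset.sum_congr rfl fun i _ => ?_
    rw [map_zsmul, map_zsmul, toTot_incl, termToTot_tmul]
    exact (map_zsmul (Finsupp.lsingle (R := F) _) _ _).symm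

open Classical in
theorem toTot_dPFrom {k t s : ℕ} (h : 2 * t + s = k + 1) (x : RestrictedUEA F p L) (m : Sym I t)
    (g : Fin s → L) :
    toTot e k (dPFrom p e k t s h
      (x ⊗ₜ (symMonomial (FrobTwist.basis F p e) m ⊗ₜ exteriorPower.ιMulti F s g))) =
      derivOp (leadingData p e).divOp (Finsupp.single (m : Multiset I)
        (x ⊗ₜ ExteriorAlgebra.ιMulti F s g)) := by
  rw [derivOp_single]
  cases t with
  | zero =>
    have hm : (m : Multiset I) = 0 := Multiset.card_eq_zero.mp m.2
    rw [dPFrom, LinearMap.zero_apply, map_zero, hm]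
    rfl
  | succ t =>
    rw [dPFrom, LinearMap.comp_apply, dP_apply, toTot_incl, map_multiset_sum, Multiset.map_map,
      ← Multiset.attach_map_val' (m : Multiset I)]
    congr 1
    refine Multiset.map_congr rfl fun j _ => ?_
    rw [Function.comp_apply, map_sub, termToTot_tmul, termToTot_tmul, ← Finsupp.single_sub]
    rfl

/-- The differential of `C` is the restriction of the differential of the total complex. -/
theorem toTot_d (k : ℕ) (c : C F p L (k + 1)) :
    toTot e k (d p e k c) = (leadingData p e).totD (toTot e (k + 1) c) := by
  classical
  refine complex_induction e
    (P := fun c => toTot e k (d p e k c) = (leadingData p e).totD (toTot e (k + 1) c)) ?_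
    (fun x y hx hy => ?_) (fun t s h x m g => ?_) c
  · rw [map_zero, map_zero, map_zero, map_zero]
  · rw [map_add, map_add, hx, hy, map_add, map_add]
  · have h1 : d p e k (incl F p L (k + 1) t s h
        (x ⊗ₜ (symMonomial (FrobTwist.basis F p e) m ⊗ₜ exteriorPower.ιMulti F s g))) =
        dKFrom F p L k t s h _ + dPFrom p e k t s h _ :=
      DirectSum.toModule_lof (RestrictedUEA F p L)
        (M := fun q : Idx (k + 1) => Term F p L q.1.1 q.1.2) ⟨(t, s), h⟩ _
    rw [h1, map_add, toTot_dKFrom, toTot_dPFrom, toTot_incl, termToTot_tmul, LeadingData.totD,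
      LinearMap.add_apply, coeffOp_single]
    rfl

theorem d_comp_d (k : ℕ) : d p e k ∘ₗ d p e (k + 1) = 0 := by
  refine LinearMap.ext fun c => toTot_injective e k ?_
  rw [LinearMap.comp_apply, toTot_d, toTot_d, ← Module.End.mul_apply, LeadingData.totD_mul_self,
    LinearMap.zero_apply, LinearMap.zero_apply, map_zero]

/-- The elements of degree `k` of the total complex come from `C_k`. -/
theorem exists_toTot_eq {k n : ℕ} {c : Multiset I →₀ RestrictedUEA F p L ⊗[F] ExteriorAlgebra F L}
    (hc : c ∈ (leadingData p e).gr k n) : ∃ y, toTot e k y = c := by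
  refine (leadingData p e).map_mem_of_mem_gr LinearMap.id (LinearMap.range (toTot (p := p) e k))
    (fun m β s ω hω hk _ => ?_) hc
  refine ⟨incl F p L k m.card s hk ((leadingData p e).b β ⊗ₜ (symMonomial (FrobTwist.basis F p e)
    (Sym.mk m rfl) ⊗ₜ ⟨ω, hω⟩)), ?_⟩
  rw [toTot_incl, termToTot_tmul]
  rfl

theorem exists_toTot_mem_gr (k : ℕ) (c : C F p L k) :
    ∃ n, toTot e k c ∈ (leadingData p e).gr k n := by
  refine complex_induction e (P := fun c => ∃ n, toTot e k c ∈ (leadingData p e).gr k n) ?_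
    (fun x y hx hy => ?_) (fun t s h x m g => ?_) c
  · exact ⟨0, by rw [map_zero]; exact zero_mem _⟩
  · obtain ⟨n, hn⟩ := hx
    obtain ⟨n', hn'⟩ := hy
    refine ⟨max n n', ?_⟩
    rw [map_add]
    exact add_mem ((leadingData p e).gr_mono k (le_max_left _ _) hn)
      ((leadingData p e).gr_mono k (le_max_right _ _) hn')
  · obtain ⟨r, hr⟩ := exists_mem_fil e x
    refine ⟨p * t + s + r, ?_⟩
    rw [toTot_incl, termToTot_tmul]
    have hm : Multiset.card (m : Multiset I) = t := m.2
    refine (leadingData p e).single_mem_gr_of_mem (r := r) (s := s) ?_ (by rw [hm, h])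
      (by rw [hm])
    refine ExteriorAlgebra.tmul_mem_coefDegree ?_ (exteriorPower.ιMulti F s g).2
    change x ∈ Submodule.span F (pbw e '' _)
    rw [funext (pbw_apply e)]
    exact hr

theorem exact_d (k : ℕ) (hk : k + 1 < p) : Function.Exact (d p e (k + 1)) (d p e k) := by
  intro c
  constructor
  · intro hc
    obtain ⟨n, hn⟩ := exists_toTot_mem_gr e (k + 1) c
    obtain ⟨a, ha, hac⟩ := (leadingData p e).exists_totD_eq (Fact.out : p.Prime).two_le hk hn
      (by rw [← toTot_d, hc, map_zero])
    obtain ⟨y, rfl⟩ := exists_toTot_eq e ha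
    refine ⟨y, toTot_injective e _ ?_⟩
    rw [toTot_d, hac]
  · rintro ⟨y, rfl⟩
    exact LinearMap.congr_fun (d_comp_d e k) y

end Differential

end Comparison

end AbelianComplex

/-! ### The augmentation -/

namespace AbelianComplex

open RestrictedUEA

variable {F : Type*} [Field F] {p : ℕ} [Fact p.Prime] [CharP F p]
  {L : Type*} [LieRing L] [LieAlgebra F L] [RestrictedLieAlgebra F p L]
  {I : Type*} (e : Basis I F L)

/-- The identification of `U_res(L)` with `C_0`. -/
noncomputable def ofC₀ : RestrictedUEA F p L →ₗ[RestrictedUEA F p L] C F p L 0 :=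
  LinearMap.toSpanSingleton (RestrictedUEA F p L) (C F p L 0) (incl F p L 0 0 0 rfl
    (1 ⊗ₜ (symMonomial (FrobTwist.basis F p e) Sym.nil ⊗ₜ exteriorPower.ιMulti F 0 ![])))

theorem ofC₀_apply (x : RestrictedUEA F p L) (m : Sym I 0) (g : Fin 0 → L) :
    ofC₀ e x = incl F p L 0 0 0 rfl
      (x ⊗ₜ (symMonomial (FrobTwist.basis F p e) m ⊗ₜ exteriorPower.ιMulti F 0 g)) := by
  rw [ofC₀, LinearMap.toSpanSingleton_apply, ← map_smul, TensorProduct.smul_tmul', smul_eq_mul,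
    mul_one, Subsingleton.elim g ![], Subsingleton.elim m Sym.nil]

theorem ofC₀_surjective : Function.Surjective (ofC₀ (p := p) e) := by
  refine complex_induction e (P := fun c => ∃ x, ofC₀ e x = c) ⟨0, map_zero _⟩ ?_ ?_
  · rintro _ _ ⟨x, rfl⟩ ⟨y, rfl⟩
    exact ⟨x + y, map_add _ _ _⟩
  · intro t s h x m g
    obtain rfl : t = 0 := by omega
    obtain rfl : s = 0 := by omega
    exact ⟨x, ofC₀_apply e x m g⟩

theorem augC_ofC₀ (x : RestrictedUEA F p L) : augC F p L (ofC₀ e x) = aug F p L x := by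
  have h1 : augC F p L (incl F p L 0 0 0 rfl (x ⊗ₜ (symMonomial (FrobTwist.basis F p e) Sym.nil ⊗ₜ
      exteriorPower.ιMulti F 0 ![]))) = augTerm F p L _ :=
    DirectSum.toModule_lof (RestrictedUEA F p L)
      (M := fun q : Idx 0 => Term F p L q.1.1 q.1.2) ⟨(0, 0), rfl⟩ _
  rw [ofC₀_apply e x Sym.nil ![], h1]
  have h2 : (symMonomial (FrobTwist.basis F p e) (Sym.nil : Sym I 0) :
      SymmetricAlgebra F (FrobTwist F p L)) = 1 := by
    rw [symMonomial_coe]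
    simp
  have h3 : ((exteriorPower.ιMulti F 0 (![] : Fin 0 → L) : ⋀[F]^0 L) : ExteriorAlgebra F L) = 1 :=
    ExteriorAlgebra.ιMulti_zero_apply _
  change aug F p L x * (SymmetricAlgebra.algebraMapInv (symMonomial (FrobTwist.basis F p e)
    (Sym.nil : Sym I 0) : SymmetricAlgebra F (FrobTwist F p L)) * ExteriorAlgebra.algebraMapInv
      ((exteriorPower.ιMulti F 0 (![] : Fin 0 → L) : ⋀[F]^0 L) : ExteriorAlgebra F L)) = _
  rw [h2, h3, map_one, map_one, mul_one, mul_one]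

theorem augC_surjective : Function.Surjective (augC F p L) := by
  intro a
  refine ⟨ofC₀ (Basis.ofVectorSpace F L) (algebraMap F _ (show F from a)), ?_⟩
  rw [augC_ofC₀, AlgHom.commutes]
  rfl

variable [IsLieAbelian L]

theorem d_zero_incl (x : RestrictedUEA F p L) (m : Sym I 0) (g : Fin 1 → L) :
    d p e 0 (incl F p L 1 0 1 rfl
      (x ⊗ₜ (symMonomial (FrobTwist.basis F p e) m ⊗ₜ exteriorPower.ιMulti F 1 g))) =
      ofC₀ e (ι F p L (g 0) * x) := by
  have h1 : d p e 0 (incl F p L 1 0 1 rfl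
      (x ⊗ₜ (symMonomial (FrobTwist.basis F p e) m ⊗ₜ exteriorPower.ιMulti F 1 g))) =
      dKFrom F p L 0 0 1 rfl _ + dPFrom p e 0 0 1 rfl _ :=
    DirectSum.toModule_lof (RestrictedUEA F p L)
      (M := fun q : Idx 1 => Term F p L q.1.1 q.1.2) ⟨(0, 1), rfl⟩ _
  rw [h1, dPFrom, LinearMap.zero_apply, add_zero, dKFrom, LinearMap.comp_apply, dK_apply,
    Fin.sum_univ_one, Fin.val_zero, pow_zero, one_smul, ← ofC₀_apply]

theorem augC_comp_d : augC F p L ∘ₗ d p e 0 = 0 := by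
  refine LinearMap.ext fun c => complex_induction e (P := fun c => augC F p L (d p e 0 c) = 0)
    ?_ (fun x y hx hy => ?_) (fun t s h x m g => ?_) c
  · rw [map_zero, map_zero]
  · rw [map_add, map_add, hx, hy, add_zero]
  · obtain rfl : t = 0 := by omega
    obtain rfl : s = 1 := by omega
    rw [d_zero_incl, augC_ofC₀, map_mul, aug_ι, zero_mul]
    rfl

/-- The augmentation ideal is generated by `L`. -/
theorem ofC₀_sub_aug_mem_range (x : RestrictedUEA F p L) :
    ofC₀ e (x - algebraMap F _ (aug F p L x)) ∈ LinearMap.range (d p e 0) := by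
  have hS : (((LinearMap.range (d p e 0)).comap (ofC₀ e)).restrictScalars F).comap
      (LinearMap.id - Algebra.linearMap F _ ∘ₗ (aug F p L).toLinearMap) = ⊤ := by
    refine eq_top_of_ι_mul_mem _ ?_ fun g x _ => ?_
    · refine ⟨0, ?_⟩
      simp
    · refine ⟨incl F p L 1 0 1 rfl
        (x ⊗ₜ (symMonomial (FrobTwist.basis F p e) Sym.nil ⊗ₜ exteriorPower.ιMulti F 1 ![g])), ?_⟩
      rw [d_zero_incl]
      simp [aug_ι]
  exact hS.ge (Submodule.mem_top (x := x))

theorem exact_d_augC : Function.Exact (d p e 0) (augC F p L) := by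
  intro c
  constructor
  · intro hc
    obtain ⟨x, rfl⟩ := ofC₀_surjective e c
    rw [augC_ofC₀] at hc
    have h := ofC₀_sub_aug_mem_range e x
    have h0 : aug F p L x = 0 := hc
    rwa [h0, map_zero, sub_zero] at h
  · rintro ⟨y, rfl⟩
    exact LinearMap.congr_fun (augC_comp_d e) y

end AbelianComplex

/-! ### Dimension shifting along a partial resolution -/

namespace CategoryTheory.Abelian.Ext

universe w v u'

variable {𝒞 : Type u'} [Category.{v} 𝒞] [Abelian 𝒞] [HasExt.{w} 𝒞]

/-- The maps out of the `k`-th syzygy `Z k` that vanish in `Ext`: for `k > 0` those that extend to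
the projective object which contains `Z k`. -/
def extendable {Z P : ℕ → 𝒞} (i : ∀ k, Z (k + 1) ⟶ P k) (M : 𝒞) : (k : ℕ) → Set (Z k ⟶ M)
  | 0 => {0}
  | k + 1 => Set.range fun g : P k ⟶ M => i k ≫ g

/-- If `0 → Z (k + 1) → P k → Z k → 0` is exact with `P k` projective for `k < n`, composition with
the iterated extension class maps `Ext^m (Z k, M)` onto `Ext^(k + m) (Z 0, M)`, for `k ≤ n`. This
map is injective for `m > 0`, and for `m = 0` its kernel is described by `extendable`. -/
theorem exists_iterated_extClass {Z P : ℕ → 𝒞} [∀ k, Projective (P k)]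
    (i : ∀ k, Z (k + 1) ⟶ P k) (q : ∀ k, P k ⟶ Z k) (w : ∀ k, i k ≫ q k = 0) (n : ℕ)
    (hS : ∀ k < n, (ShortComplex.mk (i k) (q k) (w k)).ShortExact) (k : ℕ) (hk : k ≤ n) :
    ∃ η : Ext (Z 0) (Z k) k, ∀ M : 𝒞,
      (∀ m l (h : k + m = l) (y : Ext (Z 0) M l), ∃ x : Ext (Z k) M m, η.comp x h = y) ∧
      (∀ m l (h : k + (m + 1) = l) (x : Ext (Z k) M (m + 1)), η.comp x h = 0 → x = 0) ∧
      ∀ f : Z k ⟶ M, η.comp (mk₀ f) (add_zero k) = 0 ↔ f ∈ extendable i M k := by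
  induction k with
  | zero =>
    refine ⟨mk₀ (𝟙 _), fun M => ⟨fun m l h y => ?_, fun m l h x hx => ?_, fun f => ?_⟩⟩
    · obtain rfl : m = l := by omega
      exact ⟨y, mk₀_id_comp y⟩
    · obtain rfl : m + 1 = l := by omega
      rwa [mk₀_id_comp] at hx
    · rw [mk₀_comp_mk₀, Category.id_comp, mk₀_eq_zero_iff]
      rfl
  | succ k ih =>
    obtain ⟨η, hη⟩ := ih (Nat.le_of_succ_le hk)
    have hE := hS k hk
    refine ⟨η.comp hE.extClass rfl, fun M => ?_⟩
    obtain ⟨hsurj, hinj, -⟩ := hη M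
    -- The map for `k + 1` is the connecting map of the `k`-th short exact sequence followed by the
    -- map for `k`, and `Ext` out of `P k` vanishes in positive degree.
    have hassoc : ∀ m l (h : k + 1 + m = l) (x : Ext (Z (k + 1)) M m),
        (η.comp hE.extClass rfl).comp x h =
          η.comp (hE.extClass.comp x (add_comm 1 m)) (by omega) := fun m l h x =>
      comp_assoc η hE.extClass x _ _ (by omega)
    have hzero : ∀ m l (h : k + 1 + m = l) (x : Ext (Z (k + 1)) M m),
        (η.comp hE.extClass rfl).comp x h = 0 →
          ∃ y : Ext (P k) M m, (mk₀ (i k)).comp y (zero_add m) = x := fun m l h x hx => by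
      rw [hassoc] at hx
      exact contravariant_sequence_exact₁ hE M x _ (hinj m l (by omega) _ hx)
    refine ⟨fun m l h y => ?_, fun m l h x hx => ?_, fun f => ⟨fun hf => ?_, ?_⟩⟩
    · obtain ⟨x, rfl⟩ := hsurj (m + 1) l (by omega) y
      obtain ⟨x', hx'⟩ := contravariant_sequence_exact₃ hE M x (eq_zero_of_projective _)
        (add_comm 1 m)
      exact ⟨x', by rw [hassoc, hx']⟩
    · obtain ⟨y, rfl⟩ := hzero _ _ h x hx
      rw [eq_zero_of_projective y, comp_zero]
    · obtain ⟨y, hy⟩ := hzero _ _ _ _ hf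
      obtain ⟨g, rfl⟩ := (mk₀_bijective _ _).2 y
      rw [mk₀_comp_mk₀] at hy
      exact ⟨g, (mk₀_bijective _ _).1 hy⟩
    · rintro ⟨g, rfl⟩
      rw [hassoc, ← mk₀_comp_mk₀, ← comp_assoc_of_second_deg_zero, hE.extClass_comp, zero_comp,
        comp_zero]

/-- Composition with a fixed extension class, as a linear map. -/
noncomputable def precompHom (R : Type*) [Ring R] [Linear R 𝒞] {X Y : 𝒞} {k : ℕ} (η : Ext X Y k)
    (M : 𝒞) : (Y ⟶ M) →ₗ[R] Ext X M k where
  toFun f := η.comp (mk₀ f) (add_zero k)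
  map_add' f g := by rw [mk₀_add, comp_add]
  map_smul' r f := by rw [mk₀_smul, comp_smul, RingHom.id_apply]

theorem precompHom_comp (R : Type*) [Ring R] [Linear R 𝒞] {X Y : 𝒞} {k : ℕ} (η : Ext X Y k)
    {M N : 𝒞} (g : Y ⟶ M) (f : M ⟶ N) :
    precompHom R η N (g ≫ f) = (precompHom R η M g).comp (mk₀ f) (add_zero k) := by
  change η.comp (mk₀ (g ≫ f)) (add_zero k) =
    (η.comp (mk₀ g) (add_zero k)).comp (mk₀ f) (add_zero k)
  rw [comp_assoc_of_third_deg_zero, mk₀_comp_mk₀]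

end CategoryTheory.Abelian.Ext

/-! ### The comparison with `Ext` -/

namespace AbelianComplex

open RestrictedUEA CategoryTheory CategoryTheory.Abelian

variable {F : Type u} [Field F] {p : ℕ} [Fact p.Prime] [CharP F p]
  {L : Type u} [LieRing L] [LieAlgebra F L] [RestrictedLieAlgebra F p L]
  {I : Type*} (e : Basis I F L)

variable (F p L) in
/-- `C_k` as an object of the category of modules. -/
noncomputable def chain (k : ℕ) : ModuleCat.{u} (RestrictedUEA F p L) := ModuleCat.of _ (C F p L k)

instance (k : ℕ) : Projective (chain F p L k) :=
  have : Module.Projective (RestrictedUEA F p L) (C F p L k) := inferInstance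
  have : Module.Projective (RestrictedUEA F p L) (chain F p L k) := this
  (chain F p L k).projective_of_categoryTheory_projective

/-- The differential as a morphism of modules. -/
noncomputable def chainD (k : ℕ) : chain F p L (k + 1) ⟶ chain F p L k := ModuleCat.ofHom (d p e k)

/-- The syzygies of the complex: `F` in degree `0`, the image of `d_k` in degree `k > 0`. -/
noncomputable def syzygy : ℕ → ModuleCat.{u} (RestrictedUEA F p L)
  | 0 => ModuleCat.of _ (Triv F p L)
  | k + 1 => ModuleCat.of (RestrictedUEA F p L) (LinearMap.range (chainD e k).hom)

/-- The inclusion of the `(k + 1)`-st syzygy in `C_k`. -/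
noncomputable def syzygyι (k : ℕ) : syzygy (p := p) e (k + 1) ⟶ chain F p L k :=
  ModuleCat.ofHom (LinearMap.range (chainD e k).hom).subtype

/-- The projection of `C_k` onto the `k`-th syzygy. -/
noncomputable def syzygyπ : (k : ℕ) → (chain F p L k ⟶ syzygy (p := p) e k)
  | 0 => ModuleCat.ofHom (augC F p L)
  | k + 1 => ModuleCat.ofHom (chainD e k).hom.rangeRestrict

theorem syzygyπ_surjective (k : ℕ) : Function.Surjective (syzygyπ (p := p) e k).hom := by
  cases k with
  | zero => exact augC_surjective
  | succ k => exact (chainD e k).hom.surjective_rangeRestrict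

variable [IsLieAbelian L]

theorem syzygyπ_chainD (k : ℕ) (c : chain F p L (k + 1)) :
    (syzygyπ e k).hom ((chainD e k).hom c) = 0 := by
  cases k with
  | zero => exact LinearMap.congr_fun (augC_comp_d e) c
  | succ k => exact Subtype.ext (LinearMap.congr_fun (d_comp_d e k) c)

theorem exact_chainD_syzygyπ {k : ℕ} (hk : k < p) :
    Function.Exact (chainD (p := p) e k).hom (syzygyπ e k).hom := by
  cases k with
  | zero => exact exact_d_augC e
  | succ k => exact fun c => Subtype.ext_iff.trans (exact_d e k hk c)

theorem syzygyι_comp_π (k : ℕ) : syzygyι e k ≫ syzygyπ (p := p) e k = 0 := by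
  refine ModuleCat.hom_ext (LinearMap.ext ?_)
  rintro ⟨_, c, rfl⟩
  exact syzygyπ_chainD e k c

theorem syzygy_shortExact {k : ℕ} (hk : k < p) :
    (ShortComplex.mk (syzygyι e k) (syzygyπ (p := p) e k) (syzygyι_comp_π e k)).ShortExact := by
  refine ModuleCat.shortComplex_shortExact _ (fun c => ?_) Subtype.val_injective
    (syzygyπ_surjective e k)
  refine (exact_chainD_syzygyπ e hk c).trans ⟨?_, ?_⟩
  · rintro ⟨y, rfl⟩
    exact ⟨⟨_, y, rfl⟩, rfl⟩
  · rintro ⟨⟨_, y, rfl⟩, rfl⟩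
    exact ⟨y, rfl⟩

/-- Maps out of the `k`-th syzygy are cocycles. -/
noncomputable def toCocycles (M : ModuleCat.{u} (RestrictedUEA F p L)) (k : ℕ) :
    (syzygy e k ⟶ M) →ₗ[F] cocycles F p e M k where
  toFun f := ⟨(syzygyπ e k ≫ f).hom, LinearMap.ext fun c =>
    (congrArg f.hom (syzygyπ_chainD e k c)).trans (map_zero f.hom)⟩
  map_add' _ _ := rfl
  map_smul' _ _ := rfl

/-- Since `C_{k+1} → C_k → Z_k → 0` is exact, each cocycle factors through the `k`-th
syzygy `Z_k`. -/
theorem toCocycles_bijective (M : ModuleCat.{u} (RestrictedUEA F p L)) {k : ℕ} (hk : k < p) :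
    Function.Bijective (toCocycles e M k) := by
  constructor
  · intro f g h
    refine ModuleCat.hom_ext (LinearMap.ext fun z => ?_)
    obtain ⟨c, rfl⟩ := syzygyπ_surjective e k z
    exact LinearMap.congr_fun (congrArg Subtype.val h) c
  · rintro ⟨φ, hφ⟩
    let φ' : chain F p L k →ₗ[RestrictedUEA F p L] M := φ
    have hker : LinearMap.ker (syzygyπ e k).hom ≤ LinearMap.ker φ' := by
      intro c hc
      obtain ⟨y, rfl⟩ := (exact_chainD_syzygyπ e hk c).mp hc
      exact LinearMap.congr_fun hφ y
    have hf : ((LinearMap.ker (syzygyπ e k).hom).liftQ φ' hker ∘ₗ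
        ((syzygyπ e k).hom.quotKerEquivOfSurjective (syzygyπ_surjective e k)).symm.toLinearMap) ∘ₗ
          (syzygyπ e k).hom = φ' := LinearMap.ext fun c => by
      rw [LinearMap.comp_apply, LinearMap.comp_apply, LinearEquiv.coe_coe,
        LinearMap.quotKerEquivOfSurjective_symm_apply, Submodule.liftQ_apply]
    exact ⟨ModuleCat.ofHom _, Subtype.ext hf⟩

theorem toCocycles_mem_coboundaries_iff (M : ModuleCat.{u} (RestrictedUEA F p L)) {k : ℕ}
    (f : syzygy e k ⟶ M) :
    (toCocycles e M k f : C F p L k →ₗ[RestrictedUEA F p L] M) ∈ coboundaries F p e M k ↔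
      f ∈ Ext.extendable (P := chain F p L) (syzygyι e) M k := by
  cases k with
  | zero =>
    constructor
    · intro h
      refine ModuleCat.hom_ext (LinearMap.ext fun z => ?_)
      obtain ⟨c, rfl⟩ := syzygyπ_surjective e 0 z
      exact LinearMap.congr_fun h c
    · rintro rfl
      exact LinearMap.zero_comp _
  | succ k =>
    constructor
    · rintro ⟨g, hg⟩
      let g' : chain F p L k →ₗ[RestrictedUEA F p L] M := g
      refine ⟨ModuleCat.ofHom g', ModuleCat.hom_ext (LinearMap.ext ?_)⟩
      rintro ⟨_, c, rfl⟩
      exact LinearMap.congr_fun hg c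
    · rintro ⟨g, rfl⟩
      exact ⟨g.hom, rfl⟩

set_option maxHeartbeats 1000000 in
/-- If composition with `η` maps `Hom (Z_k, M)` onto `Ext^k (F, M)`, and its kernel consists of the
maps that extend to `C_{k-1}`, then it identifies the cohomology with `Ext`. -/
theorem exists_cohomology_equiv_ext_of_class {k : ℕ} (hk : k < p)
    (η : Ext (ModuleCat.of (RestrictedUEA F p L) (Triv F p L)) (syzygy e k) k)
    (hη : ∀ M : ModuleCat.{u} (RestrictedUEA F p L),
      (∀ y : Ext (ModuleCat.of (RestrictedUEA F p L) (Triv F p L)) M k,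
        ∃ x : Ext (syzygy e k) M 0, η.comp x (add_zero k) = y) ∧
      ∀ f : syzygy e k ⟶ M, η.comp (Ext.mk₀ f) (add_zero k) = 0 ↔
        f ∈ Ext.extendable (P := chain F p L) (syzygyι e) M k) :
    ∃ θ : ∀ M : ModuleCat.{u} (RestrictedUEA F p L),
      H F p e M k ≃ₗ[F] Ext (ModuleCat.of (RestrictedUEA F p L) (Triv F p L)) M k,
    ∀ (M N : ModuleCat.{u} (RestrictedUEA F p L)) (f : M ⟶ N)
      (φ : cocycles F p e M k) (ψ : cocycles F p e N k),
      (ψ : C F p L k →ₗ[RestrictedUEA F p L] N) = f.hom ∘ₗ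
        (φ : C F p L k →ₗ[RestrictedUEA F p L] M) →
      θ N (cls ψ) = (θ M (cls φ)).comp (Ext.mk₀ f) (add_zero k) := by
  let T (M : ModuleCat.{u} (RestrictedUEA F p L)) : (syzygy e k ⟶ M) ≃ₗ[F] cocycles F p e M k :=
    LinearEquiv.ofBijective (toCocycles e M k) (toCocycles_bijective e M hk)
  let Φ (M : ModuleCat.{u} (RestrictedUEA F p L)) : cocycles F p e M k →ₗ[F]
      Ext (ModuleCat.of (RestrictedUEA F p L) (Triv F p L)) M k :=
    Ext.precompHom F η M ∘ₗ (T M).symm.toLinearMap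
  have hT : ∀ M f, Φ M (T M f) = Ext.precompHom F η M f := fun M f =>
    congrArg (Ext.precompHom F η M) ((T M).symm_apply_apply f)
  have hsurj : ∀ M, Function.Surjective (Φ M) := fun M y => by
    obtain ⟨x, hx⟩ := (hη M).1 y
    obtain ⟨f, rfl⟩ := (Ext.mk₀_bijective _ _).2 x
    exact ⟨T M f, (hT M f).trans hx⟩
  have hker : ∀ M, (coboundaries F p e M k).submoduleOf (cocycles F p e M k) =
      LinearMap.ker (Φ M) := fun M => by
    refine Submodule.ext fun φ => ?_
    obtain ⟨f, rfl⟩ := (T M).surjective φ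
    refine (toCocycles_mem_coboundaries_iff e M f).trans (((hη M).2 f).symm.trans ?_)
    exact Eq.congr_left (hT M f).symm
  refine ⟨fun M => (Submodule.quotEquivOfEq _ _ (hker M)).trans
    ((Φ M).quotKerEquivOfSurjective (hsurj M)), fun M N f φ ψ h => ?_⟩
  change Φ N ψ = (Φ M φ).comp (Ext.mk₀ f) (add_zero k)
  obtain ⟨g, rfl⟩ := (T M).surjective φ
  have hψ : ψ = T N (g ≫ f) := Subtype.ext h
  exact (congrArg (Φ N) hψ).trans ((hT N _).trans ((Ext.precompHom_comp F η g f).trans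
    (congrArg (fun y => y.comp (Ext.mk₀ f) (add_zero k)) (hT M g).symm)))

theorem exists_cohomology_equiv_ext {k : ℕ} (hk : k < p) :
    ∃ θ : ∀ M : ModuleCat.{u} (RestrictedUEA F p L),
      H F p e M k ≃ₗ[F] Ext (ModuleCat.of (RestrictedUEA F p L) (Triv F p L)) M k,
    ∀ (M N : ModuleCat.{u} (RestrictedUEA F p L)) (f : M ⟶ N)
      (φ : cocycles F p e M k) (ψ : cocycles F p e N k),
      (ψ : C F p L k →ₗ[RestrictedUEA F p L] N) = f.hom ∘ₗ
        (φ : C F p L k →ₗ[RestrictedUEA F p L] M) →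
      θ N (cls ψ) = (θ M (cls φ)).comp (Ext.mk₀ f) (add_zero k) := by
  have h := Ext.exists_iterated_extClass (Z := syzygy e) (P := chain F p L) (syzygyι e) (syzygyπ e)
    (syzygyι_comp_π e) k (fun j hj => syzygy_shortExact e (hj.trans hk)) k le_rfl
  exact h.elim fun η hη => exists_cohomology_equiv_ext_of_class e hk η fun M =>
    ⟨(hη M).1 0 k (add_zero k), (hη M).2.2⟩

end AbelianComplex

open AbelianComplex in
theorem mainTheorem1 {p : ℕ} [Fact p.Prime] {F : Type u} [Field F] [CharP F p]
    {𝔤 : Type u} [LieRing 𝔤] [LieAlgebra F 𝔤] [RestrictedLieAlgebra F p 𝔤] [IsLieAbelian 𝔤]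
    {I : Type*} (e : Basis I F 𝔤) :
    -- `C` is an augmented complex of free `U_res(𝔤)`-modules
    (∀ k, Module.Free (RestrictedUEA F p 𝔤) (C F p 𝔤 k)) ∧
    (∀ k, d p e k ∘ₗ d p e (k + 1) = 0) ∧
    augC F p 𝔤 ∘ₗ d p e 0 = 0 ∧
    -- it is exact in degrees `0 ≤ k < p`
    Function.Surjective (augC F p 𝔤) ∧
    Function.Exact (d p e 0) (augC F p 𝔤) ∧
    (∀ k, k + 1 < p → Function.Exact (d p e (k + 1)) (d p e k)) ∧
    -- its cohomology is `Ext` in degrees `0 ≤ k < p`, naturally in the coefficients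
    ∀ k < p,
      ∃ θ : ∀ M : ModuleCat.{u} (RestrictedUEA F p 𝔤),
          H F p e M k ≃ₗ[F] CategoryTheory.Abelian.Ext
            (ModuleCat.of (RestrictedUEA F p 𝔤) (RestrictedUEA.Triv F p 𝔤)) M k,
        ∀ (M N : ModuleCat.{u} (RestrictedUEA F p 𝔤)) (f : M ⟶ N)
          (φ : cocycles F p e M k) (ψ : cocycles F p e N k),
          (ψ : C F p 𝔤 k →ₗ[RestrictedUEA F p 𝔤] N) = f.hom ∘ₗ
            (φ : C F p 𝔤 k →ₗ[RestrictedUEA F p 𝔤] M) →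
          θ N (cls ψ) = (θ M (cls φ)).comp (CategoryTheory.Abelian.Ext.mk₀ f) (add_zero k) := by
  exact ⟨fun _ => inferInstance, d_comp_d e, augC_comp_d e, augC_surjective, exact_d_augC e,
    exact_d e, fun _ hk => exists_cohomology_equiv_ext e hk⟩
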